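/- **Setting.** Let $m\ge 2$ and $S_j(x)=\rho_jx+b_j$, $0<\rho_j<1$, $1\le j\le m$, with $b_1\le\dots\le b_m$, $S_1(0)=0$, $S_m(1)=1$ and $S_j((0,1))\subset(0,1)$ for all $j$. Let $K$ be the attractor, i.e. the non-empty compact set with $K=\bigcup_jS_jK$, and assume $\alpha:=\dim_HK<1$. For a finite word $\mathbf i=i_1\cdots i_r$ over $\{1,\dots,m\}$ put $S_{\mathbf i}=S_{i_1}\circ\cdots\circ S_{i_r}$, and $|\mathbf i|=r$. Let $(\mathcal M_k)_{k\ge0}$ be a sequence of nested index sets: finite sets of words with $\mathcal M_0=\{\emptyset\}$ such that (1) $\min_{\mathbf i\in\mathcal M_k}|\mathbf i|$ and $\max_{\mathbf i\in\mathcal M_k}|\mathbf i|$ are non-decreasing in $k$ and tend to $\infty$; (2) no word of $\mathcal M_k$ is an initial segment of another word of $\mathcal M_k$; (3) every word longer than all words of $\mathcal M_k$ has an initial segment in $\mathcal M_k$; (4) every word shorter than all words of $\mathcal M_k$ is an initial segment of a word of $\mathcal M_k$; (5) for some positive integer $L$, $|\mathbf j|-|\mathbf i|\le L$ whenever $k\ge0$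 and $\mathbf i\in\mathcal M_k$ is an initial segment of $\mathbf j\in\mathcal M_{k+1}$. Assume that the open sets $U_k:=\bigcup_{\mathbf i\in\mathcal M_k}S_{\mathbf i}((0,1))$ satisfy $U_{k+1}\subset U_k$ for all $k$. The closures of the connected components of $U_k$ are the $k$-th generation *islands*; an island is always considered together with its generation. The gaps of positive length in $[0,1]$ between consecutive $k$-th generation islands are the $k$-th generation *lakes*. $\mathcal F_k$ is the finite field of sets generated by the $k$-th generation islands and lakes, endpoints being disregarded (lakes are taken closed), so that for $x>0$, $[0,x]\in\mathcal F_k$ iff $x$ is an endpoint of a $k$-th generation island, and for $y<1$, $[y,1]\in\mathcal F_k$ iff $y$ is such an endpoint. For a $k$-th generation island $I$ let $V(I)$ be the set of maps $S_{\mathbf i}$, $\mathbf i\in\mathcal M_k$, with $S_{\mathbf i}([0,1])\subset I$. Islands $I,I'$ of generations $k,k'$ are *equivalent* (have the same overlap type) if there is an invertible affine map $\tau$ of $\mathbb R$ with $\tau(I)=I'$, $V(I')=\{\tau\circ f:f\in V(I)\}$, and such that for all $l\ge1$ and all sets $J$: $J$ is a $(k+l)$-th generation island contained in $I$ iff $\tau(J)$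 is a $(k'+l)$-th generation island contained in $I'$. Assume: * (generalized finite type condition) there are only finitely many overlap types $\mathcal T_1,\dots,\mathcal T_q$; * the weighted incidence matrix $A_\alpha(i,j)=\sum_J(|J|/|I|)^\alpha$ is irreducible, where $I$ is a fixed island of type $\mathcal T_i$ and $J$ runs over the islands of type $\mathcal T_j$ of the next generation contained in $I$; * (Assumption A) for every island $I$ and different $f,g\in V(I)$, $f([0,1])\not\subset g([0,1])$; * (Assumption B) $S_1([0,1])\cap K=S_1K$ and $S_m([0,1])\cap K=S_mK$. Let $\lambda=\mathcal H^\alpha|_K/\mathcal H^\alpha(K)$, $d(J)=\lambda(J)/|J|^\alpha$ for intervals $J$ of positive length, and let $d_{\min}$ be the infimum of $d(J)$ over all closed intervals $J\subset[0,1]$ of positive length whose midpoint lies in $K$. **Theorem 4.16.** There is a least $k_0\ge0$ such that every $(k_0+1)$-th generation island is equivalent to an island of generation at most $k_0$; let $[a_1,b_1],\dots,[a_l,b_l]$ be the $(k_0+1)$-th generation islands in increasing order ($b_i\le a_{i+1}$). There are a least $k$ such that the leftmost $k$-th generation island (the one containing $0$) has length at most $\rho_1$, and a least $k'$ such that the rightmost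 $k'$-th generation island (the one containing $1$) has length at most $\rho_m$. The minima $$\underline D_0=\min\{d([0,x]):x>0,\ [0,x]\in\mathcal F_k\},\qquad \underline D_1=\min\{d([y,1]):y<1,\ [y,1]\in\mathcal F_{k'}\}$$ exist, and $$d_{\min}=\min\{2^{-\alpha}\underline D_0,\ 2^{-\alpha}\underline D_1,\ D\},\qquad D=\min_{1\le i_1<i_2<l}\frac{\sum_{i=i_1+1}^{i_2}\lambda([a_i,b_i])}{\bigl(a_{i_2+1}-b_{i_1}-2\,\mathrm{dist}(\tfrac{a_{i_2+1}+b_{i_1}}2,K)\bigr)^\alpha},$$ where $D=\infty$ if there is no pair $i_1<i_2<l$. Moreover the $\alpha$-dimensional packing measure of $K$ (defined with $|B|=2r$ for balls $B$ of radius $r$) is $\mathcal P^\alpha(K)=d_{\min}^{-1}$. -/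

import Mathlib

open Set Filter Topology MeasureTheory
open scoped ENNReal NNReal

/-- An orientation preserving linear iterated function system on the real line with `n + 1` maps
`x ↦ ρ j * x + b j`, `0 < ρ j < 1`. The maps `S_1, …, S_m` are indexed by `0, …, Fin.last n`,
so that `m = n + 1`. -/
structure LinearIFS (n : ℕ) where
  ρ : Fin (n + 1) → ℝ
  b : Fin (n + 1) → ℝ
  ρ_pos : ∀ j, 0 < ρ j
  ρ_lt_one : ∀ j, ρ j < 1

namespace LinearIFS

variable {n : ℕ}

/-- The similitude `S_j`. -/
def map (S : LinearIFS n) (j : Fin (n + 1)) (x : ℝ) : ℝ := S.ρ j * x + S.b j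

/-- `S_w = S_{w_1} ∘ ⋯ ∘ S_{w_k}` for a finite word `w`; the empty word gives the identity. -/
def wordMap (S : LinearIFS n) : List (Fin (n + 1)) → ℝ → ℝ
  | [] => id
  | j :: w => S.map j ∘ S.wordMap w

/-- The conditions (1) -- (5) on a sequence of nested index sets. -/
structure IsNestedIndexSeq (M : ℕ → Finset (List (Fin (n + 1)))) : Prop where
  zero : M 0 = {[]}
  min_mono : Monotone fun k => sInf (List.length '' (M k : Set (List (Fin (n + 1)))))
  min_tendsto :
    Tendsto (fun k => sInf (List.length '' (M k : Set (List (Fin (n + 1)))))) atTop atTop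
  max_mono : Monotone fun k => (M k).sup List.length
  max_tendsto : Tendsto (fun k => (M k).sup List.length) atTop atTop
  incomparable : ∀ k, ∀ v ∈ M k, ∀ w ∈ M k, v ≠ w → ¬ v <+: w ∧ ¬ w <+: v
  long : ∀ k, ∀ w : List (Fin (n + 1)), (M k).sup List.length < w.length → ∃ v ∈ M k, v <+: w
  short : ∀ k, ∀ w : List (Fin (n + 1)),
    w.length < sInf (List.length '' (M k : Set (List (Fin (n + 1))))) → ∃ v ∈ M k, w <+: v
  bounded : ∃ L : ℕ, 0 < L ∧
    ∀ k, ∀ v ∈ M k, ∀ w ∈ M (k + 1), v <+: w → w.length - v.length ≤ L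

variable (S : LinearIFS n) (M : ℕ → Finset (List (Fin (n + 1))))

/-- The union of the open intervals `S_w (0,1)`, `w ∈ M k`. -/
def openUnion (k : ℕ) : Set ℝ := ⋃ w ∈ M k, S.wordMap w '' Ioo 0 1

/-- The set of `k`-th generation islands: the closures of the connected components of the union of
the open intervals `S_w (0,1)`, `w ∈ M k`. -/
def islands (k : ℕ) : Set (Set ℝ) :=
  {I | ∃ x ∈ S.openUnion M k, I = closure (connectedComponentIn (S.openUnion M k) x)}

/-- The (closed) `k`-th generation lakes: the closures of the connected components of the part of
`[0,1]` not covered by the `k`-th generation islands. -/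
def lakes (k : ℕ) : Set (Set ℝ) :=
  {L | ∃ x ∈ Icc (0 : ℝ) 1 \ ⋃₀ S.islands M k,
    L = closure (connectedComponentIn (Icc (0 : ℝ) 1 \ ⋃₀ S.islands M k) x)}

/-- The `k`-th generation field: the finite field of sets generated by the islands and the lakes
of generation `k`. With closed islands and closed lakes as generators, the intervals `[0,x]`
(`0 < x`) and `[y,1]` (`y < 1`) in it are those for which `x`, resp. `y`, is an endpoint of
a `k`-th generation island. -/
def field (k : ℕ) : Set (Set ℝ) := generateSetAlgebra (S.islands M k ∪ S.lakes M k)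

/-- An island together with its generation. -/
@[ext] structure Island where
  gen : ℕ
  carrier : Set ℝ
  mem : carrier ∈ S.islands M gen

variable {S M}

/-- The maps `S_v` of the vertices `v ∈ V(I)`: those maps `S_w`, with `w` in the index set of the
generation of `I`, whose interval `S_w [0,1]` is contained in `I`. -/
def Island.vertexMaps (I : S.Island M) : Set (ℝ → ℝ) :=
  {f | ∃ w ∈ M I.gen, f = S.wordMap w ∧ f '' Icc 0 1 ⊆ I.carrier}

/-- Two islands are equivalent (have the same overlap type). -/
def Island.Equivalent (I I' : S.Island M) : Prop :=
  ∃ p q : ℝ, p ≠ 0 ∧ (fun x => p * x + q) '' I.carrier = I'.carrier ∧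
    I'.vertexMaps = (fun f => (fun x => p * x + q) ∘ f) '' I.vertexMaps ∧
    ∀ l : ℕ, 1 ≤ l → ∀ J : Set ℝ,
      (J ∈ S.islands M (I.gen + l) ∧ J ⊆ I.carrier) ↔
        ((fun x => p * x + q) '' J ∈ S.islands M (I'.gen + l) ∧
          (fun x => p * x + q) '' J ⊆ I'.carrier)

theorem Island.Equivalent.refl (I : S.Island M) : I.Equivalent I :=
  ⟨1, 0, one_ne_zero, by simp, by simp [Function.comp_def], by simp⟩

theorem Island.Equivalent.symm {I I' : S.Island M} (h : I.Equivalent I') : I'.Equivalent I := by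
  obtain ⟨p, q, hp, h1, h2, h3⟩ := h
  have hl : ∀ x : ℝ, p⁻¹ * (p * x + q) + -(p⁻¹ * q) = x := by intro x; field_simp; ring
  have hr : ∀ x : ℝ, p * (p⁻¹ * x + -(p⁻¹ * q)) + q = x := by intro x; field_simp; ring
  have hl' : ∀ A : Set ℝ,
      (fun x => p⁻¹ * x + -(p⁻¹ * q)) '' ((fun x => p * x + q) '' A) = A := by
    intro A; rw [image_image]; simp [hl]
  have hr' : ∀ A : Set ℝ,
      (fun x => p * x + q) '' ((fun x => p⁻¹ * x + -(p⁻¹ * q)) '' A) = A := by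
    intro A; rw [image_image]; simp [hr]
  refine ⟨p⁻¹, -(p⁻¹ * q), inv_ne_zero hp, ?_, ?_, ?_⟩
  · rw [← h1, hl']
  · rw [h2, image_image]
    simp [Function.comp_def, hl]
  · intro l hl1 J
    have := h3 l hl1 ((fun x => p⁻¹ * x + -(p⁻¹ * q)) '' J)
    rw [hr'] at this
    exact this.symm

theorem Island.Equivalent.trans {I I' I'' : S.Island M} (h : I.Equivalent I')
    (h' : I'.Equivalent I'') : I.Equivalent I'' := by
  obtain ⟨p, q, hp, h1, h2, h3⟩ := h
  obtain ⟨p', q', hp', h1', h2', h3'⟩ := h'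
  have hc : ∀ x : ℝ, p' * (p * x + q) + q' = p' * p * x + (p' * q + q') := by intro x; ring
  have hc' : ∀ A : Set ℝ, (fun x => p' * x + q') '' ((fun x => p * x + q) '' A) =
      (fun x => p' * p * x + (p' * q + q')) '' A := by
    intro A; rw [image_image]; simp [hc]
  refine ⟨p' * p, p' * q + q', mul_ne_zero hp' hp, ?_, ?_, ?_⟩
  · rw [← h1', ← h1, hc']
  · rw [h2', h2, image_image]
    simp [Function.comp_def, hc]
  · intro l hl1 J
    rw [h3 l hl1 J, h3' l hl1, hc']

variable (S M)

/-- Equivalence of islands, as a setoid. -/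
instance islandSetoid : Setoid (S.Island M) where
  r := Island.Equivalent
  iseqv := ⟨Island.Equivalent.refl, Island.Equivalent.symm, Island.Equivalent.trans⟩

/-- The overlap types. -/
abbrev OverlapType : Type := Quotient (S.islandSetoid M)

/-- The weighted incidence matrix, computed from a system `T` of representatives of the overlap
types: the entry `(i, j)` is the sum of `(|J| / |I|) ^ α` over the offspring `J` of `I = T i` (the
islands of the next generation contained in `I`) of overlap type `j`. -/
noncomputable def incidenceMatrix (T : S.OverlapType M → S.Island M) (α : ℝ) :
    Matrix (S.OverlapType M) (S.OverlapType M) ℝ :=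
  fun i j => ∑ᶠ J ∈ {J : S.Island M | J.gen = (T i).gen + 1 ∧ J.carrier ⊆ (T i).carrier ∧
      (⟦J⟧ : S.OverlapType M) = j},
    (Metric.diam J.carrier / Metric.diam (T i).carrier) ^ α

/-- No `(k+1)`-th generation island has a new overlap type. -/
def NoNewType (k : ℕ) : Prop :=
  ∀ I : S.Island M, I.gen = k + 1 → ∃ I' : S.Island M, I'.gen ≤ k ∧ I.Equivalent I'

/-- Assumption A: no constitutive interval of an island contains another one. -/
def AssumptionA : Prop :=
  ∀ I : S.Island M, ∀ f ∈ I.vertexMaps, ∀ g ∈ I.vertexMaps, f ≠ g →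
    ¬ f '' Icc 0 1 ⊆ g '' Icc 0 1

/-- Assumption B, for the attractor `K`. -/
def AssumptionB (K : Set ℝ) : Prop :=
  S.map 0 '' Icc 0 1 ∩ K = S.map 0 '' K ∧
    S.map (Fin.last n) '' Icc 0 1 ∩ K = S.map (Fin.last n) '' K

/-- `[a 1, b 1], …, [a l, b l]` are the `k`-th generation islands, listed in increasing order
(consecutive islands may touch). -/
def IsIslandList (k l : ℕ) (a b : ℕ → ℝ) : Prop :=
  (∀ i ∈ Finset.Icc 1 l, a i < b i) ∧ (∀ i, 1 ≤ i → i < l → b i ≤ a (i + 1)) ∧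
    S.islands M k = (fun i => Icc (a i) (b i)) '' (Finset.Icc 1 l : Set ℕ)

end LinearIFS

/-- The normalized `α`-dimensional Hausdorff measure on `K`. -/
noncomputable def normalizedHausdorff (α : ℝ) (K : Set ℝ) : Measure ℝ :=
  (μH[α] K)⁻¹ • (μH[α]).restrict K

/-- The density `d(J) = λ(J) / |J| ^ α`, used for intervals `J` of positive length. -/
noncomputable def density (α : ℝ) (K J : Set ℝ) : ℝ≥0∞ :=
  normalizedHausdorff α K J / Metric.ediam J ^ α

/-- The minimal density of (nondegenerate) intervals contained in `[0,1]` and centred in `K`. -/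
noncomputable def minCentredDensity (α : ℝ) (K : Set ℝ) : ℝ≥0∞ :=
  sInf {y | ∃ x ∈ K, ∃ r : ℝ, 0 < r ∧ Icc (x - r) (x + r) ⊆ Icc 0 1 ∧
    y = density α K (Icc (x - r) (x + r))}

/-- The minimum, over all `1 ≤ i₁ < i₂ < l`, of
`∑_{i₁ < i ≤ i₂} λ([a_i, b_i]) / (a_{i₂+1} - b_{i₁} - 2 dist((a_{i₂+1} + b_{i₁}) / 2, K)) ^ α`.
It is `∞` if there are no such pairs. -/
noncomputable def pairMin (α : ℝ) (K : Set ℝ) (l : ℕ) (a b : ℕ → ℝ) : ℝ≥0∞ :=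
  sInf {y | ∃ i₁ i₂ : ℕ, 1 ≤ i₁ ∧ i₁ < i₂ ∧ i₂ < l ∧
    y = (∑ i ∈ Finset.Icc (i₁ + 1) i₂, normalizedHausdorff α K (Icc (a i) (b i))) /
      ENNReal.ofReal (a (i₂ + 1) - b i₁ -
        2 * Metric.infDist ((a (i₂ + 1) + b i₁) / 2) K) ^ α}

/-- A `δ`-packing of `E`: a countable family of disjoint open balls with centres in `E` and radii
at most `δ`; a ball is recorded as the pair (centre, radius). -/
def IsPacking (δ : ℝ) (E : Set ℝ) (B : Set (ℝ × ℝ)) : Prop :=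
  B.Countable ∧ (∀ c ∈ B, c.1 ∈ E ∧ 0 < c.2 ∧ c.2 ≤ δ) ∧
    B.PairwiseDisjoint fun c => Metric.ball c.1 c.2

/-- The supremum of `∑ |B_i| ^ s` over all `δ`-packings of `E`. -/
noncomputable def packingSup (s δ : ℝ) (E : Set ℝ) : ℝ≥0∞ :=
  ⨆ (B : Set (ℝ × ℝ)) (_ : IsPacking δ E B), ∑' c : B, Metric.ediam (Metric.ball c.1.1 c.1.2) ^ s

/-- The `s`-dimensional packing premeasure. -/
noncomputable def packingPremeasure (s : ℝ) (E : Set ℝ) : ℝ≥0∞ :=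
  ⨅ (δ : ℝ) (_ : 0 < δ), packingSup s δ E

/-- The `s`-dimensional packing measure. -/
noncomputable def packingMeasure (s : ℝ) (E : Set ℝ) : ℝ≥0∞ :=
  ⨅ (F : ℕ → Set ℝ) (_ : E ⊆ ⋃ i, F i), ∑' i, packingPremeasure s (F i)

/-! Finiteness of the overlap types makes the geometry of islands uniform. The sum of the relative
lengths of the descendants of an island, raised to a power, depends only on the type of the island.
At a critical exponent these sums neither blow up nor die out: since irreducibility lets every type
reappear inside every other one, they stay between `1 / C` and `C` for all islands and all
generations (`exists_critical_bounds`). Covers by islands then give finite Hausdorff measure, and a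
counting argument on finite covers gives a positive one (`hausdorffMeasure_pos`), so the critical
exponent is the dimension. No eigenvector of the incidence matrix is needed; only its zero pattern
enters.

A similarity of islands carries the trace of `K` to the trace of `K`, hence preserves densities. For
the lower bound on the minimal density, a centred interval is transported from the last island
containing it to an island of generation at most `k₀`, where no island of generation `k₀ + 1`
contains it (`le_minCentredDensity`). There it is compared with an end piece of an island, or cut at
island ends, or found to have both ends in lakes, where the pair quotients control it
(`le_measure_centred`). The pieces add up because `t ↦ t ^ α` is subadditive. The one-sided
densities needed for all `x` reduce to finitely many endpoints by a self-improving inequality on a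
fundamental domain of the scaling at the end of `K` (`le_of_bootstrap`).

For the upper bounds, a small interval centred at an island end beside a lake sees only a one-sided
copy of `K` (`exists_isolated_left`, `exists_isolated_right`); twice the radius against the
one-sided length is the factor `2 ^ (-α)`. A pair quotient is tested by recentring at the point of
`K` nearest to the midpoint.

For the packing measure, almost every point sees, at arbitrarily small scales, a slightly shrunk
copy of any prescribed centred interval (`ae_exists_density_le`), and Besicovitch's covering theorem
turns this into large packings. Conversely, disjoint balls have total mass at most one. -/

namespace LinearIFS

/-! ### Words, contraction ratios and the attractor -/

variable {n : ℕ}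

/-- The standing assumptions on the iterated function system, its attractor and the sequence of
index sets. -/
structure IsIslandSystem (S : LinearIFS n) (K : Set ℝ) (M : ℕ → Finset (List (Fin (n + 1)))) :
    Prop where
  map_zero : S.map 0 0 = 0
  map_one : S.map (Fin.last n) 1 = 1
  map_Ioo : ∀ j, S.map j '' Ioo 0 1 ⊆ Ioo 0 1
  nonempty : K.Nonempty
  compact : IsCompact K
  self_similar : K = ⋃ j, S.map j '' K
  index : IsNestedIndexSeq M
  nested : ∀ k, S.openUnion M (k + 1) ⊆ S.openUnion M k

variable (S : LinearIFS n)

/-- The contraction ratio of `S_w`. -/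
def ratio (w : List (Fin (n + 1))) : ℝ := (w.map S.ρ).prod

@[simp] theorem ratio_nil : S.ratio [] = 1 := rfl

@[simp] theorem ratio_cons (j : Fin (n + 1)) (w : List (Fin (n + 1))) :
    S.ratio (j :: w) = S.ρ j * S.ratio w := by simp [ratio]

theorem ratio_pos (w : List (Fin (n + 1))) : 0 < S.ratio w := by
  induction w with
  | nil => simp
  | cons j w ih => simpa using mul_pos (S.ρ_pos j) ih

theorem exists_ratio_le_pow : ∃ r : ℝ, 0 < r ∧ r < 1 ∧ ∀ w, S.ratio w ≤ r ^ w.length := by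
  obtain ⟨j, -, hj⟩ := Finset.exists_max_image Finset.univ S.ρ ⟨0, Finset.mem_univ _⟩
  refine ⟨S.ρ j, S.ρ_pos j, S.ρ_lt_one j, fun w => ?_⟩
  induction w with
  | nil => simp
  | cons i w ih =>
    rw [ratio_cons, List.length_cons, pow_succ']
    exact mul_le_mul (hj i (Finset.mem_univ _)) ih (S.ratio_pos w).le (S.ρ_pos j).le

theorem wordMap_apply (w : List (Fin (n + 1))) (x : ℝ) :
    S.wordMap w x = S.ratio w * x + S.wordMap w 0 := by
  induction w generalizing x with
  | nil => simp [wordMap]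
  | cons j w ih =>
    simp only [wordMap, Function.comp_apply, map, ratio_cons]
    rw [ih]; ring

theorem wordMap_append (v w : List (Fin (n + 1))) :
    S.wordMap (v ++ w) = S.wordMap v ∘ S.wordMap w := by
  induction v with
  | nil => rfl
  | cons j v ih => simp [wordMap, ih, Function.comp_assoc]

theorem wordMap_one (w : List (Fin (n + 1))) :
    S.wordMap w 1 = S.ratio w + S.wordMap w 0 := by
  rw [wordMap_apply, mul_one]

theorem wordMap_zero_lt_one (w : List (Fin (n + 1))) : S.wordMap w 0 < S.wordMap w 1 := by
  have := S.ratio_pos w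
  rw [wordMap_one]; linarith

theorem wordMap_eq_affine (w : List (Fin (n + 1))) :
    S.wordMap w = fun x => S.ratio w * x + S.wordMap w 0 := funext (S.wordMap_apply w)

theorem wordMap_image_Icc (w : List (Fin (n + 1))) (u v : ℝ) :
    S.wordMap w '' Icc u v = Icc (S.wordMap w u) (S.wordMap w v) := by
  rw [S.wordMap_apply w u, S.wordMap_apply w v,
    ← image_affine_Icc' (S.ratio_pos w), ← S.wordMap_eq_affine]

theorem wordMap_image_Ioo (w : List (Fin (n + 1))) (u v : ℝ) :
    S.wordMap w '' Ioo u v = Ioo (S.wordMap w u) (S.wordMap w v) := by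
  rw [S.wordMap_apply w u, S.wordMap_apply w v,
    ← image_affine_Ioo (S.ratio_pos w), ← S.wordMap_eq_affine]

theorem wordMap_strictMono (w : List (Fin (n + 1))) : StrictMono (S.wordMap w) := by
  rw [S.wordMap_eq_affine]
  intro x y h
  have := mul_lt_mul_of_pos_left h (S.ratio_pos w)
  simp only; linarith

theorem map_strictMono (j : Fin (n + 1)) : StrictMono (S.map j) := S.wordMap_strictMono [j]

theorem map_sub_map (j : Fin (n + 1)) (x y : ℝ) : S.map j x - S.map j y = S.ρ j * (x - y) := by
  simp only [map]; ring

variable {S} {K : Set ℝ} {M : ℕ → Finset (List (Fin (n + 1)))}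

namespace IsIslandSystem

variable (h : S.IsIslandSystem K M)
include h

theorem map_Icc (j : Fin (n + 1)) : S.map j '' Icc 0 1 ⊆ Icc 0 1 := by
  have h1 := h.map_Ioo j
  have e1 : S.map j '' Ioo 0 1 = Ioo (S.map j 0) (S.map j 1) := S.wordMap_image_Ioo [j] 0 1
  have e2 : S.map j '' Icc 0 1 = Icc (S.map j 0) (S.map j 1) := S.wordMap_image_Icc [j] 0 1
  rw [e1] at h1
  have hlt := S.map_strictMono j zero_lt_one
  rw [Ioo_subset_Ioo_iff hlt] at h1
  rw [e2]
  exact Icc_subset_Icc h1.1 h1.2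

theorem wordMap_Icc (w : List (Fin (n + 1))) : S.wordMap w '' Icc 0 1 ⊆ Icc 0 1 := by
  induction w with
  | nil => simp [wordMap]
  | cons j w ih =>
    simp only [wordMap, image_comp]
    exact (image_mono ih).trans (h.map_Icc j)

theorem wordMap_Ioo (w : List (Fin (n + 1))) : S.wordMap w '' Ioo 0 1 ⊆ Ioo 0 1 := by
  induction w with
  | nil => simp [wordMap]
  | cons j w ih =>
    simp only [wordMap, image_comp]
    exact (image_mono ih).trans (h.map_Ioo j)

/-- The maximum `p` of `K` is some `S_j y` with `y ≤ p`, so `p ≤ S_j p`. If `p > 1`, contraction and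
`S_j 1 ≤ 1` make `S_j p < p`. The minimum is treated alike. -/
theorem subset_Icc : K ⊆ Icc 0 1 := by
  obtain ⟨p, hp, hpm⟩ := h.compact.exists_isGreatest h.nonempty
  obtain ⟨q, hq, hqm⟩ := h.compact.exists_isLeast h.nonempty
  have h0 : ∀ j, 0 ≤ S.map j 0 := fun j =>
    (h.map_Icc j (mem_image_of_mem _ (left_mem_Icc.2 zero_le_one))).1
  have h1 : ∀ j, S.map j 1 ≤ 1 := fun j =>
    (h.map_Icc j (mem_image_of_mem _ (right_mem_Icc.2 zero_le_one))).2
  have hp1 : p ≤ 1 := by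
    by_contra! hlt
    have hp' := hp
    rw [h.self_similar] at hp'
    obtain ⟨j, y, hy, hyp⟩ := mem_iUnion.1 hp'
    have a1 := S.map_sub_map j p 1
    have a2 := (S.map_strictMono j).monotone (hpm hy)
    nlinarith [h1 j, S.ρ_lt_one j, S.ρ_pos j]
  have hq1 : 0 ≤ q := by
    by_contra! hlt
    have hq' := hq
    rw [h.self_similar] at hq'
    obtain ⟨j, y, hy, hyp⟩ := mem_iUnion.1 hq'
    have a1 := S.map_sub_map j q 0
    have a2 := (S.map_strictMono j).monotone (hqm hy)
    nlinarith [h0 j, S.ρ_lt_one j, S.ρ_pos j]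
  exact fun x hx => ⟨hq1.trans (hqm hx), (hpm hx).trans hp1⟩

theorem map_subset (j : Fin (n + 1)) : S.map j '' K ⊆ K := by
  conv_rhs => rw [h.self_similar]
  exact subset_iUnion (fun j => S.map j '' K) j

theorem wordMap_subset (w : List (Fin (n + 1))) : S.wordMap w '' K ⊆ K := by
  induction w with
  | nil => simp [wordMap]
  | cons j w ih =>
    simp only [wordMap, image_comp]
    exact (image_mono ih).trans (h.map_subset j)

/-- The minimum `q ≥ 0` of `K` satisfies `q ≤ S_1 q = ρ_1 q`, which forces `q = 0`. -/
theorem zero_mem : (0 : ℝ) ∈ K := by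
  obtain ⟨q, hq, hqm⟩ := h.compact.exists_isLeast h.nonempty
  have h1 := hqm (h.map_subset 0 (mem_image_of_mem _ hq))
  have h2 := S.map_sub_map 0 q 0
  rw [h.map_zero] at h2
  have h3 := (h.subset_Icc hq).1
  have : q = 0 := by nlinarith [S.ρ_lt_one 0]
  rwa [← this]

theorem one_mem : (1 : ℝ) ∈ K := by
  obtain ⟨q, hq, hqm⟩ := h.compact.exists_isGreatest h.nonempty
  have h1 := hqm (h.map_subset (Fin.last n) (mem_image_of_mem _ hq))
  have h2 := S.map_sub_map (Fin.last n) q 1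
  rw [h.map_one] at h2
  have h3 := (h.subset_Icc hq).2
  have : q = 1 := by nlinarith [S.ρ_lt_one (Fin.last n)]
  rwa [← this]

theorem wordMap_zero_mem (w : List (Fin (n + 1))) : S.wordMap w 0 ∈ K :=
  h.wordMap_subset w (mem_image_of_mem _ h.zero_mem)

theorem wordMap_one_mem (w : List (Fin (n + 1))) : S.wordMap w 1 ∈ K :=
  h.wordMap_subset w (mem_image_of_mem _ h.one_mem)

theorem exists_word (N : ℕ) {x : ℝ} (hx : x ∈ K) :
    ∃ w : List (Fin (n + 1)), w.length = N ∧ x ∈ S.wordMap w '' K := by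
  induction N generalizing x with
  | zero => exact ⟨[], rfl, by simpa [wordMap] using hx⟩
  | succ N ih =>
    rw [h.self_similar] at hx
    obtain ⟨j, y, hy, rfl⟩ := mem_iUnion.1 hx
    obtain ⟨w, hw, z, hz, rfl⟩ := ih hy
    exact ⟨j :: w, by simp [hw], z, hz, rfl⟩

theorem exists_prefix (k : ℕ) : ∃ N : ℕ, ∀ w : List (Fin (n + 1)), N < w.length →
    ∃ v ∈ M k, v <+: w := ⟨_, h.index.long k⟩

/-- Points of `K` have addresses of every length, and a sufficiently long address has an initial
segment in `M k`. -/
theorem subset_biUnion (k : ℕ) : K ⊆ ⋃ w ∈ M k, S.wordMap w '' K := by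
  intro x hx
  obtain ⟨N, hN⟩ := h.exists_prefix k
  obtain ⟨w, hw, hxw⟩ := h.exists_word (N + 1) hx
  obtain ⟨v, hv, t, rfl⟩ := hN w (by omega)
  refine mem_biUnion (show v ∈ M k from hv) ?_
  rw [wordMap_append, image_comp] at hxw
  exact image_mono (h.wordMap_subset t) hxw

theorem nested_add (k l : ℕ) : S.openUnion M (k + l) ⊆ S.openUnion M k := by
  induction l with
  | zero => exact subset_rfl
  | succ l ih => exact (h.nested (k + l)).trans ih

theorem openUnion_zero : S.openUnion M 0 = Ioo 0 1 := by
  simp [openUnion, h.index.zero, wordMap]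

theorem openUnion_subset (k : ℕ) : S.openUnion M k ⊆ Ioo 0 1 := by
  have := h.nested_add 0 k
  rwa [zero_add, h.openUnion_zero] at this

end IsIslandSystem

theorem wordMap_replicate_zero (h0 : S.map 0 0 = 0) (N : ℕ) :
    S.wordMap (List.replicate N 0) 0 = 0 := by
  induction N with
  | zero => rfl
  | succ N ih => simp [List.replicate_succ, wordMap, ih, h0]

theorem wordMap_replicate_last (h1 : S.map (Fin.last n) 1 = 1) (N : ℕ) :
    S.wordMap (List.replicate N (Fin.last n)) 1 = 1 := by
  induction N with
  | zero => rfl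
  | succ N ih => simp [List.replicate_succ, wordMap, ih, h1]

end LinearIFS

/-! ### Islands as closures of maximal open intervals -/

theorem connectedComponentIn_eq_Ioo {U : Set ℝ} {a b x : ℝ} (hx : x ∈ Ioo a b)
    (hU : Ioo a b ⊆ U) (ha : a ∉ U) (hb : b ∉ U) : connectedComponentIn U x = Ioo a b := by
  apply Subset.antisymm
  · intro y hy
    have hc : (connectedComponentIn U x).OrdConnected :=
      isPreconnected_connectedComponentIn.ordConnected
    have hxm := mem_connectedComponentIn (hU hx)
    have hs := connectedComponentIn_subset U x
    constructor
    · by_contra! hya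
      exact ha (hs (hc.out hy hxm ⟨hya, hx.1.le⟩))
    · by_contra! hyb
      exact hb (hs (hc.out hxm hy ⟨hx.2.le, hyb⟩))
  · exact isPreconnected_Ioo.subset_connectedComponentIn hx hU

namespace LinearIFS

variable {n : ℕ} (S : LinearIFS n) (M : ℕ → Finset (List (Fin (n + 1))))

/-- `(a, b)` is a connected component of the `k`-th union of open intervals. -/
structure IsComponent (k : ℕ) (a b : ℝ) : Prop where
  lt : a < b
  subset : Ioo a b ⊆ S.openUnion M k
  left_notMem : a ∉ S.openUnion M k
  right_notMem : b ∉ S.openUnion M k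

variable {S M}

theorem isOpen_openUnion (k : ℕ) : IsOpen (S.openUnion M k) := by
  refine isOpen_biUnion fun w _ => ?_
  rw [wordMap_image_Ioo]; exact isOpen_Ioo

theorem wordMap_Ioo_subset_openUnion {k : ℕ} {w : List (Fin (n + 1))} (hw : w ∈ M k) :
    Ioo (S.wordMap w 0) (S.wordMap w 1) ⊆ S.openUnion M k := by
  rw [← wordMap_image_Ioo]
  exact subset_biUnion_of_mem (u := fun w => S.wordMap w '' Ioo 0 1) (show w ∈ M k from hw)

theorem mem_openUnion {k : ℕ} {x : ℝ} : x ∈ S.openUnion M k ↔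
    ∃ w ∈ M k, x ∈ Ioo (S.wordMap w 0) (S.wordMap w 1) := by
  simp only [openUnion, wordMap_image_Ioo, mem_iUnion, exists_prop]

namespace IsComponent

variable {k : ℕ} {a b : ℝ}

/-- An open subinterval meeting the component lies in it. -/
theorem bounds_of_Ioo (H : S.IsComponent M k a b) {c d x : ℝ} (hcd : Ioo c d ⊆ S.openUnion M k)
    (hx : x ∈ Ioo c d) (hx' : x ∈ Ioo a b) : a ≤ c ∧ d ≤ b := by
  constructor
  · by_contra! hlt
    exact H.left_notMem (hcd ⟨hlt, hx'.1.trans hx.2⟩)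
  · by_contra! hlt
    exact H.right_notMem (hcd ⟨hx.1.trans hx'.2, hlt⟩)

theorem eq_or (H : S.IsComponent M k a b) {a' b' : ℝ} (H' : S.IsComponent M k a' b') :
    (a = a' ∧ b = b') ∨ b ≤ a' ∨ b' ≤ a := by
  by_cases h1 : b ≤ a'
  · exact Or.inr (Or.inl h1)
  by_cases h2 : b' ≤ a
  · exact Or.inr (Or.inr h2)
  push Not at h1 h2
  left
  obtain ⟨x, hx1, hx2⟩ := exists_between (show max a a' < min b b' from
    max_lt (lt_min H.lt h2) (lt_min h1 H'.lt))
  have hxa : x ∈ Ioo a b := ⟨(le_max_left _ _).trans_lt hx1, hx2.trans_le (min_le_left _ _)⟩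
  have hxb : x ∈ Ioo a' b' := ⟨(le_max_right _ _).trans_lt hx1, hx2.trans_le (min_le_right _ _)⟩
  have e1 := H.bounds_of_Ioo H'.subset hxb hxa
  have e2 := H'.bounds_of_Ioo H.subset hxa hxb
  exact ⟨le_antisymm e1.1 e2.1, le_antisymm e2.2 e1.2⟩

theorem mem_islands (H : S.IsComponent M k a b) : Icc a b ∈ S.islands M k := by
  obtain ⟨x, hx⟩ := nonempty_Ioo.2 H.lt
  refine ⟨x, H.subset hx, ?_⟩
  rw [connectedComponentIn_eq_Ioo hx H.subset H.left_notMem H.right_notMem,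
    closure_Ioo H.lt.ne]

theorem exists_word_Ioo (H : S.IsComponent M k a b) {x : ℝ} (hx : x ∈ Ioo a b) :
    ∃ w ∈ M k, x ∈ Ioo (S.wordMap w 0) (S.wordMap w 1) ∧ a ≤ S.wordMap w 0 ∧
      S.wordMap w 1 ≤ b := by
  obtain ⟨w, hw, hxw⟩ := mem_openUnion.1 (H.subset hx)
  exact ⟨w, hw, hxw, H.bounds_of_Ioo (wordMap_Ioo_subset_openUnion hw) hxw hx⟩

/-- Only finitely many word intervals lie in the component. If the smallest of their left ends
exceeded `a`, the points just right of `a` would be uncovered. -/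
theorem exists_word_left (H : S.IsComponent M k a b) :
    ∃ w ∈ M k, S.wordMap w 0 = a ∧ S.wordMap w 1 ≤ b := by
  classical
  obtain ⟨x, hx⟩ := nonempty_Ioo.2 H.lt
  obtain ⟨w₀, hw₀, -, h1, h2⟩ := H.exists_word_Ioo hx
  obtain ⟨v, hv, hmin⟩ := Finset.exists_min_image
    {w ∈ M k | a ≤ S.wordMap w 0 ∧ S.wordMap w 1 ≤ b} (fun w => S.wordMap w 0)
    ⟨w₀, by simp [hw₀, h1, h2]⟩
  rw [Finset.mem_filter] at hv
  refine ⟨v, hv.1, le_antisymm ?_ hv.2.1, hv.2.2⟩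
  by_contra! hlt
  obtain ⟨y, hy1, hy2⟩ := exists_between hlt
  obtain ⟨w, hw, hyw, h3, h4⟩ := H.exists_word_Ioo
    ⟨hy1, hy2.trans ((S.wordMap_zero_lt_one v).trans_le hv.2.2)⟩
  have := hmin w (by simp [hw, h3, h4])
  linarith [hyw.1]

theorem exists_word_right (H : S.IsComponent M k a b) :
    ∃ w ∈ M k, S.wordMap w 1 = b ∧ a ≤ S.wordMap w 0 := by
  classical
  obtain ⟨x, hx⟩ := nonempty_Ioo.2 H.lt
  obtain ⟨w₀, hw₀, -, h1, h2⟩ := H.exists_word_Ioo hx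
  obtain ⟨v, hv, hmax⟩ := Finset.exists_max_image
    {w ∈ M k | a ≤ S.wordMap w 0 ∧ S.wordMap w 1 ≤ b} (fun w => S.wordMap w 1)
    ⟨w₀, by simp [hw₀, h1, h2]⟩
  rw [Finset.mem_filter] at hv
  refine ⟨v, hv.1, le_antisymm hv.2.2 ?_, hv.2.1⟩
  by_contra! hlt
  obtain ⟨y, hy1, hy2⟩ := exists_between hlt
  obtain ⟨w, hw, hyw, h3, h4⟩ := H.exists_word_Ioo
    ⟨(hv.2.1.trans_lt (S.wordMap_zero_lt_one v)).trans hy1, hy2⟩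
  have := hmax w (by simp [hw, h3, h4])
  linarith [hyw.2]

end IsComponent

/-- The component of `x` is open, order convex and bounded, so it is the open interval between its
infimum and supremum. Neither end lies in the union, because a component is relatively closed. -/
theorem exists_isComponent {k : ℕ} {x : ℝ} (hx : x ∈ S.openUnion M k) :
    ∃ a b, S.IsComponent M k a b ∧ x ∈ Ioo a b := by
  classical
  set C := connectedComponentIn (S.openUnion M k) x with hC
  have hCo : IsOpen C := (isOpen_openUnion k).connectedComponentIn
  have hCc : C.OrdConnected := isPreconnected_connectedComponentIn.ordConnected
  have hCs : C ⊆ S.openUnion M k := connectedComponentIn_subset _ _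
  have hxC : x ∈ C := mem_connectedComponentIn hx
  have hword : ∀ y ∈ C, ∃ w ∈ M k, y ∈ Ioo (S.wordMap w 0) (S.wordMap w 1) := fun y hy =>
    mem_openUnion.1 (hCs hy)
  have hbb : BddBelow C := by
    refine ⟨(M k).inf' ?_ (fun w => S.wordMap w 0), fun y hy => ?_⟩
    · obtain ⟨w, hw, -⟩ := hword x hxC
      exact ⟨w, hw⟩
    · obtain ⟨w, hw, hyw⟩ := hword y hy
      exact (Finset.inf'_le (fun w => S.wordMap w 0) hw).trans hyw.1.le
  have hba : BddAbove C := by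
    refine ⟨(M k).sup' ?_ (fun w => S.wordMap w 1), fun y hy => ?_⟩
    · obtain ⟨w, hw, -⟩ := hword x hxC
      exact ⟨w, hw⟩
    · obtain ⟨w, hw, hyw⟩ := hword y hy
      exact hyw.2.le.trans (Finset.le_sup' (fun w => S.wordMap w 1) hw)
  -- The component of `y` is open, hence meets `C`, hence equals it.
  have hclosed : ∀ y ∈ closure C, y ∈ S.openUnion M k → y ∈ C := by
    intro y hy hyU
    have ho : IsOpen (connectedComponentIn (S.openUnion M k) y) :=
      (isOpen_openUnion k).connectedComponentIn
    obtain ⟨z, hz1, hz2⟩ := mem_closure_iff.1 hy _ ho (mem_connectedComponentIn hyU)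
    have e1 := connectedComponentIn_eq hz1
    have e2 := connectedComponentIn_eq hz2
    rw [hC, e2, ← e1]
    exact mem_connectedComponentIn hyU
  have hinf : sInf C ∉ C := fun hm => by
    obtain ⟨ε, hε, hb⟩ := Metric.isOpen_iff.1 hCo _ hm
    have : sInf C - ε / 2 ∈ C := hb (by rw [Real.ball_eq_Ioo]; constructor <;> linarith)
    linarith [csInf_le hbb this]
  have hsup : sSup C ∉ C := fun hm => by
    obtain ⟨ε, hε, hb⟩ := Metric.isOpen_iff.1 hCo _ hm
    have : sSup C + ε / 2 ∈ C := hb (by rw [Real.ball_eq_Ioo]; constructor <;> linarith)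
    linarith [le_csSup hba this]
  have hlt : ∀ y ∈ C, sInf C < y ∧ y < sSup C := fun y hy =>
    ⟨lt_of_le_of_ne (csInf_le hbb hy) (fun e => hinf (e ▸ hy)),
      lt_of_le_of_ne (le_csSup hba hy) (fun e => hsup (e ▸ hy))⟩
  refine ⟨sInf C, sSup C, ⟨(hlt x hxC).1.trans (hlt x hxC).2, ?_, ?_, ?_⟩, hlt x hxC⟩
  · intro y hy
    obtain ⟨u, hu, huy⟩ := exists_lt_of_csInf_lt ⟨x, hxC⟩ hy.1
    obtain ⟨v, hv, hyv⟩ := exists_lt_of_lt_csSup ⟨x, hxC⟩ hy.2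
    exact hCs (hCc.out hu hv ⟨huy.le, hyv.le⟩)
  · exact fun hm => hinf (hclosed _ (csInf_mem_closure ⟨x, hxC⟩ hbb) hm)
  · exact fun hm => hsup (hclosed _ (csSup_mem_closure ⟨x, hxC⟩ hba) hm)

theorem mem_islands_iff {k : ℕ} {I : Set ℝ} :
    I ∈ S.islands M k ↔ ∃ a b, S.IsComponent M k a b ∧ I = Icc a b := by
  constructor
  · rintro ⟨x, hx, rfl⟩
    obtain ⟨a, b, H, hxab⟩ := exists_isComponent hx
    refine ⟨a, b, H, ?_⟩
    rw [connectedComponentIn_eq_Ioo hxab H.subset H.left_notMem H.right_notMem,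
      closure_Ioo H.lt.ne]
  · rintro ⟨a, b, H, rfl⟩
    exact H.mem_islands

/-- Every component contains the midpoint of the interval of some word in `M k`, and that midpoint
determines it. -/
theorem finite_islands (k : ℕ) : (S.islands M k).Finite := by
  refine ((M k).finite_toSet.image fun w =>
    closure (connectedComponentIn (S.openUnion M k) (S.wordMap w (1 / 2)))).subset ?_
  rintro I ⟨x, hx, rfl⟩
  obtain ⟨a, b, H, hxab⟩ := exists_isComponent hx
  obtain ⟨w, hw, hxw, h1, h2⟩ := H.exists_word_Ioo hxab
  refine ⟨w, hw, ?_⟩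
  have e1 : S.wordMap w 0 < S.wordMap w (1 / 2) := S.wordMap_strictMono w (by norm_num)
  have e2 : S.wordMap w (1 / 2) < S.wordMap w 1 := S.wordMap_strictMono w (by norm_num)
  have hm : S.wordMap w (1 / 2) ∈ Ioo a b := ⟨by linarith, by linarith⟩
  simp only
  rw [connectedComponentIn_eq_Ioo hxab H.subset H.left_notMem H.right_notMem,
    connectedComponentIn_eq_Ioo hm H.subset H.left_notMem H.right_notMem]

theorem exists_isComponent_of_word {k : ℕ} {w : List (Fin (n + 1))} (hw : w ∈ M k) :
    ∃ a b, S.IsComponent M k a b ∧ a ≤ S.wordMap w 0 ∧ S.wordMap w 1 ≤ b := by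
  obtain ⟨x, hx⟩ := nonempty_Ioo.2 (S.wordMap_zero_lt_one w)
  obtain ⟨a, b, H, hxab⟩ := exists_isComponent (wordMap_Ioo_subset_openUnion hw hx)
  exact ⟨a, b, H, H.bounds_of_Ioo (wordMap_Ioo_subset_openUnion hw) hx hxab⟩

theorem IsComponent.of_Icc_mem {k : ℕ} {a b : ℝ} (hI : Icc a b ∈ S.islands M k) : S.IsComponent M k a b := by
  obtain ⟨a', b', H, e⟩ := mem_islands_iff.1 hI
  have hab : a ≤ b := by
    by_contra! hlt
    rw [Icc_eq_empty (not_le.2 hlt)] at e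
    exact (nonempty_Icc.2 H.lt.le).ne_empty e.symm
  obtain ⟨rfl, rfl⟩ := (Icc_eq_Icc_iff hab).1 e
  exact H

theorem eq_of_islands_subset {k : ℕ} {I J : Set ℝ} (hI : I ∈ S.islands M k)
    (hJ : J ∈ S.islands M k) (hIJ : I ⊆ J) : I = J := by
  obtain ⟨a, b, H, rfl⟩ := mem_islands_iff.1 hI
  obtain ⟨a', b', H', rfl⟩ := mem_islands_iff.1 hJ
  rw [Icc_subset_Icc_iff H.lt.le] at hIJ
  have := H.lt
  rcases H.eq_or H' with ⟨rfl, rfl⟩ | h | h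
  · rfl
  · linarith
  · linarith

/-- Two islands of the same generation with a common offspring coincide. -/
theorem island_parent_unique {k l : ℕ} {I I' J : Set ℝ} (hI : I ∈ S.islands M k)
    (hI' : I' ∈ S.islands M k) (hJ : J ∈ S.islands M l) (h1 : J ⊆ I)
    (h2 : J ⊆ I') : I = I' := by
  obtain ⟨a, b, H, rfl⟩ := mem_islands_iff.1 hI
  obtain ⟨a', b', H', rfl⟩ := mem_islands_iff.1 hI'
  obtain ⟨c, d, H'', rfl⟩ := mem_islands_iff.1 hJ
  rw [Icc_subset_Icc_iff H''.lt.le] at h1 h2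
  have := H''.lt
  rcases H.eq_or H' with ⟨rfl, rfl⟩ | h | h
  · rfl
  · linarith
  · linarith

/-! ### Parents and children of islands -/

namespace IsIslandSystem

variable {K : Set ℝ} (h : S.IsIslandSystem K M)
include h

theorem component_subset {k : ℕ} {a b : ℝ} (H : S.IsComponent M k a b) : 0 ≤ a ∧ b ≤ 1 := by
  have := H.subset.trans (h.openUnion_subset k)
  exact (Ioo_subset_Ioo_iff H.lt).1 this

theorem island_subset {k : ℕ} {I : Set ℝ} (hI : I ∈ S.islands M k) : I ⊆ Icc 0 1 := by
  obtain ⟨a, b, H, rfl⟩ := mem_islands_iff.1 hI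
  have := h.component_subset H
  exact Icc_subset_Icc this.1 this.2

theorem left_mem {k : ℕ} {a b : ℝ} (H : S.IsComponent M k a b) : a ∈ K := by
  obtain ⟨w, -, rfl, -⟩ := H.exists_word_left
  exact h.wordMap_zero_mem w

theorem right_mem {k : ℕ} {a b : ℝ} (H : S.IsComponent M k a b) : b ∈ K := by
  obtain ⟨w, -, rfl, -⟩ := H.exists_word_right
  exact h.wordMap_one_mem w

theorem exists_component_of_mem (k : ℕ) {x : ℝ} (hx : x ∈ K) :
    ∃ a b, S.IsComponent M k a b ∧ x ∈ Icc a b := by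
  obtain ⟨w, hw, y, hy, rfl⟩ := mem_iUnion₂.1 (h.subset_biUnion k hx)
  obtain ⟨a, b, H, h1, h2⟩ := exists_isComponent_of_word (S := S) hw
  have hy' := h.subset_Icc hy
  exact ⟨a, b, H, h1.trans ((S.wordMap_strictMono w).monotone hy'.1),
    ((S.wordMap_strictMono w).monotone hy'.2).trans h2⟩

theorem exists_island_of_mem (k : ℕ) {x : ℝ} (hx : x ∈ K) : ∃ I ∈ S.islands M k, x ∈ I := by
  obtain ⟨a, b, H, hx⟩ := h.exists_component_of_mem k hx
  exact ⟨_, H.mem_islands, hx⟩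

theorem islands_zero : S.islands M 0 = {Icc 0 1} := by
  have H : S.IsComponent M 0 0 1 :=
    ⟨zero_lt_one, h.openUnion_zero.ge, by simp [h.openUnion_zero], by simp [h.openUnion_zero]⟩
  apply Subset.antisymm
  · intro I hI
    have := eq_of_islands_subset hI H.mem_islands (h.island_subset hI)
    exact this
  · rintro I rfl
    exact H.mem_islands

theorem exists_parent (k l : ℕ) {a b : ℝ} (H : S.IsComponent M (k + l) a b) :
    ∃ a' b', S.IsComponent M k a' b' ∧ a' ≤ a ∧ b ≤ b' := by
  obtain ⟨x, hx⟩ := nonempty_Ioo.2 H.lt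
  have hs := H.subset.trans (h.nested_add k l)
  obtain ⟨a', b', H', hx'⟩ := exists_isComponent (hs hx)
  exact ⟨a', b', H', H'.bounds_of_Ioo hs hx hx'⟩

theorem exists_parent_island (k l : ℕ) {J : Set ℝ} (hJ : J ∈ S.islands M (k + l)) :
    ∃ I ∈ S.islands M k, J ⊆ I := by
  obtain ⟨a, b, H, rfl⟩ := mem_islands_iff.1 hJ
  obtain ⟨a', b', H', h1, h2⟩ := h.exists_parent k l H
  exact ⟨_, H'.mem_islands, Icc_subset_Icc h1 h2⟩

/-- The left end of an island is the left end of an island of each later generation. -/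
theorem exists_child_left {k : ℕ} (l : ℕ) {a b : ℝ} (H : S.IsComponent M k a b) :
    ∃ d, S.IsComponent M (k + l) a d ∧ d ≤ b := by
  obtain ⟨w, hw, hwa, hwb⟩ := H.exists_word_left
  obtain ⟨N, hN⟩ := h.exists_prefix (k + l)
  -- Appending copies of the first letter does not move the left end, as `S_1` fixes `0`. The padded
  -- word is long enough to have an initial segment `v` of the later generation. The component
  -- around `v` reaches down to `a`, and nestedness keeps it from going further.
  obtain ⟨v, hv, t, ht⟩ := hN (w ++ List.replicate (N + 1) 0) (by simp; omega)
  set u := w ++ List.replicate (N + 1) 0 with hu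
  have hu0 : S.wordMap u 0 = a := by
    rw [hu, wordMap_append, Function.comp_apply, wordMap_replicate_zero h.map_zero, hwa]
  have hu1 : S.wordMap u '' Ioo 0 1 ⊆ Ioo a b := by
    rw [hu, wordMap_append, image_comp]
    refine (image_mono (h.wordMap_Ioo _)).trans ?_
    rw [wordMap_image_Ioo, hwa]
    exact Ioo_subset_Ioo_right hwb
  have hv0 : S.wordMap v 0 ≤ a := by
    rw [← hu0, ← ht, wordMap_append, Function.comp_apply]
    refine (S.wordMap_strictMono v).monotone ?_
    exact (h.wordMap_Icc t (mem_image_of_mem _ (left_mem_Icc.2 zero_le_one))).1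
  have hv1 : S.wordMap u '' Ioo 0 1 ⊆ S.wordMap v '' Ioo 0 1 := by
    rw [← ht, wordMap_append, image_comp]
    exact image_mono (h.wordMap_Ioo t)
  obtain ⟨c, d, H', hc, hd⟩ := exists_isComponent_of_word (S := S) hv
  have hx := mem_image_of_mem (S.wordMap u) (show (1 / 2 : ℝ) ∈ Ioo 0 1 by norm_num)
  have hx1 := hu1 hx
  have hx2 := hv1 hx
  rw [wordMap_image_Ioo] at hx2
  have hx3 : S.wordMap u (1 / 2) ∈ Ioo c d := ⟨hc.trans_lt hx2.1, hx2.2.trans_le hd⟩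
  obtain ⟨h3, h4⟩ := H.bounds_of_Ioo (H'.subset.trans (h.nested_add k l)) hx3 hx1
  have : c = a := by linarith
  subst this
  exact ⟨d, H', h4⟩

theorem exists_child_right {k : ℕ} (l : ℕ) {a b : ℝ} (H : S.IsComponent M k a b) :
    ∃ c, S.IsComponent M (k + l) c b ∧ a ≤ c := by
  obtain ⟨w, hw, hwb, hwa⟩ := H.exists_word_right
  obtain ⟨N, hN⟩ := h.exists_prefix (k + l)
  obtain ⟨v, hv, t, ht⟩ := hN (w ++ List.replicate (N + 1) (Fin.last n)) (by simp; omega)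
  set u := w ++ List.replicate (N + 1) (Fin.last n) with hu
  have hu0 : S.wordMap u 1 = b := by
    rw [hu, wordMap_append, Function.comp_apply, wordMap_replicate_last h.map_one, hwb]
  have hu1 : S.wordMap u '' Ioo 0 1 ⊆ Ioo a b := by
    rw [hu, wordMap_append, image_comp]
    refine (image_mono (h.wordMap_Ioo _)).trans ?_
    rw [wordMap_image_Ioo, hwb]
    exact Ioo_subset_Ioo_left hwa
  have hv0 : b ≤ S.wordMap v 1 := by
    rw [← hu0, ← ht, wordMap_append, Function.comp_apply]
    refine (S.wordMap_strictMono v).monotone ?_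
    exact (h.wordMap_Icc t (mem_image_of_mem _ (right_mem_Icc.2 zero_le_one))).2
  have hv1 : S.wordMap u '' Ioo 0 1 ⊆ S.wordMap v '' Ioo 0 1 := by
    rw [← ht, wordMap_append, image_comp]
    exact image_mono (h.wordMap_Ioo t)
  obtain ⟨c, d, H', hc, hd⟩ := exists_isComponent_of_word (S := S) hv
  have hx := mem_image_of_mem (S.wordMap u) (show (1 / 2 : ℝ) ∈ Ioo 0 1 by norm_num)
  have hx1 := hu1 hx
  have hx2 := hv1 hx
  rw [wordMap_image_Ioo] at hx2
  have hx3 : S.wordMap u (1 / 2) ∈ Ioo c d := ⟨hc.trans_lt hx2.1, hx2.2.trans_le hd⟩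
  obtain ⟨h3, h4⟩ := H.bounds_of_Ioo (H'.subset.trans (h.nested_add k l)) hx3 hx1
  have : d = b := by linarith
  subst this
  exact ⟨c, H', h3⟩

end IsIslandSystem

end LinearIFS

/-! ### Affine maps, descendants and similarity of islands -/

/-- The affine map `x ↦ p * x + q`. -/
def affineFun (p q x : ℝ) : ℝ := p * x + q

theorem affineFun_injective {p : ℝ} (q : ℝ) (hp : p ≠ 0) :
    Function.Injective (affineFun p q) := fun x y hxy => by
  simpa [affineFun, hp] using hxy

theorem affineFun_inv_comp {p : ℝ} (q : ℝ) (hp : p ≠ 0) (x : ℝ) :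
    affineFun p⁻¹ (-(p⁻¹ * q)) (affineFun p q x) = x := by
  simp only [affineFun]; field_simp; ring

theorem affineFun_comp_inv {p : ℝ} (q : ℝ) (hp : p ≠ 0) (x : ℝ) :
    affineFun p q (affineFun p⁻¹ (-(p⁻¹ * q)) x) = x := by
  simp only [affineFun]; field_simp; ring

theorem affineFun_inv_image {p : ℝ} (q : ℝ) (hp : p ≠ 0) (A : Set ℝ) :
    affineFun p⁻¹ (-(p⁻¹ * q)) '' (affineFun p q '' A) = A := by
  rw [image_image]; simp [affineFun_inv_comp q hp]

theorem affineFun_image_inv {p : ℝ} (q : ℝ) (hp : p ≠ 0) (A : Set ℝ) :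
    affineFun p q '' (affineFun p⁻¹ (-(p⁻¹ * q)) '' A) = A := by
  rw [image_image]; simp [affineFun_comp_inv q hp]

open scoped Pointwise in
theorem affineFun_image_eq (p q : ℝ) (A : Set ℝ) :
    affineFun p q '' A = (fun x => q + x) '' (p • A) := by
  rw [← image_smul, image_image]
  exact image_congr fun x _ => add_comm _ _

open scoped Pointwise in
theorem diam_affineFun_image (p q : ℝ) (A : Set ℝ) :
    Metric.diam (affineFun p q '' A) = |p| * Metric.diam A := by
  rw [affineFun_image_eq, (isometry_add_left q).diam_image, diam_smul₀, Real.norm_eq_abs]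

namespace LinearIFS

variable {n : ℕ} (S : LinearIFS n) (M : ℕ → Finset (List (Fin (n + 1))))

/-- The islands of generation `g + l` contained in the island `I` of generation `g`. -/
noncomputable def desc (g : ℕ) (I : Set ℝ) (l : ℕ) : Finset (Set ℝ) :=
  Set.Finite.toFinset (s := {J | J ∈ S.islands M (g + l) ∧ J ⊆ I})
    ((finite_islands _).subset fun _ h => h.1)

/-- The affine map `x ↦ p * x + q` carries the island `I` of generation `g` and its descendants to
the island `I'` of generation `g'` and its descendants. -/
structure Similar (p q : ℝ) (g : ℕ) (I : Set ℝ) (g' : ℕ) (I' : Set ℝ) : Prop where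
  ne_zero : p ≠ 0
  image_eq : affineFun p q '' I = I'
  mem_iff : ∀ l J, J ∈ S.desc M g I l ↔ affineFun p q '' J ∈ S.desc M g' I' l

variable {S M}

@[simp] theorem mem_desc {g l : ℕ} {I J : Set ℝ} :
    J ∈ S.desc M g I l ↔ J ∈ S.islands M (g + l) ∧ J ⊆ I := by
  simp [desc]

theorem mem_desc_zero {g : ℕ} {I J : Set ℝ} (hI : I ∈ S.islands M g) :
    J ∈ S.desc M g I 0 ↔ J = I := by
  rw [mem_desc]
  constructor
  · rintro ⟨h1, h2⟩
    exact eq_of_islands_subset h1 hI h2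
  · rintro rfl
    exact ⟨hI, subset_rfl⟩

theorem desc_zero {g : ℕ} {I : Set ℝ} (hI : I ∈ S.islands M g) : S.desc M g I 0 = {I} := by
  ext J; rw [mem_desc_zero hI, Finset.mem_singleton]

theorem diam_pos_of_island {g : ℕ} {I : Set ℝ} (hI : I ∈ S.islands M g) : 0 < Metric.diam I := by
  obtain ⟨a, b, H, rfl⟩ := mem_islands_iff.1 hI
  rw [Real.diam_Icc H.lt.le]
  linarith [H.lt]

namespace Similar

variable {p q : ℝ} {g g' : ℕ} {I I' : Set ℝ}

theorem symm (H : S.Similar M p q g I g' I') :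
    S.Similar M p⁻¹ (-(p⁻¹ * q)) g' I' g I where
  ne_zero := inv_ne_zero H.ne_zero
  image_eq := by rw [← H.image_eq, affineFun_inv_image q H.ne_zero]
  mem_iff l J := by rw [H.mem_iff l, affineFun_image_inv q H.ne_zero]

theorem trans (H : S.Similar M p q g I g' I') {p' q' : ℝ} {g'' : ℕ} {I'' : Set ℝ}
    (H' : S.Similar M p' q' g' I' g'' I'') :
    S.Similar M (p' * p) (p' * q + q') g I g'' I'' := by
  have hc : ∀ A : Set ℝ, affineFun (p' * p) (p' * q + q') '' A =
      affineFun p' q' '' (affineFun p q '' A) := by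
    intro A
    rw [image_image]
    congr 1
    ext x
    simp only [affineFun]; ring
  refine ⟨mul_ne_zero H'.ne_zero H.ne_zero, ?_, fun l J => ?_⟩
  · rw [hc, H.image_eq, H'.image_eq]
  · rw [H.mem_iff, H'.mem_iff, hc]

theorem refl (g : ℕ) (I : Set ℝ) : S.Similar M 1 0 g I g I := by
  have : affineFun 1 0 = id := by ext x; simp [affineFun]
  exact ⟨one_ne_zero, by simp [this], by simp [this]⟩

/-- A similarity restricts to descendants, since a descendant of a descendant is a descendant of the
whole. -/
theorem child (H : S.Similar M p q g I g' I') {l : ℕ} {J : Set ℝ} (hJ : J ∈ S.desc M g I l) :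
    S.Similar M p q (g + l) J (g' + l) (affineFun p q '' J) := by
  refine ⟨H.ne_zero, rfl, fun m A => ?_⟩
  have hJ' := (H.mem_iff _ _).1 hJ
  have key := H.mem_iff (l + m) A
  have hinj := (affineFun_injective q H.ne_zero)
  rw [mem_desc] at hJ hJ' key ⊢
  rw [mem_desc] at key ⊢
  rw [image_subset_image_iff hinj, Nat.add_assoc, Nat.add_assoc]
  constructor
  · rintro ⟨h1, h2⟩
    exact ⟨(key.1 ⟨h1, h2.trans hJ.2⟩).1, h2⟩
  · rintro ⟨h1, h2⟩
    exact ⟨(key.2 ⟨h1, (image_mono h2).trans hJ'.2⟩).1, h2⟩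

theorem diam_eq (H : S.Similar M p q g I g' I') : Metric.diam I' = |p| * Metric.diam I := by
  rw [← H.image_eq, diam_affineFun_image]

theorem sum_eq (H : S.Similar M p q g I g' I') (l : ℕ) (F : Set ℝ → ℝ) :
    ∑ J ∈ S.desc M g' I' l, F J = ∑ J ∈ S.desc M g I l, F (affineFun p q '' J) := by
  symm
  refine Finset.sum_bij' (fun J _ => affineFun p q '' J)
    (fun J _ => affineFun p⁻¹ (-(p⁻¹ * q)) '' J) ?_ ?_ ?_ ?_ ?_
  · intro J hJ; exact (H.mem_iff _ _).1 hJ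
  · intro J hJ; exact (H.symm.mem_iff _ _).1 hJ
  · intro J _; exact affineFun_inv_image q H.ne_zero J
  · intro J _; exact affineFun_image_inv q H.ne_zero J
  · intro J _; rfl

end Similar

/-- Equivalence speaks of later generations only. The level `l = 0` comes for free, because the sole
island of the same generation inside `I` is `I`. The vertex maps are forgotten here. -/
theorem similar_of_equivalent {I I' : S.Island M} (H : I.Equivalent I') :
    ∃ p q, S.Similar M p q I.gen I.carrier I'.gen I'.carrier := by
  obtain ⟨p, q, hp, h1, -, h3⟩ := H
  refine ⟨p, q, hp, h1, fun l J => ?_⟩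
  rcases Nat.eq_zero_or_pos l with rfl | hl
  · rw [mem_desc_zero I.mem, mem_desc_zero I'.mem, ← h1]
    exact (image_injective.2 (affineFun_injective q hp)).eq_iff.symm
  · rw [mem_desc, mem_desc]
    exact h3 l hl J

variable (S M) in
/-- The sum of the relative diameters to the power `s` of the descendants. -/
noncomputable def relSum (s : ℝ) (l g : ℕ) (I : Set ℝ) : ℝ :=
  ∑ J ∈ S.desc M g I l, (Metric.diam J / Metric.diam I) ^ s

theorem Similar.relSum_eq {p q : ℝ} {g g' : ℕ} {I I' : Set ℝ}
    (H : S.Similar M p q g I g' I') (s : ℝ) (l : ℕ) :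
    S.relSum M s l g I = S.relSum M s l g' I' := by
  rw [relSum, relSum, H.sum_eq, H.diam_eq]
  refine Finset.sum_congr rfl fun J _ => ?_
  rw [diam_affineFun_image, mul_div_mul_left _ _ (abs_ne_zero.2 H.ne_zero)]

theorem relSum_nonneg (s : ℝ) (l g : ℕ) (I : Set ℝ) : 0 ≤ S.relSum M s l g I :=
  Finset.sum_nonneg fun _ _ => Real.rpow_nonneg (div_nonneg Metric.diam_nonneg Metric.diam_nonneg) _

theorem relSum_zero (s : ℝ) {g : ℕ} {I : Set ℝ} (hI : I ∈ S.islands M g) :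
    S.relSum M s 0 g I = 1 := by
  rw [relSum, desc_zero hI, Finset.sum_singleton, div_self (diam_pos_of_island hI).ne',
    Real.one_rpow]

theorem le_relSum (s : ℝ) {l g : ℕ} {I J : Set ℝ} (hJ : J ∈ S.desc M g I l) :
    (Metric.diam J / Metric.diam I) ^ s ≤ S.relSum M s l g I :=
  Finset.single_le_sum (f := fun J => (Metric.diam J / Metric.diam I) ^ s)
    (fun _ _ => Real.rpow_nonneg (div_nonneg Metric.diam_nonneg Metric.diam_nonneg) _) hJ

namespace IsIslandSystem

variable {K : Set ℝ} (h : S.IsIslandSystem K M)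
include h

/-- Each descendant has exactly one ancestor in the intermediate generation, and that ancestor lies
in `I`. -/
theorem sum_desc_add (k l : ℕ) {g : ℕ} {I : Set ℝ} (hI : I ∈ S.islands M g) {E : Type*}
    [AddCommMonoid E] (F : Set ℝ → E) :
    ∑ J ∈ S.desc M g I (k + l), F J =
      ∑ J ∈ S.desc M g I k, ∑ A ∈ S.desc M (g + k) J l, F A := by
  classical
  rw [← Finset.sum_biUnion]
  · refine Finset.sum_congr ?_ fun _ _ => rfl
    ext A
    simp only [Finset.mem_biUnion, mem_desc, ← Nat.add_assoc]
    constructor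
    · rintro ⟨h1, h2⟩
      obtain ⟨J, hJ, hAJ⟩ := h.exists_parent_island (g + k) l h1
      obtain ⟨I', hI', hJI⟩ := h.exists_parent_island g k hJ
      obtain rfl := island_parent_unique hI hI' h1 h2 (hAJ.trans hJI)
      exact ⟨J, ⟨hJ, hJI⟩, h1, hAJ⟩
    · rintro ⟨J, ⟨h1, h2⟩, h3, h4⟩
      exact ⟨h3, h4.trans h2⟩
  · intro J hJ J' hJ' hne
    refine Finset.disjoint_left.2 fun A hA hA' => hne ?_
    rw [Finset.mem_coe, mem_desc] at hJ hJ'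
    rw [mem_desc] at hA hA'
    exact island_parent_unique hJ.1 hJ'.1 hA.1 hA.2 hA'.2

theorem relSum_add (s : ℝ) (k l : ℕ) {g : ℕ} {I : Set ℝ} (hI : I ∈ S.islands M g) :
    S.relSum M s (k + l) g I =
      ∑ J ∈ S.desc M g I k, (Metric.diam J / Metric.diam I) ^ s * S.relSum M s l (g + k) J := by
  rw [relSum, h.sum_desc_add k l hI]
  refine Finset.sum_congr rfl fun J hJ => ?_
  rw [relSum, Finset.mul_sum]
  refine Finset.sum_congr rfl fun A _ => ?_
  have hJ' := diam_pos_of_island (mem_desc.1 hJ).1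
  rw [← Real.mul_rpow (div_nonneg Metric.diam_nonneg Metric.diam_nonneg)
    (div_nonneg Metric.diam_nonneg Metric.diam_nonneg)]
  congr 1
  field_simp

theorem desc_nonempty {g : ℕ} {I : Set ℝ} (hI : I ∈ S.islands M g) (l : ℕ) :
    (S.desc M g I l).Nonempty := by
  obtain ⟨a, b, H, rfl⟩ := mem_islands_iff.1 hI
  obtain ⟨d, H', hd⟩ := h.exists_child_left l H
  exact ⟨Icc a d, mem_desc.2 ⟨H'.mem_islands, Icc_subset_Icc_right hd⟩⟩

theorem relSum_mul_le {s θ : ℝ} {k : ℕ} (hθ : ∀ g, ∀ I ∈ S.islands M g, S.relSum M s k g I ≤ θ)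
    (hθ0 : 0 ≤ θ) (j : ℕ) {g : ℕ} {I : Set ℝ} (hI : I ∈ S.islands M g) :
    S.relSum M s (k * j) g I ≤ θ ^ j := by
  induction j generalizing g I with
  | zero => simp [relSum_zero s hI]
  | succ j ih =>
    rw [Nat.mul_succ, Nat.add_comm (k * j) k, h.relSum_add s _ _ hI, pow_succ]
    calc _ ≤ ∑ J ∈ S.desc M g I k, (Metric.diam J / Metric.diam I) ^ s * θ ^ j :=
          Finset.sum_le_sum fun J hJ => mul_le_mul_of_nonneg_left (ih (mem_desc.1 hJ).1)
            (Real.rpow_nonneg (div_nonneg Metric.diam_nonneg Metric.diam_nonneg) _)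
      _ = S.relSum M s k g I * θ ^ j := by rw [relSum, Finset.sum_mul]
      _ ≤ θ * θ ^ j := mul_le_mul_of_nonneg_right (hθ g I hI) (pow_nonneg hθ0 j)
      _ = θ ^ j * θ := mul_comm _ _

theorem le_relSum_mul {s θ : ℝ} {k : ℕ} (hθ : ∀ g, ∀ I ∈ S.islands M g, θ ≤ S.relSum M s k g I)
    (hθ0 : 0 ≤ θ) (j : ℕ) {g : ℕ} {I : Set ℝ} (hI : I ∈ S.islands M g) :
    θ ^ j ≤ S.relSum M s (k * j) g I := by
  induction j generalizing g I with
  | zero => simp [relSum_zero s hI]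
  | succ j ih =>
    rw [Nat.mul_succ, Nat.add_comm (k * j) k, h.relSum_add s _ _ hI, pow_succ]
    refine ge_iff_le.1 ?_
    calc _ ≥ ∑ J ∈ S.desc M g I k, (Metric.diam J / Metric.diam I) ^ s * θ ^ j :=
          Finset.sum_le_sum fun J hJ => mul_le_mul_of_nonneg_left (ih (mem_desc.1 hJ).1)
            (Real.rpow_nonneg (div_nonneg Metric.diam_nonneg Metric.diam_nonneg) _)
      _ = S.relSum M s k g I * θ ^ j := by rw [relSum, Finset.sum_mul]
      _ ≥ θ * θ ^ j := mul_le_mul_of_nonneg_right (hθ g I hI) (pow_nonneg hθ0 j)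
      _ = θ ^ j * θ := mul_comm _ _

end IsIslandSystem

/-! ### Uniform bounds from finitely many overlap types -/

theorem exists_similar_representative (T : S.OverlapType M → S.Island M)
    (hT : ∀ t, (⟦T t⟧ : S.OverlapType M) = t) {g : ℕ} {I : Set ℝ} (hI : I ∈ S.islands M g) :
    ∃ t p q, S.Similar M p q g I (T t).gen (T t).carrier := by
  have h1 := hT ⟦(⟨g, I, hI⟩ : S.Island M)⟧
  have h2 : (⟨g, I, hI⟩ : S.Island M).Equivalent (T ⟦⟨g, I, hI⟩⟧) := Quotient.exact h1.symm
  obtain ⟨p, q, H⟩ := similar_of_equivalent h2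
  exact ⟨_, p, q, H⟩

/-- A similarity invariant real function of islands is bounded. -/
theorem exists_bound_of_similar [Finite (S.OverlapType M)] (f : ℕ → Set ℝ → ℝ)
    (hf : ∀ {p q g I g' I'}, S.Similar M p q g I g' I' → f g I = f g' I') :
    ∃ B : ℝ, 0 < B ∧ ∀ g, ∀ I ∈ S.islands M g, f g I ≤ B := by
  let T : S.OverlapType M → S.Island M := Quotient.out
  obtain ⟨B, hB⟩ := (Set.finite_range fun t => f (T t).gen (T t).carrier).bddAbove
  refine ⟨max B 1, lt_max_of_lt_right one_pos, fun g I hI => ?_⟩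
  obtain ⟨t, p, q, H⟩ := exists_similar_representative T (fun t => Quotient.out_eq t) hI
  rw [hf H]
  exact (hB ⟨t, rfl⟩).trans (le_max_left _ _)

theorem exists_relSum_le [Finite (S.OverlapType M)] (s : ℝ) (l : ℕ) :
    ∃ B : ℝ, 0 < B ∧ ∀ g, ∀ I ∈ S.islands M g, S.relSum M s l g I ≤ B :=
  exists_bound_of_similar (fun g I => S.relSum M s l g I) fun H => H.relSum_eq s l

/-- With exponent `-1`, the relative sum dominates `|I| / |J|` for every child `J`, and it is
bounded over all types. -/
theorem exists_child_diam_ge [Finite (S.OverlapType M)] :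
    ∃ c : ℝ, 0 < c ∧ c ≤ 1 ∧ ∀ g, ∀ I ∈ S.islands M g, ∀ J ∈ S.desc M g I 1,
      c * Metric.diam I ≤ Metric.diam J := by
  obtain ⟨B, hB, hle⟩ := exists_relSum_le (S := S) (M := M) (-1) 1
  refine ⟨min B⁻¹ 1, lt_min (inv_pos.2 hB) one_pos, min_le_right _ _, fun g I hI J hJ => ?_⟩
  have h1 := (le_relSum (-1) hJ).trans (hle g I hI)
  have hJ' := diam_pos_of_island (mem_desc.1 hJ).1
  have hI' := diam_pos_of_island hI
  rw [Real.rpow_neg_one, inv_div, div_le_iff₀ hJ'] at h1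
  calc _ ≤ B⁻¹ * Metric.diam I := mul_le_mul_of_nonneg_right (min_le_left _ _) hI'.le
    _ ≤ B⁻¹ * (B * Metric.diam J) := by gcongr
    _ = _ := by field_simp

/-- Here the vertex condition in the equivalence is used. If `τ ∘ S_w = S_v`, the quotient of the
island's length by the ratio of the word is the same for `w` and `v`, and the representatives of the
types offer only finitely many quotients. -/
theorem exists_diam_le_ratio [Finite (S.OverlapType M)] :
    ∃ C : ℝ, 0 < C ∧ ∀ g, ∀ I ∈ S.islands M g, ∀ w ∈ M g, S.wordMap w '' Icc 0 1 ⊆ I →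
      Metric.diam I ≤ C * S.ratio w := by
  let T : S.OverlapType M → S.Island M := Quotient.out
  have hT : ∀ t, (⟦T t⟧ : S.OverlapType M) = t := fun t => Quotient.out_eq t
  have h1 : ∀ t, ∃ C : ℝ, ∀ v ∈ M (T t).gen, Metric.diam (T t).carrier / S.ratio v ≤ C := by
    intro t
    obtain ⟨C, hC⟩ := ((M (T t).gen).finite_toSet.image
      fun v => Metric.diam (T t).carrier / S.ratio v).bddAbove
    exact ⟨C, fun v hv => hC ⟨v, hv, rfl⟩⟩
  choose C hC using h1
  obtain ⟨B, hB⟩ := (Set.finite_range C).bddAbove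
  refine ⟨max B 1, lt_max_of_lt_right one_pos, fun g I hI w hw hwI => ?_⟩
  set I₀ : S.Island M := ⟨g, I, hI⟩
  have h2 : I₀.Equivalent (T ⟦I₀⟧) := Quotient.exact (hT ⟦I₀⟧).symm
  obtain ⟨p, q, hp, e1, e2, -⟩ := h2
  have h3 : (fun x => p * x + q) ∘ S.wordMap w ∈ (T ⟦I₀⟧).vertexMaps := by
    rw [e2]
    exact ⟨_, ⟨w, hw, rfl, hwI⟩, rfl⟩
  obtain ⟨v, hv, hvw, -⟩ := h3
  have h4 := congrFun hvw 0
  have h5 := congrFun hvw 1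
  simp only [Function.comp_apply] at h4 h5
  rw [S.wordMap_one, S.wordMap_one] at h5
  have h6 : p * S.ratio w = S.ratio v := by linarith
  have h7 : Metric.diam (T ⟦I₀⟧).carrier = |p| * Metric.diam I := by
    rw [← e1]; exact diam_affineFun_image p q I
  have hw0 := S.ratio_pos w
  have hv0 := S.ratio_pos v
  have hp0 : 0 < p := by
    by_contra! hle
    have := mul_nonpos_of_nonpos_of_nonneg hle hw0.le
    linarith
  have h8 := (hC ⟦I₀⟧ v hv).trans ((hB ⟨_, rfl⟩).trans (le_max_left B 1))
  rw [h7, abs_of_pos hp0, ← h6, mul_div_mul_left _ _ hp0.ne', div_le_iff₀ hw0] at h8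
  exact h8

/-- An island is at most a constant times longer than the interval of any of its words, and the
shortest word length tends to infinity. -/
theorem IsIslandSystem.diam_tendsto [Finite (S.OverlapType M)] {K : Set ℝ}
    (h : S.IsIslandSystem K M) {ε : ℝ} (hε : 0 < ε) :
    ∃ N, ∀ k ≥ N, ∀ I ∈ S.islands M k, Metric.diam I < ε := by
  obtain ⟨C, hC, hle⟩ := exists_diam_le_ratio (S := S) (M := M)
  obtain ⟨r, hr0, hr1, hr⟩ := S.exists_ratio_le_pow
  have ht : Tendsto (fun k => C * r ^ sInf (List.length '' (M k : Set (List (Fin (n + 1))))))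
      atTop (𝓝 (C * 0)) :=
    ((tendsto_pow_atTop_nhds_zero_of_lt_one hr0.le hr1).comp h.index.min_tendsto).const_mul C
  rw [mul_zero] at ht
  obtain ⟨N, hN⟩ := eventually_atTop.1 (ht.eventually_lt_const hε)
  refine ⟨N, fun k hk I hI => ?_⟩
  obtain ⟨a, b, H, rfl⟩ := mem_islands_iff.1 hI
  obtain ⟨w, hw, hwa, hwb⟩ := H.exists_word_left
  refine lt_of_le_of_lt (hle k _ hI w hw ?_) (lt_of_le_of_lt ?_ (hN k hk))
  · rw [wordMap_image_Icc]
    exact Icc_subset_Icc hwa.ge hwb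
  · refine mul_le_mul_of_nonneg_left ((hr w).trans ?_) hC.le
    exact pow_le_pow_of_le_one hr0.le hr1.le (Nat.sInf_le ⟨w, hw, rfl⟩)

/-! ### The trace of the attractor on an island -/

namespace IsIslandSystem

variable {K : Set ℝ}

/-- This describes `K ∩ I` through descendants alone, so similarities must preserve it. Islands may
touch, so the end points of `I` are handled separately: they stay end points of descendants of `I`.
A later island around an inner point can only descend from `I`. Conversely, points in ever shorter
descendants are limits of end points, which lie in `K`. -/
theorem mem_inter_island_iff [Finite (S.OverlapType M)] (h : S.IsIslandSystem K M) {g : ℕ}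
    {I : Set ℝ} (hI : I ∈ S.islands M g) {x : ℝ} :
    x ∈ K ∩ I ↔ ∀ l, ∃ J ∈ S.desc M g I l, x ∈ J := by
  constructor
  · rintro ⟨hxK, hxI⟩ l
    obtain ⟨a, b, H, rfl⟩ := mem_islands_iff.1 hI
    rcases hxI.1.eq_or_lt with rfl | hax
    · obtain ⟨d, H', hd⟩ := h.exists_child_left l H
      exact ⟨_, mem_desc.2 ⟨H'.mem_islands, Icc_subset_Icc_right hd⟩, left_mem_Icc.2 H'.lt.le⟩
    rcases hxI.2.eq_or_lt with rfl | hxb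
    · obtain ⟨c, H', hc⟩ := h.exists_child_right l H
      exact ⟨_, mem_desc.2 ⟨H'.mem_islands, Icc_subset_Icc_left hc⟩, right_mem_Icc.2 H'.lt.le⟩
    obtain ⟨c, d, H', hxcd⟩ := h.exists_component_of_mem (g + l) hxK
    obtain ⟨a', b', H'', h1, h2⟩ := h.exists_parent g l H'
    rcases H.eq_or H'' with ⟨rfl, rfl⟩ | h3 | h3
    · exact ⟨_, mem_desc.2 ⟨H'.mem_islands, Icc_subset_Icc h1 h2⟩, hxcd⟩
    · linarith [hxcd.1]
    · linarith [hxcd.2]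
  · intro hx
    refine ⟨?_, ?_⟩
    · rw [← h.compact.isClosed.closure_eq, Metric.mem_closure_iff]
      intro ε hε
      obtain ⟨N, hN⟩ := h.diam_tendsto hε
      obtain ⟨J, hJ, hxJ⟩ := hx N
      have hJ' := (mem_desc.1 hJ).1
      have hd := hN _ (Nat.le_add_left N g) J hJ'
      obtain ⟨a, b, H, rfl⟩ := mem_islands_iff.1 hJ'
      refine ⟨a, h.left_mem H, lt_of_le_of_lt ?_ hd⟩
      exact Metric.dist_le_diam_of_mem (Metric.isBounded_Icc a b) hxJ (left_mem_Icc.2 H.lt.le)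
    · obtain ⟨J, hJ, hxJ⟩ := hx 0
      exact (mem_desc.1 hJ).2 hxJ

theorem similar_image [Finite (S.OverlapType M)] (h : S.IsIslandSystem K M) {p q : ℝ} {g g' : ℕ}
    {I I' : Set ℝ} (hI : I ∈ S.islands M g) (hI' : I' ∈ S.islands M g')
    (H : S.Similar M p q g I g' I') :
    affineFun p q '' (K ∩ I) = K ∩ I' := by
  apply Subset.antisymm
  · rintro _ ⟨x, hx, rfl⟩
    rw [h.mem_inter_island_iff hI] at hx
    rw [h.mem_inter_island_iff hI']
    intro l
    obtain ⟨J, hJ, hxJ⟩ := hx l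
    exact ⟨_, (H.mem_iff _ _).1 hJ, mem_image_of_mem _ hxJ⟩
  · intro y hy
    refine ⟨affineFun p⁻¹ (-(p⁻¹ * q)) y, ?_, affineFun_comp_inv q H.ne_zero y⟩
    rw [h.mem_inter_island_iff hI'] at hy
    rw [h.mem_inter_island_iff hI]
    intro l
    obtain ⟨J, hJ, hyJ⟩ := hy l
    exact ⟨_, (H.symm.mem_iff _ _).1 hJ, mem_image_of_mem _ hyJ⟩

end IsIslandSystem

end LinearIFS

/-! ### Transitivity and the critical exponent -/

namespace LinearIFS

variable {n : ℕ} {S : LinearIFS n} {M : ℕ → Finset (List (Fin (n + 1)))} {K : Set ℝ}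

variable (S M) in
/-- Every island has a descendant similar to any given island. -/
def IsTransitive : Prop :=
  ∀ g, ∀ I ∈ S.islands M g, ∀ g', ∀ I' ∈ S.islands M g',
    ∃ l, ∃ J ∈ S.desc M g I l, ∃ p q, S.Similar M p q (g + l) J g' I'

/-- A positive entry of the incidence matrix exhibits a child of the given type, so a path of
positive entries is a chain of descendants, pulled back step by step along similarities. The
exponent `s` plays no role, as only positivity of the entries counts. -/
theorem isTransitive_of_isIrreducible (T : S.OverlapType M → S.Island M)
    (hT : ∀ t, (⟦T t⟧ : S.OverlapType M) = t) {s : ℝ}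
    (hirr : (S.incidenceMatrix M T s).IsIrreducible) : S.IsTransitive M := by
  let : Quiver (S.OverlapType M) := Matrix.toQuiver (S.incidenceMatrix M T s)
  intro g I hI g' I' hI'
  obtain ⟨i, p, q, H⟩ := exists_similar_representative T hT hI
  obtain ⟨j, p', q', H'⟩ := exists_similar_representative T hT hI'
  suffices hs : ∀ j : S.OverlapType M, Quiver.Path i j → ∃ l, ∃ J ∈ S.desc M g I l, ∃ p q,
      S.Similar M p q (g + l) J (T j).gen (T j).carrier by
    obtain ⟨π, -⟩ := hirr.connected i j
    obtain ⟨l, J, hJ, p₁, q₁, H₁⟩ := hs j π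
    exact ⟨l, J, hJ, _, _, H₁.trans H'.symm⟩
  intro j π
  induction π with
  | nil => exact ⟨0, I, (mem_desc_zero hI).2 rfl, p, q, H⟩
  | @cons j₁ j₂ _ e ih =>
    obtain ⟨l, J, hJ, p₁, q₁, H₁⟩ := ih
    have he : 0 < S.incidenceMatrix M T s j₁ j₂ := e.down
    obtain ⟨A, ⟨hAg, hAs, hAt⟩, -⟩ := exists_ne_zero_of_finsum_mem_ne_zero he.ne'
    have hAd : A.carrier ∈ S.desc M (T j₁).gen (T j₁).carrier 1 :=
      mem_desc.2 ⟨hAg ▸ A.mem, hAs⟩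
    have hd := (H₁.symm.mem_iff _ _).1 hAd
    have H₂ := (H₁.symm.child hAd).symm
    obtain ⟨p₃, q₃, H₃⟩ := similar_of_equivalent
      (show A.Equivalent (T j₂) from Quotient.exact (hAt.trans (hT j₂).symm))
    rw [hAg] at H₃
    refine ⟨l + 1, _, ?_, _, _, H₂.trans H₃⟩
    rw [mem_desc] at hd ⊢
    exact ⟨hd.1, hd.2.trans (mem_desc.1 hJ).2⟩

theorem relSum_le_pow_mul {s : ℕ} {l g : ℕ} {I : Set ℝ} {θ : ℝ}
    (hθ : ∀ J ∈ S.desc M g I l, Metric.diam J / Metric.diam I ≤ θ) :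
    S.relSum M s l g I ≤ θ ^ s * S.relSum M 0 l g I := by
  rw [relSum, relSum, Finset.mul_sum]
  refine Finset.sum_le_sum fun J hJ => ?_
  rw [Real.rpow_zero, mul_one, Real.rpow_natCast]
  exact pow_le_pow_left₀ (div_nonneg Metric.diam_nonneg Metric.diam_nonneg) (hθ J hJ) s

theorem continuous_relSum (l : ℕ) {g : ℕ} {I : Set ℝ} (hI : I ∈ S.islands M g) :
    Continuous fun s => S.relSum M s l g I := by
  unfold relSum
  refine continuous_finsetSum _ fun J hJ => ?_
  exact Real.continuous_const_rpow
    (div_pos (diam_pos_of_island (mem_desc.1 hJ).1) (diam_pos_of_island hI)).ne'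

theorem one_le_relSum_zero (h : S.IsIslandSystem K M) (l : ℕ) {g : ℕ} {I : Set ℝ}
    (hI : I ∈ S.islands M g) : 1 ≤ S.relSum M 0 l g I := by
  obtain ⟨J, hJ⟩ := h.desc_nonempty hI l
  simpa using le_relSum 0 hJ

namespace IsIslandSystem

variable (h : S.IsIslandSystem K M)
include h

/-- For some `k` all `k`-th descendants are at most half as long as the island, and their number is
bounded by some `B`. Any `s` with `2 ^ (-s) * B < 1` works. -/
theorem exists_relSum_lt_one [Finite (S.OverlapType M)] :
    ∃ s : ℕ, ∃ k, ∀ g, ∀ I ∈ S.islands M g, S.relSum M s k g I < 1 := by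
  let T : S.OverlapType M → S.Island M := Quotient.out
  have h1 : ∀ t, ∃ N, ∀ k ≥ N, ∀ J ∈ S.islands M k,
      Metric.diam J < Metric.diam (T t).carrier / 2 :=
    fun t => h.diam_tendsto (half_pos (diam_pos_of_island (T t).mem))
  choose N hN using h1
  obtain ⟨k, hk⟩ := (Set.finite_range N).bddAbove
  have h2 : ∀ g, ∀ I ∈ S.islands M g, ∀ J ∈ S.desc M g I k,
      Metric.diam J / Metric.diam I ≤ 1 / 2 := by
    intro g I hI J hJ
    obtain ⟨t, p, q, H⟩ := exists_similar_representative T (fun t => Quotient.out_eq t) hI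
    have hJ' := (H.mem_iff k J).1 hJ
    have h3 := hN t ((T t).gen + k) ((hk ⟨t, rfl⟩).trans (Nat.le_add_left _ _)) _
      (mem_desc.1 hJ').1
    rw [diam_affineFun_image, H.diam_eq] at h3
    have hp := abs_pos.2 H.ne_zero
    rw [div_le_iff₀ (diam_pos_of_island hI)]
    nlinarith
  obtain ⟨B, hB, hle⟩ := exists_relSum_le (S := S) (M := M) 0 k
  obtain ⟨s, hs⟩ := exists_pow_lt_of_lt_one (inv_pos.2 hB) (show (1 / 2 : ℝ) < 1 by norm_num)
  refine ⟨s, k, fun g I hI => (relSum_le_pow_mul (h2 g I hI)).trans_lt ?_⟩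
  calc (1 / 2 : ℝ) ^ s * S.relSum M 0 k g I ≤ (1 / 2 : ℝ) ^ s * B := by gcongr; exact hle g I hI
    _ < B⁻¹ * B := by gcongr
    _ = 1 := inv_mul_cancel₀ hB.ne'

/-- There is a critical exponent. -/
theorem exists_critical [Finite (S.OverlapType M)] :
    ∃ s : ℝ, 0 ≤ s ∧ (∀ k, ∃ g, ∃ I ∈ S.islands M g, 1 ≤ S.relSum M s k g I) ∧
      ∀ k, ∃ g, ∃ I ∈ S.islands M g, S.relSum M s k g I ≤ 1 := by
  let T : S.OverlapType M → S.Island M := Quotient.out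
  have hT : ∀ t, (⟦T t⟧ : S.OverlapType M) = t := fun t => Quotient.out_eq t
  have hroot : Icc (0 : ℝ) 1 ∈ S.islands M 0 := by rw [h.islands_zero]; rfl
  set A : Set ℝ := {s | 0 ≤ s ∧ ∃ k, ∀ g, ∀ I ∈ S.islands M g, S.relSum M s k g I < 1} with hA
  have hAne : A.Nonempty := by
    obtain ⟨s, k, hk⟩ := h.exists_relSum_lt_one
    exact ⟨s, Nat.cast_nonneg s, k, hk⟩
  have hAb : BddBelow A := ⟨0, fun s hs => hs.1⟩
  have h0 : 0 ≤ sInf A := le_csInf hAne fun s hs => hs.1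
  -- Both alternatives are open conditions in the exponent, as there are finitely many types. If all
  -- sums at the infimum were below one, a smaller exponent would belong to `A`. If all were above
  -- one, they would still be so at a nearby member of `A`.
  refine ⟨sInf A, h0, fun k => ?_, fun k => ?_⟩
  · by_contra! hlt
    have hpos : 0 < sInf A := by
      refine lt_of_le_of_ne h0 fun e => ?_
      have := hlt 0 _ hroot
      rw [← e] at this
      linarith [one_le_relSum_zero h k hroot]
    have hev : ∀ᶠ s in 𝓝 (sInf A), ∀ t, S.relSum M s k (T t).gen (T t).carrier < 1 :=
      eventually_all.2 fun t => ((continuous_relSum k (T t).mem).tendsto _).eventually_lt_const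
        (hlt _ _ (T t).mem)
    have hev' : ∀ᶠ s in 𝓝[<] sInf A, 0 < s ∧
        ∀ t, S.relSum M s k (T t).gen (T t).carrier < 1 :=
      ((lt_mem_nhds hpos).and hev).filter_mono nhdsWithin_le_nhds
    obtain ⟨s, ⟨hs0, hs⟩, hsl⟩ := (hev'.and self_mem_nhdsWithin).exists
    have : s ∈ A := ⟨hs0.le, k, fun g I hI => by
      obtain ⟨t, p, q, H⟩ := exists_similar_representative T hT hI
      rw [H.relSum_eq]; exact hs t⟩
    exact absurd (csInf_le hAb this) (not_le.2 hsl)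
  · by_contra! hlt
    have hk : k ≠ 0 := by
      rintro rfl
      have := hlt 0 _ hroot
      rw [relSum_zero _ hroot] at this
      exact lt_irrefl _ this
    have hev : ∀ᶠ s in 𝓝 (sInf A), ∀ t, 1 < S.relSum M s k (T t).gen (T t).carrier :=
      eventually_all.2 fun t => ((continuous_relSum k (T t).mem).tendsto _).eventually_const_lt
        (hlt _ _ (T t).mem)
    obtain ⟨ε, hε, hball⟩ := Metric.eventually_nhds_iff.1 hev
    obtain ⟨s, hsA, hs⟩ := exists_lt_of_csInf_lt hAne (lt_add_of_pos_right (sInf A) hε)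
    have hs' := csInf_le hAb hsA
    have hgt := hball (show dist s (sInf A) < ε by
      rw [Real.dist_eq, abs_of_nonneg (by linarith)]; linarith)
    obtain ⟨-, k', hk'⟩ := hsA
    have : Nonempty (S.OverlapType M) := ⟨⟦⟨0, _, hroot⟩⟧⟩
    obtain ⟨t₀, ht₀⟩ := Finite.exists_max fun t => S.relSum M s k' (T t).gen (T t).carrier
    set θ := S.relSum M s k' (T t₀).gen (T t₀).carrier
    have hθ : ∀ g, ∀ I ∈ S.islands M g, S.relSum M s k' g I ≤ θ := fun g I hI => by
      obtain ⟨t, p, q, H⟩ := exists_similar_representative T hT hI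
      rw [H.relSum_eq]; exact ht₀ t
    have hθ0 : 0 ≤ θ := relSum_nonneg _ _ _ _
    have hθ1 : θ < 1 := hk' _ _ (T t₀).mem
    -- The sum over `k * k'` generations of the root is read in two ways: at most `θ ^ k < 1` and at
    -- least `1`.
    have e1 := h.relSum_mul_le hθ hθ0 k hroot
    have e2 := h.le_relSum_mul (θ := 1) (s := s) (k := k) (fun g I hI => by
      obtain ⟨t, p, q, H⟩ := exists_similar_representative T hT hI
      rw [H.relSum_eq]; exact (hgt t).le) zero_le_one k' hroot
    rw [one_pow, Nat.mul_comm] at e2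
    have e3 : θ ^ k < 1 := pow_lt_one₀ hθ0 hθ1 hk
    linarith

/-- The relative sums of different islands are comparable. -/
theorem exists_relSum_le_mul [Finite (S.OverlapType M)] (htr : S.IsTransitive M) (s : ℝ) :
    ∃ C : ℝ, 0 < C ∧ ∀ k, ∀ g, ∀ I ∈ S.islands M g, ∀ g', ∀ I' ∈ S.islands M g',
      S.relSum M s k g I ≤ C * S.relSum M s k g' I' := by
  let T : S.OverlapType M → S.Island M := Quotient.out
  have hT : ∀ t, (⟦T t⟧ : S.OverlapType M) = t := fun t => Quotient.out_eq t
  have key : ∀ x : S.OverlapType M × S.OverlapType M, ∃ C : ℝ, ∀ k,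
      S.relSum M s k (T x.1).gen (T x.1).carrier ≤
        C * S.relSum M s k (T x.2).gen (T x.2).carrier := by
    intro x
    obtain ⟨l, J, hJ, p, q, H⟩ := htr _ _ (T x.2).mem _ _ (T x.1).mem
    obtain ⟨B, hB, hle⟩ := exists_relSum_le (S := S) (M := M) s l
    set ρ := (Metric.diam J / Metric.diam (T x.2).carrier) ^ s with hρ
    have hρ0 : 0 < ρ := Real.rpow_pos_of_pos
      (div_pos (diam_pos_of_island (mem_desc.1 hJ).1) (diam_pos_of_island (T x.2).mem)) _
    refine ⟨B / ρ, fun k => ?_⟩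
    -- The sum over `l + k` generations of the second island is split in both orders. It contains
    -- the contribution of the copy `J` of the first island, and it is at most `B` times the sum
    -- over `k` generations.
    have h1 : ρ * S.relSum M s k (T x.1).gen (T x.1).carrier ≤
        S.relSum M s (l + k) (T x.2).gen (T x.2).carrier := by
      rw [h.relSum_add s l k (T x.2).mem, ← H.relSum_eq]
      exact Finset.single_le_sum (f := fun J => (Metric.diam J / Metric.diam (T x.2).carrier) ^ s *
        S.relSum M s k ((T x.2).gen + l) J) (fun J _ => mul_nonneg (Real.rpow_nonneg
          (div_nonneg Metric.diam_nonneg Metric.diam_nonneg) _) (relSum_nonneg _ _ _ _)) hJ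
    have h2 : S.relSum M s (k + l) (T x.2).gen (T x.2).carrier ≤
        S.relSum M s k (T x.2).gen (T x.2).carrier * B := by
      rw [h.relSum_add s k l (T x.2).mem, relSum, Finset.sum_mul]
      exact Finset.sum_le_sum fun A hA => mul_le_mul_of_nonneg_left
        (hle _ _ (mem_desc.1 hA).1) (Real.rpow_nonneg
          (div_nonneg Metric.diam_nonneg Metric.diam_nonneg) _)
    rw [Nat.add_comm] at h2
    rw [div_mul_eq_mul_div, le_div_iff₀ hρ0]
    linarith
  choose C hC using key
  obtain ⟨B, hB⟩ := (Set.finite_range C).bddAbove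
  refine ⟨max B 1, lt_max_of_lt_right one_pos, fun k g I hI g' I' hI' => ?_⟩
  obtain ⟨t, p, q, H⟩ := exists_similar_representative T hT hI
  obtain ⟨t', p', q', H'⟩ := exists_similar_representative T hT hI'
  rw [H.relSum_eq, H'.relSum_eq]
  exact (hC (t, t') k).trans (mul_le_mul_of_nonneg_right
    ((hB ⟨(t, t'), rfl⟩).trans (le_max_left _ _)) (relSum_nonneg _ _ _ _))

/-- In each generation some sum is at least one and some sum is at most one, and all of them are
comparable with a constant independent of the generation. -/
theorem exists_critical_bounds [Finite (S.OverlapType M)] (htr : S.IsTransitive M) :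
    ∃ s C : ℝ, 0 ≤ s ∧ 0 < C ∧ ∀ k, ∀ g, ∀ I ∈ S.islands M g,
      1 / C ≤ S.relSum M s k g I ∧ S.relSum M s k g I ≤ C := by
  obtain ⟨s, hs, h1, h2⟩ := h.exists_critical
  obtain ⟨C, hC, hle⟩ := h.exists_relSum_le_mul htr s
  refine ⟨s, C, hs, hC, fun k g I hI => ⟨?_, ?_⟩⟩
  · obtain ⟨g', I', hI', hge⟩ := h1 k
    have := hle k _ _ hI' _ _ hI
    rw [div_le_iff₀ hC]; linarith
  · obtain ⟨g', I', hI', hge⟩ := h2 k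
    have := hle k _ _ hI _ _ hI'
    nlinarith

end IsIslandSystem

theorem aedisjoint_islands (μ : Measure ℝ) [NullSingletonClass μ] {k : ℕ} {I J : Set ℝ}
    (hI : I ∈ S.islands M k) (hJ : J ∈ S.islands M k) (hne : I ≠ J) : AEDisjoint μ I J := by
  obtain ⟨a, b, H, rfl⟩ := mem_islands_iff.1 hI
  obtain ⟨a', b', H', rfl⟩ := mem_islands_iff.1 hJ
  rw [AEDisjoint, Icc_inter_Icc]
  refine Set.Subsingleton.measure_zero (subsingleton_Icc_of_ge ?_) μ
  rcases H.eq_or H' with ⟨rfl, rfl⟩ | h1 | h1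
  · exact absurd rfl hne
  · exact (min_le_left _ _).trans (h1.trans (le_max_right _ _))
  · exact (min_le_right _ _).trans (h1.trans (le_max_left _ _))

theorem measurableSet_island {k : ℕ} {I : Set ℝ} (hI : I ∈ S.islands M k) : MeasurableSet I := by
  obtain ⟨a, b, H, rfl⟩ := mem_islands_iff.1 hI
  exact measurableSet_Icc

theorem sum_measure_islands (μ : Measure ℝ) [NullSingletonClass μ] {k : ℕ} (F : Finset (Set ℝ))
    (hF : ∀ I ∈ F, I ∈ S.islands M k) {W : Set ℝ} (hW : MeasurableSet W) :
    ∑ I ∈ F, μ (I ∩ W) = μ (⋃ I ∈ F, I ∩ W) := by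
  rw [measure_biUnion_finset₀]
  · intro I hI J hJ hne
    exact (aedisjoint_islands μ (hF I hI) (hF J hJ) hne).mono inter_subset_left inter_subset_left
  · exact fun I hI => ((measurableSet_island (hF I hI)).inter hW).nullMeasurableSet

theorem sum_measure_desc_le (μ : Measure ℝ) [NullSingletonClass μ] (g l : ℕ) (I : Set ℝ)
    {W : Set ℝ} (hW : MeasurableSet W) :
    ∑ J ∈ S.desc M g I l, μ (J ∩ W) ≤ μ (I ∩ W) := by
  rw [sum_measure_islands μ _ (fun J hJ => (mem_desc.1 hJ).1) hW]
  exact measure_mono (iUnion₂_subset fun J hJ =>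
    inter_subset_inter_left _ (mem_desc.1 hJ).2)

end LinearIFS

/-! ### Positive and finite Hausdorff measure at the critical exponent -/

namespace LinearIFS

variable {n : ℕ} {S : LinearIFS n} {M : ℕ → Finset (List (Fin (n + 1)))} {K : Set ℝ}

theorem sum_diam_rpow (s : ℝ) (l : ℕ) {g : ℕ} {I : Set ℝ} (hI : I ∈ S.islands M g) :
    ∑ J ∈ S.desc M g I l, Metric.diam J ^ s = Metric.diam I ^ s * S.relSum M s l g I := by
  rw [relSum, Finset.mul_sum]
  refine Finset.sum_congr rfl fun J _ => ?_
  have := diam_pos_of_island hI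
  rw [← Real.mul_rpow this.le (div_nonneg Metric.diam_nonneg this.le),
    mul_div_cancel₀ _ this.ne']

theorem ediam_island {k : ℕ} {I : Set ℝ} (hI : I ∈ S.islands M k) :
    Metric.ediam I = ENNReal.ofReal (Metric.diam I) := by
  obtain ⟨a, b, H, rfl⟩ := mem_islands_iff.1 hI
  rw [Real.ediam_Icc, Real.diam_Icc H.lt.le]

theorem volume_island {k : ℕ} {I : Set ℝ} (hI : I ∈ S.islands M k) :
    volume.real I = Metric.diam I := by
  obtain ⟨a, b, H, rfl⟩ := mem_islands_iff.1 hI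
  rw [Real.volume_real_Icc_of_le H.lt.le, Real.diam_Icc H.lt.le]

theorem sum_volume_desc_le (g l : ℕ) {I : Set ℝ} (hI : I ∈ S.islands M g) {W : Set ℝ}
    (hW : MeasurableSet W) :
    ∑ J ∈ S.desc M g I l, volume.real (J ∩ W) ≤ volume.real (I ∩ W) := by
  have hfin : ∀ J ⊆ I, volume (J ∩ W) ≠ ⊤ := by
    obtain ⟨a, b, H, rfl⟩ := mem_islands_iff.1 hI
    intro J hJ
    exact measure_ne_top_of_subset (inter_subset_left.trans hJ) (by simp)
  simp only [Measure.real]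
  rw [← ENNReal.toReal_sum fun J hJ => hfin J (mem_desc.1 hJ).2]
  exact ENNReal.toReal_mono (hfin I subset_rfl) (sum_measure_desc_le volume g l I hW)

namespace IsIslandSystem

variable (h : S.IsIslandSystem K M)
include h

theorem root_mem : Icc (0 : ℝ) 1 ∈ S.islands M 0 := by rw [h.islands_zero]; rfl

theorem mem_desc_root {l : ℕ} {J : Set ℝ} :
    J ∈ S.desc M 0 (Icc 0 1) l ↔ J ∈ S.islands M l := by
  rw [mem_desc, zero_add]
  exact ⟨fun hJ => hJ.1, fun hJ => ⟨hJ, h.island_subset hJ⟩⟩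

open Classical in
-- Descend until islands become no longer than `δ`; they are then still at least `c * δ` long. Such
-- an island contributes at most `C * δ ^ s`, which is paid for by its own length. If one of its
-- descendants meets `(u, v)`, it lies within distance `δ` of that interval, and islands of one
-- generation do not overlap, so Lebesgue measure bounds the total.
theorem sum_diam_meeting_le {s C c : ℝ} (hs : 0 ≤ s) (hC0 : 0 < C) (hc0 : 0 < c)
    (hC : ∀ k, ∀ g, ∀ I ∈ S.islands M g, S.relSum M s k g I ≤ C)
    (hc : ∀ g, ∀ I ∈ S.islands M g, ∀ J ∈ S.desc M g I 1, c * Metric.diam I ≤ Metric.diam J)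
    {u v δ : ℝ} (hδ : 0 < δ) (k : ℕ) {g : ℕ} {I : Set ℝ} (hI : I ∈ S.islands M g)
    (hk : ∀ J ∈ S.desc M g I k, Metric.diam J ≤ δ) (hcI : c * δ ≤ Metric.diam I) :
    ∑ J ∈ S.desc M g I k, (if (J ∩ Ioo u v).Nonempty then Metric.diam J ^ s else 0) ≤
      C * δ ^ s / (c * δ) * volume.real (I ∩ Icc (u - δ) (v + δ)) := by
  have hA : 0 ≤ C * δ ^ s / (c * δ) := by positivity
  have hsmall : ∀ k, ∀ g, ∀ I ∈ S.islands M g, Metric.diam I ≤ δ → c * δ ≤ Metric.diam I →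
      ∑ J ∈ S.desc M g I k, (if (J ∩ Ioo u v).Nonempty then Metric.diam J ^ s else 0) ≤
        C * δ ^ s / (c * δ) * volume.real (I ∩ Icc (u - δ) (v + δ)) := by
    intro k g I hI hId hcI
    by_cases hm : (I ∩ Ioo u v).Nonempty
    · have hsub : I ⊆ Icc (u - δ) (v + δ) := by
        obtain ⟨a, b, H, rfl⟩ := mem_islands_iff.1 hI
        obtain ⟨x, hx1, hx2⟩ := hm
        rw [Real.diam_Icc H.lt.le] at hId
        exact Icc_subset_Icc (by linarith [hx1.2, hx2.1]) (by linarith [hx1.1, hx2.2])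
      rw [inter_eq_left.2 hsub, volume_island hI]
      calc _ ≤ ∑ J ∈ S.desc M g I k, Metric.diam J ^ s :=
            Finset.sum_le_sum fun J _ => by
              split_ifs
              · exact le_rfl
              · exact Real.rpow_nonneg Metric.diam_nonneg _
        _ = Metric.diam I ^ s * S.relSum M s k g I := sum_diam_rpow s k hI
        _ ≤ δ ^ s * C := mul_le_mul (Real.rpow_le_rpow Metric.diam_nonneg hId hs) (hC _ _ _ hI)
            (relSum_nonneg _ _ _ _) (Real.rpow_nonneg hδ.le _)
        _ = C * δ ^ s / (c * δ) * (c * δ) := by field_simp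
        _ ≤ _ := mul_le_mul_of_nonneg_left hcI hA
    · rw [Finset.sum_eq_zero]
      · exact mul_nonneg hA measureReal_nonneg
      · intro J hJ
        exact if_neg fun hJm => hm (hJm.mono (inter_subset_inter_left _ (mem_desc.1 hJ).2))
  induction k generalizing g I with
  | zero => exact hsmall 0 g I hI (hk I ((mem_desc_zero hI).2 rfl)) hcI
  | succ k ih =>
    rcases le_or_gt (Metric.diam I) δ with hle | hgt
    · exact hsmall _ g I hI hle hcI
    rw [Nat.add_comm k 1] at hk ⊢
    rw [h.sum_desc_add 1 k hI]
    calc _ ≤ ∑ J ∈ S.desc M g I 1,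
          C * δ ^ s / (c * δ) * volume.real (J ∩ Icc (u - δ) (v + δ)) := by
          refine Finset.sum_le_sum fun J hJ => ih (mem_desc.1 hJ).1 (fun A hA => hk A ?_) ?_
          · rw [mem_desc] at hA hJ ⊢
            exact ⟨by rw [← Nat.add_assoc]; exact hA.1, hA.2.trans hJ.2⟩
          · exact (mul_le_mul_of_nonneg_left hgt.le hc0.le).trans (hc g I hI J hJ)
      _ = C * δ ^ s / (c * δ) *
          ∑ J ∈ S.desc M g I 1, volume.real (J ∩ Icc (u - δ) (v + δ)) := by
          rw [Finset.mul_sum]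
      _ ≤ _ := mul_le_mul_of_nonneg_left (sum_volume_desc_le g 1 hI measurableSet_Icc) hA

/-- A lower bound for the sums of the lengths to the critical power over finite covers. -/
theorem le_sum_of_cover [Finite (S.OverlapType M)] {s C : ℝ} (hs : 0 ≤ s) (hC0 : 0 < C)
    (hC : ∀ k, ∀ g, ∀ I ∈ S.islands M g, 1 / C ≤ S.relSum M s k g I ∧ S.relSum M s k g I ≤ C) :
    ∃ η : ℝ, 0 < η ∧ ∀ (F : Finset ℕ) (u v : ℕ → ℝ), (∀ i ∈ F, u i < v i) →
      (∀ i ∈ F, v i - u i ≤ 1) → K ⊆ ⋃ i ∈ F, Ioo (u i) (v i) →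
      η ≤ ∑ i ∈ F, (v i - u i) ^ s := by
  classical
  obtain ⟨c, hc0, hc1, hc⟩ := exists_child_diam_ge (S := S) (M := M)
  -- `1 / C` bounds the sum over all islands of a generation from below. The factor `3 * C / c` is
  -- the cost of one covering interval: taking `δ` as its length, its `δ`-neighbourhood has length
  -- `3 * δ`.
  refine ⟨1 / C / (3 * C / c), by positivity, fun F u v huv huv1 hcov => ?_⟩
  have h1 : ∀ i ∈ F, ∃ N, ∀ k ≥ N, ∀ J ∈ S.islands M k, Metric.diam J < v i - u i :=
    fun i hi => h.diam_tendsto (sub_pos.2 (huv i hi))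
  choose! N hN using h1
  set k := F.sup N
  have h2 : 1 / C ≤ ∑ J ∈ S.desc M 0 (Icc 0 1) k, Metric.diam J ^ s := by
    rw [sum_diam_rpow s k h.root_mem, Real.diam_Icc zero_le_one, sub_zero, Real.one_rpow, one_mul]
    exact (hC k 0 _ h.root_mem).1
  have h3 : ∑ J ∈ S.desc M 0 (Icc 0 1) k, Metric.diam J ^ s ≤
      ∑ J ∈ S.desc M 0 (Icc 0 1) k, ∑ i ∈ F,
        (if (J ∩ Ioo (u i) (v i)).Nonempty then Metric.diam J ^ s else 0) := by
    refine Finset.sum_le_sum fun J hJ => ?_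
    obtain ⟨a, b, H, rfl⟩ := mem_islands_iff.1 (h.mem_desc_root.1 hJ)
    obtain ⟨i, hi, hai⟩ := mem_iUnion₂.1 (hcov (h.left_mem H))
    calc Metric.diam (Icc a b) ^ s
        = if (Icc a b ∩ Ioo (u i) (v i)).Nonempty then Metric.diam (Icc a b) ^ s else 0 :=
          (if_pos ⟨a, left_mem_Icc.2 H.lt.le, hai⟩).symm
      _ ≤ _ := Finset.single_le_sum (f := fun i =>
          if (Icc a b ∩ Ioo (u i) (v i)).Nonempty then Metric.diam (Icc a b) ^ s else 0)
          (fun i _ => by split_ifs; exacts [Real.rpow_nonneg Metric.diam_nonneg _, le_rfl]) hi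
  rw [Finset.sum_comm] at h3
  have h4 : ∀ i ∈ F, ∑ J ∈ S.desc M 0 (Icc 0 1) k,
      (if (J ∩ Ioo (u i) (v i)).Nonempty then Metric.diam J ^ s else 0) ≤
      3 * C / c * (v i - u i) ^ s := by
    intro i hi
    have hδ : 0 < v i - u i := sub_pos.2 (huv i hi)
    refine (h.sum_diam_meeting_le hs hC0 hc0 (fun k g I hI => (hC k g I hI).2) hc hδ k
      h.root_mem (fun J hJ => (hN i hi k (Finset.le_sup hi) J (h.mem_desc_root.1 hJ)).le)
      ?_).trans ?_
    · rw [Real.diam_Icc zero_le_one]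
      nlinarith [huv1 i hi]
    · have hle : volume.real (Icc (0 : ℝ) 1 ∩ Icc (u i - (v i - u i)) (v i + (v i - u i))) ≤
          3 * (v i - u i) := by
        refine (measureReal_mono inter_subset_right (by simp)).trans ?_
        rw [Real.volume_real_Icc_of_le (by linarith)]
        linarith
      calc _ ≤ C * (v i - u i) ^ s / (c * (v i - u i)) * (3 * (v i - u i)) :=
            mul_le_mul_of_nonneg_left hle (by positivity)
        _ = _ := by field_simp
  rw [div_le_iff₀ (by positivity), mul_comm, Finset.mul_sum]
  exact h2.trans (h3.trans (Finset.sum_le_sum h4))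

theorem hausdorffMeasure_pos [Finite (S.OverlapType M)] {s C : ℝ} (hs : 0 ≤ s) (hC0 : 0 < C)
    (hC : ∀ k, ∀ g, ∀ I ∈ S.islands M g, 1 / C ≤ S.relSum M s k g I ∧ S.relSum M s k g I ≤ C) :
    μH[s] K ≠ 0 := by
  obtain ⟨η, hη, hle⟩ := h.le_sum_of_cover hs hC0 hC
  suffices hsuff : ENNReal.ofReal η ≤ μH[s] K from
    ((ENNReal.ofReal_pos.2 hη).trans_le hsuff).ne'
  rw [Measure.hausdorffMeasure_apply]
  -- Sets of diameter at most `1 / 2`, enlarged by at most `1 / 2`, give intervals of length at most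
  -- `1`, as `le_sum_of_cover` requires.
  refine le_iSup₂_of_le (1 / 2) (by norm_num) (le_iInf₂ fun t hKt => le_iInf fun htd => ?_)
  refine ENNReal.le_of_forall_pos_le_add fun ε hε _ => ?_
  obtain ⟨ε', hε'0, hε'⟩ := ENNReal.exists_pos_sum_of_countable
    (ENNReal.coe_ne_zero.2 hε.ne') ℕ
  have hbdd : ∀ i, Bornology.IsBounded (t i) := fun i =>
    Metric.isBounded_iff_ediam_ne_top.2 (ne_top_of_le_ne_top (by norm_num) (htd i))
  have hd : ∀ i, ∃ d : ℝ, 0 ≤ d ∧ d ≤ 1 / 2 ∧ Metric.ediam (t i) = ENNReal.ofReal d ∧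
      ∀ x ∈ t i, sInf (t i) ≤ x ∧ x ≤ sInf (t i) + d := by
    intro i
    refine ⟨Metric.diam (t i), Metric.diam_nonneg, ?_, ?_, fun x hx => ?_⟩
    · have := ENNReal.toReal_mono (by norm_num) (htd i)
      simpa [Metric.diam] using this
    · rw [Metric.diam, ENNReal.ofReal_toReal (hbdd i).ediam_ne_top]
    · rw [Real.diam_eq (hbdd i)]
      have h1 := csInf_le (hbdd i).bddBelow hx
      have h2 := le_csSup (hbdd i).bddAbove hx
      exact ⟨h1, by linarith⟩
  choose d hd0 hd1 hde hdx using hd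
  have he : ∀ i, ∃ e : ℝ, 0 < e ∧ e ≤ 1 / 2 ∧ (d i + e) ^ s ≤ d i ^ s + ε' i := by
    intro i
    have hcont : ContinuousAt (fun x : ℝ => x ^ s) (d i) :=
      Real.continuousAt_rpow_const _ _ (Or.inr hs)
    obtain ⟨r, hr, hball⟩ := Metric.continuousAt_iff.1 hcont (ε' i) (NNReal.coe_pos.2 (hε'0 i))
    refine ⟨min (r / 2) (1 / 2), lt_min (half_pos hr) (by norm_num), min_le_right _ _, ?_⟩
    have hm : 0 < min (r / 2) (1 / 2) := lt_min (half_pos hr) (by norm_num)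
    have := hball (x := d i + min (r / 2) (1 / 2)) (by
      rw [Real.dist_eq, add_sub_cancel_left, abs_of_pos hm]
      exact (min_le_left _ _).trans_lt (half_lt_self hr))
    rw [Real.dist_eq] at this
    linarith [le_abs_self ((d i + min (r / 2) (1 / 2)) ^ s - d i ^ s)]
  choose e he0 he1 hes using he
  set u : ℕ → ℝ := fun i => sInf (t i) - e i / 2 with hu
  set v : ℕ → ℝ := fun i => sInf (t i) + d i + e i / 2 with hv
  have hsub : ∀ i, t i ⊆ Ioo (u i) (v i) := fun i x hx => by
    have := hdx i x hx
    have := he0 i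
    simp only [hu, hv]
    constructor <;> linarith
  -- Empty members of the cover are dropped: they contribute no term to the Hausdorff sum.
  obtain ⟨F, hF⟩ := h.compact.elim_finite_subcover
    (fun i => ⋃ _ : (t i).Nonempty, Ioo (u i) (v i))
    (fun i => isOpen_iUnion fun _ => isOpen_Ioo) (hKt.trans (iUnion_mono fun i x hx =>
      mem_iUnion.2 ⟨⟨x, hx⟩, hsub i hx⟩))
  classical
  have hvu : ∀ i, v i - u i = d i + e i := fun i => by simp only [hu, hv]; ring
  have key := hle {i ∈ F | (t i).Nonempty} u v
    (fun i _ => by have := hvu i; have := hd0 i; have := he0 i; linarith)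
    (fun i _ => by have := hvu i; have := hd1 i; have := he1 i; linarith) (by
      intro x hx
      obtain ⟨i, hi, hx⟩ := mem_iUnion₂.1 (hF hx)
      obtain ⟨hi', hx⟩ := mem_iUnion.1 hx
      exact mem_iUnion₂.2 ⟨i, Finset.mem_filter.2 ⟨hi, hi'⟩, hx⟩)
  calc ENNReal.ofReal η
      ≤ ENNReal.ofReal (∑ i ∈ F with (t i).Nonempty, (v i - u i) ^ s) :=
        ENNReal.ofReal_le_ofReal key
    _ = ∑ i ∈ F with (t i).Nonempty, ENNReal.ofReal ((d i + e i) ^ s) := by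
        rw [ENNReal.ofReal_sum_of_nonneg]
        · simp only [hvu]
        · intro i _
          rw [hvu]
          exact Real.rpow_nonneg (add_nonneg (hd0 i) (he0 i).le) _
    _ ≤ ∑ i ∈ F with (t i).Nonempty,
          ((⨆ _ : (t i).Nonempty, Metric.ediam (t i) ^ s) + ε' i) := by
        refine Finset.sum_le_sum fun i hi => ?_
        rw [iSup_pos (Finset.mem_filter.1 hi).2, hde, ENNReal.ofReal_rpow_of_nonneg (hd0 i) hs,
          ← ENNReal.ofReal_coe_nnreal (p := ε' i),
          ← ENNReal.ofReal_add (Real.rpow_nonneg (hd0 i) _) (NNReal.coe_nonneg _)]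
        exact ENNReal.ofReal_le_ofReal (hes i)
    _ ≤ ∑' i, ((⨆ _ : (t i).Nonempty, Metric.ediam (t i) ^ s) + ε' i) :=
        ENNReal.sum_le_tsum _
    _ ≤ _ := by
        rw [ENNReal.tsum_add]
        gcongr

theorem hausdorffMeasure_lt_top [Finite (S.OverlapType M)] {s C : ℝ} (hs : 0 ≤ s)
    (hC : ∀ k, ∀ g, ∀ I ∈ S.islands M g, S.relSum M s k g I ≤ C) :
    μH[s] K ≠ ⊤ := by
  have hle := Measure.hausdorffMeasure_le_liminf_sum (ι := fun k => S.desc M 0 (Icc 0 1) k) s K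
    (l := atTop) (fun k => ⨆ J : S.desc M 0 (Icc 0 1) k, Metric.ediam (J : Set ℝ)) ?_
    (fun k J => (J : Set ℝ)) (Eventually.of_forall fun k J => le_iSup
      (fun J : S.desc M 0 (Icc 0 1) k => Metric.ediam (J : Set ℝ)) J)
    (Eventually.of_forall fun k x hx => ?_)
  · refine ne_top_of_le_ne_top (ENNReal.ofReal_ne_top (r := C))
      (hle.trans (liminf_le_of_le (by isBoundedDefault) fun b hb => ?_))
    obtain ⟨k, hk⟩ := hb.exists
    refine hk.trans ?_
    rw [Finset.sum_coe_sort (S.desc M 0 (Icc 0 1) k) fun J => Metric.ediam J ^ s]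
    calc _ = ∑ J ∈ S.desc M 0 (Icc 0 1) k, ENNReal.ofReal (Metric.diam J ^ s) :=
          Finset.sum_congr rfl fun J hJ => by
            rw [ediam_island (mem_desc.1 hJ).1, ENNReal.ofReal_rpow_of_nonneg
              Metric.diam_nonneg hs]
      _ = ENNReal.ofReal (∑ J ∈ S.desc M 0 (Icc 0 1) k, Metric.diam J ^ s) :=
          (ENNReal.ofReal_sum_of_nonneg fun J _ => Real.rpow_nonneg Metric.diam_nonneg _).symm
      _ ≤ _ := by
          refine ENNReal.ofReal_le_ofReal ?_
          rw [sum_diam_rpow s k h.root_mem, Real.diam_Icc zero_le_one, sub_zero, Real.one_rpow,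
            one_mul]
          exact hC k 0 _ h.root_mem
  · rw [ENNReal.tendsto_atTop_zero]
    intro ε hε
    obtain ⟨r, hr0, hr⟩ := ENNReal.lt_iff_exists_real_btwn.1 hε
    obtain ⟨N, hN⟩ := h.diam_tendsto (ENNReal.ofReal_pos.1 hr.1)
    refine ⟨N, fun k hk => iSup_le fun J => le_trans ?_ hr.2.le⟩
    rw [ediam_island (mem_desc.1 J.2).1]
    exact ENNReal.ofReal_le_ofReal (hN k hk _ (h.mem_desc_root.1 J.2)).le
  · obtain ⟨I, hI, hxI⟩ := h.exists_island_of_mem k hx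
    exact mem_iUnion.2 ⟨⟨I, h.mem_desc_root.2 hI⟩, hxI⟩

theorem infinite : K.Infinite := by
  intro hf
  obtain ⟨x, ⟨hxK, hx0⟩, hmin⟩ := (hf.subset (sep_subset K fun x => 0 < x)).exists_minimal
    ⟨1, h.one_mem, one_pos⟩
  have h1 : S.map 0 x ∈ K := h.map_subset 0 (mem_image_of_mem _ hxK)
  have h2 := S.map_sub_map 0 x 0
  rw [h.map_zero, sub_zero, sub_zero] at h2
  have h3 : 0 < S.map 0 x := h2 ▸ mul_pos (S.ρ_pos 0) hx0
  have h4 : S.map 0 x < x := by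
    rw [h2]; nlinarith [S.ρ_lt_one 0]
  exact absurd (hmin ⟨h1, h3⟩ h4.le) (not_le.2 h4)

/-- A measure that is neither zero nor infinite identifies the critical exponent with the dimension.
The dimension is not zero, because the measure of the infinite set `K` would then be infinite. -/
theorem hausdorffMeasure_dimH [Finite (S.OverlapType M)] (htr : S.IsTransitive M) {α : ℝ≥0}
    (hdim : dimH K = α) : 0 < α ∧ μH[α] K ≠ 0 ∧ μH[α] K ≠ ⊤ := by
  obtain ⟨s, C, hs, hC0, hC⟩ := h.exists_critical_bounds htr
  have h1 := h.hausdorffMeasure_pos hs hC0 hC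
  have h2 := h.hausdorffMeasure_lt_top hs (fun k g I hI => (hC k g I hI).2)
  lift s to ℝ≥0 using hs
  have h3 := dimH_of_hausdorffMeasure_ne_zero_ne_top h1 h2
  rw [hdim] at h3
  have h4 : α = s := by exact_mod_cast h3
  subst h4
  refine ⟨pos_iff_ne_zero.2 ?_, h1, h2⟩
  rintro rfl
  obtain ⟨N, hN⟩ := ENNReal.exists_nat_gt h2
  obtain ⟨F, hFK, hF⟩ := h.infinite.exists_subset_card_eq N
  have h5 : (N : ℝ≥0∞) ≤ μH[(0 : ℝ≥0)] K := by
    calc (N : ℝ≥0∞) = ∑ x ∈ F, μH[((0 : ℝ≥0) : ℝ)] ({x} : Set ℝ) := by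
          simp [hF]
      _ = μH[((0 : ℝ≥0) : ℝ)] (F : Set ℝ) := by
          rw [sum_measure_singleton]
      _ ≤ _ := measure_mono hFK
  exact absurd h5 (not_le.2 hN)

end IsIslandSystem

end LinearIFS

/-! ### The normalized measure under similarities and word maps -/

open scoped Pointwise in
theorem hausdorffMeasure_affineFun_image {α : ℝ} (hα : 0 ≤ α) {p : ℝ} (q : ℝ) (hp : p ≠ 0)
    (A : Set ℝ) : μH[α] (affineFun p q '' A) = ENNReal.ofReal |p| ^ α * μH[α] A := by
  rw [affineFun_image_eq, (isometry_add_left q).hausdorffMeasure_image (Or.inl hα),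
    Measure.hausdorffMeasure_smul₀ hα hp, ENNReal.smul_def, smul_eq_mul]
  congr 1
  rw [← Real.norm_eq_abs, ofReal_norm, enorm_eq_nnnorm, ← ENNReal.coe_rpow_of_nonneg _ hα]

theorem ENNReal.mul_ofReal_mul_rpow {α c x : ℝ} (hα : 0 ≤ α) (hc : 0 ≤ c) (E : ℝ≥0∞) :
    E * ENNReal.ofReal (c * x) ^ α = ENNReal.ofReal c ^ α * (E * ENNReal.ofReal x ^ α) := by
  rw [ENNReal.ofReal_mul hc, ENNReal.mul_rpow_of_nonneg _ _ hα]
  ring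

theorem ENNReal.mul_ofReal_add_rpow_le {α x y : ℝ} (hα : 0 ≤ α) (hα1 : α ≤ 1) (hx : 0 ≤ x)
    (hy : 0 ≤ y) (E : ℝ≥0∞) :
    E * ENNReal.ofReal (x + y) ^ α ≤ E * ENNReal.ofReal x ^ α + E * ENNReal.ofReal y ^ α := by
  rw [ENNReal.ofReal_add hx hy, ← mul_add]
  gcongr
  exact ENNReal.rpow_add_le_add_rpow _ _ hα hα1

namespace LinearIFS

variable {n : ℕ}

/-- An island system whose attractor has positive and finite Hausdorff measure of dimension
`0 < α < 1`, with finitely many overlap types and the transitivity of the types. -/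
structure IsRegularSystem (S : LinearIFS n) (K : Set ℝ) (M : ℕ → Finset (List (Fin (n + 1))))
    (α : ℝ) : Prop extends S.IsIslandSystem K M where
  pos : 0 < α
  lt_one : α < 1
  measure_ne_zero : μH[α] K ≠ 0
  measure_ne_top : μH[α] K ≠ ⊤
  finite : Finite (S.OverlapType M)
  transitive : S.IsTransitive M

variable {S : LinearIFS n} {M : ℕ → Finset (List (Fin (n + 1)))} {K : Set ℝ} {α : ℝ}

namespace IsRegularSystem

variable (h : S.IsRegularSystem K M α)
include h

theorem measurableSet : MeasurableSet K := h.compact.measurableSet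

theorem measure_apply (A : Set ℝ) :
    normalizedHausdorff α K A = (μH[α] K)⁻¹ * μH[α] (K ∩ A) := by
  rw [normalizedHausdorff, Measure.smul_apply, Measure.restrict_apply' h.measurableSet,
    smul_eq_mul, inter_comm]

theorem isProbabilityMeasure : IsProbabilityMeasure (normalizedHausdorff α K) :=
  ⟨by rw [h.measure_apply, inter_univ, ENNReal.inv_mul_cancel h.measure_ne_zero h.measure_ne_top]⟩

theorem nullSingletonClass : NullSingletonClass (normalizedHausdorff α K) := by
  have := Measure.nullSingletonClass_hausdorff ℝ h.pos
  refine ⟨fun x => ?_⟩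
  rw [h.measure_apply, measure_mono_null (inter_subset_right) (measure_singleton x), mul_zero]

theorem measure_compl : normalizedHausdorff α K Kᶜ = 0 := by
  rw [h.measure_apply, inter_compl_self, measure_empty, mul_zero]

theorem measure_mono_of_inter {A B : Set ℝ} (hAB : K ∩ A ⊆ B) :
    normalizedHausdorff α K A ≤ normalizedHausdorff α K B := by
  rw [h.measure_apply, h.measure_apply]
  exact mul_le_mul' le_rfl (measure_mono (subset_inter inter_subset_left hAB))

theorem measure_eq_one {A : Set ℝ} (hA : K ⊆ A) : normalizedHausdorff α K A = 1 := by
  rw [h.measure_apply, inter_eq_left.2 hA,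
    ENNReal.inv_mul_cancel h.measure_ne_zero h.measure_ne_top]

theorem measure_Icc : normalizedHausdorff α K (Icc 0 1) = 1 := h.measure_eq_one h.subset_Icc

theorem le_measure_of_image_subset {p q : ℝ} (hp : p ≠ 0) {A B : Set ℝ}
    (hAB : affineFun p q '' (K ∩ A) ⊆ K ∩ B) :
    ENNReal.ofReal |p| ^ α * normalizedHausdorff α K A ≤ normalizedHausdorff α K B := by
  rw [h.measure_apply, h.measure_apply, mul_left_comm,
    ← hausdorffMeasure_affineFun_image h.pos.le q hp]
  gcongr

theorem measure_le_of_subset_image {p q : ℝ} (hp : p ≠ 0) {A B : Set ℝ}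
    (hAB : K ∩ B ⊆ affineFun p q '' (K ∩ A)) :
    normalizedHausdorff α K B ≤ ENNReal.ofReal |p| ^ α * normalizedHausdorff α K A := by
  rw [h.measure_apply, h.measure_apply, mul_left_comm,
    ← hausdorffMeasure_affineFun_image h.pos.le q hp]
  gcongr

theorem measure_similar_image {p q : ℝ} {g g' : ℕ} {I I' : Set ℝ} (hI : I ∈ S.islands M g)
    (hI' : I' ∈ S.islands M g') (H : S.Similar M p q g I g' I') {A : Set ℝ} (hA : A ⊆ I) :
    normalizedHausdorff α K (affineFun p q '' A) =
      ENNReal.ofReal |p| ^ α * normalizedHausdorff α K A := by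
  have := h.finite
  have e := h.similar_image hI hI' H
  apply le_antisymm
  · refine h.measure_le_of_subset_image (q := q) H.ne_zero ?_
    rintro _ ⟨hxK, x, hxA, rfl⟩
    have hx : affineFun p q x ∈ K ∩ I' := ⟨hxK, H.image_eq ▸ mem_image_of_mem _ (hA hxA)⟩
    rw [← e] at hx
    obtain ⟨y, hy, hyx⟩ := hx
    obtain rfl := affineFun_injective q H.ne_zero hyx
    exact ⟨y, ⟨hy.1, hxA⟩, rfl⟩
  · refine h.le_measure_of_image_subset (q := q) H.ne_zero ?_
    rintro _ ⟨x, ⟨hxK, hxA⟩, rfl⟩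
    have hx : affineFun p q x ∈ affineFun p q '' (K ∩ I) := mem_image_of_mem _ ⟨hxK, hA hxA⟩
    rw [e] at hx
    exact ⟨hx.1, mem_image_of_mem _ hxA⟩

/-- Overlaps can only add mass: `S_w K ⊆ K` gives this inequality for every word. The converse
`measure_wordMap_le` needs the trace of `K` to come from `S_w K` alone. -/
theorem le_measure_wordMap (w : List (Fin (n + 1))) (u v : ℝ) :
    ENNReal.ofReal (S.ratio w) ^ α * normalizedHausdorff α K (Icc u v) ≤
      normalizedHausdorff α K (Icc (S.wordMap w u) (S.wordMap w v)) := by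
  have := h.le_measure_of_image_subset (p := S.ratio w) (q := S.wordMap w 0)
    (S.ratio_pos w).ne' (A := Icc u v) (B := Icc (S.wordMap w u) (S.wordMap w v)) (by
      rw [show affineFun (S.ratio w) (S.wordMap w 0) = S.wordMap w from
        (S.wordMap_eq_affine w).symm, ← S.wordMap_image_Icc]
      exact (image_inter_subset _ _ _).trans (inter_subset_inter_left _ (h.wordMap_subset w)))
  rwa [abs_of_pos (S.ratio_pos w)] at this

theorem measure_wordMap_le {w : List (Fin (n + 1))} {A : Set ℝ} {u v : ℝ}
    (hA : K ∩ A ⊆ S.wordMap w '' (K ∩ Icc u v)) :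
    normalizedHausdorff α K A ≤
      ENNReal.ofReal (S.ratio w) ^ α * normalizedHausdorff α K (Icc u v) := by
  rw [S.wordMap_eq_affine] at hA
  have := h.measure_le_of_subset_image (p := S.ratio w) (q := S.wordMap w 0)
    (S.ratio_pos w).ne' (A := Icc u v) hA
  rwa [abs_of_pos (S.ratio_pos w)] at this

theorem measure_union_Icc {a b c : ℝ} (hab : a ≤ b) (hbc : b ≤ c) :
    normalizedHausdorff α K (Icc a c) =
      normalizedHausdorff α K (Icc a b) + normalizedHausdorff α K (Icc b c) := by
  have := h.nullSingletonClass
  rw [← Icc_union_Ioc_eq_Icc hab hbc, measure_union (disjoint_left.2 fun x hx hx' =>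
    not_lt.2 hx.2 hx'.1) measurableSet_Ioc, measure_congr (Ioc_ae_eq_Icc (a := b) (b := c))]

theorem measure_component_pos {k : ℕ} {a b : ℝ} (H : S.IsComponent M k a b) :
    0 < normalizedHausdorff α K (Icc a b) := by
  obtain ⟨w, hw, hwa, hwb⟩ := H.exists_word_left
  have h1 := h.le_measure_wordMap w 0 1
  rw [h.measure_Icc, mul_one] at h1
  refine lt_of_lt_of_le ?_ (h1.trans (measure_mono (Icc_subset_Icc hwa.ge hwb)))
  exact ENNReal.rpow_pos (ENNReal.ofReal_pos.2 (S.ratio_pos w)) ENNReal.ofReal_ne_top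

theorem le_density_iff {u v : ℝ} (huv : u < v) {D : ℝ≥0∞} :
    D ≤ density α K (Icc u v) ↔
      D * ENNReal.ofReal (v - u) ^ α ≤ normalizedHausdorff α K (Icc u v) := by
  have h1 : ENNReal.ofReal (v - u) ^ α ≠ 0 :=
    (ENNReal.rpow_pos (ENNReal.ofReal_pos.2 (sub_pos.2 huv)) ENNReal.ofReal_ne_top).ne'
  have h2 : ENNReal.ofReal (v - u) ^ α ≠ ⊤ :=
    ENNReal.rpow_ne_top_of_nonneg h.pos.le ENNReal.ofReal_ne_top
  rw [density, Real.ediam_Icc, ENNReal.le_div_iff_mul_le (Or.inl h1) (Or.inl h2)]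

end IsRegularSystem

/-- A point outside the islands of a generation has a next island on the right. -/
theorem IsIslandSystem.exists_next (h : S.IsIslandSystem K M) (k : ℕ) {x : ℝ} (hx : x ≤ 1)
    (hxI : ∀ I ∈ S.islands M k, x ∉ I) :
    ∃ a b, S.IsComponent M k a b ∧ x < a ∧ ∀ y ∈ K, x ≤ y → a ≤ y := by
  obtain ⟨c, d, H, hcd⟩ := h.exists_component_of_mem k h.one_mem
  have hfin : {I | I ∈ S.islands M k ∧ x < sInf I}.Finite :=
    (finite_islands k).subset fun _ h => h.1
  have hc : x < c := by
    by_contra! hle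
    exact hxI _ H.mem_islands ⟨hle, hx.trans hcd.2⟩
  obtain ⟨I, ⟨hI, hxI'⟩, hmin⟩ := hfin.exists_minimalFor sInf _
    ⟨_, H.mem_islands, by rwa [csInf_Icc H.lt.le]⟩
  obtain ⟨a, b, H', rfl⟩ := mem_islands_iff.1 hI
  rw [csInf_Icc H'.lt.le] at hxI'
  refine ⟨a, b, H', hxI', fun y hy hxy => ?_⟩
  obtain ⟨c', d', H'', hcd'⟩ := h.exists_component_of_mem k hy
  have hc' : x < c' := by
    by_contra! hle
    exact hxI _ H''.mem_islands ⟨hle, hxy.trans hcd'.2⟩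
  have := hmin ⟨H''.mem_islands, by rwa [csInf_Icc H''.lt.le]⟩
  simp only [csInf_Icc H''.lt.le, csInf_Icc H'.lt.le] at this
  by_contra! hlt
  linarith [this (by linarith [hcd'.1]), hcd'.1]

/-- A point outside the islands of a generation has a previous island on the left. -/
theorem IsIslandSystem.exists_prev (h : S.IsIslandSystem K M) (k : ℕ) {x : ℝ} (hx : 0 ≤ x)
    (hxI : ∀ I ∈ S.islands M k, x ∉ I) :
    ∃ a b, S.IsComponent M k a b ∧ b < x ∧ ∀ y ∈ K, y ≤ x → y ≤ b := by
  obtain ⟨c, d, H, hcd⟩ := h.exists_component_of_mem k h.zero_mem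
  have hfin : {I | I ∈ S.islands M k ∧ sSup I < x}.Finite :=
    (finite_islands k).subset fun _ h => h.1
  have hc : d < x := by
    by_contra! hle
    exact hxI _ H.mem_islands ⟨hcd.1.trans hx, hle⟩
  obtain ⟨I, ⟨hI, hxI'⟩, hmax⟩ := hfin.exists_maximalFor sSup _
    ⟨_, H.mem_islands, by rwa [csSup_Icc H.lt.le]⟩
  obtain ⟨a, b, H', rfl⟩ := mem_islands_iff.1 hI
  rw [csSup_Icc H'.lt.le] at hxI'
  refine ⟨a, b, H', hxI', fun y hy hxy => ?_⟩
  obtain ⟨c', d', H'', hcd'⟩ := h.exists_component_of_mem k hy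
  have hc' : d' < x := by
    by_contra! hle
    exact hxI _ H''.mem_islands ⟨hcd'.1.trans hxy, hle⟩
  have := hmax ⟨H''.mem_islands, by rwa [csSup_Icc H''.lt.le]⟩
  simp only [csSup_Icc H''.lt.le, csSup_Icc H'.lt.le] at this
  by_contra! hlt
  linarith [this (by linarith [hcd'.2]), hcd'.2]

end LinearIFS

/-! ### One-sided densities: from finitely many endpoints to all points -/

namespace LinearIFS

variable {n : ℕ} {S : LinearIFS n} {M : ℕ → Finset (List (Fin (n + 1)))} {K : Set ℝ} {α : ℝ}

theorem map_zero_eq (h0 : S.map 0 0 = 0) (x : ℝ) : S.map 0 x = S.ρ 0 * x := by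
  have := S.map_sub_map 0 x 0
  rw [h0] at this; linarith

theorem one_sub_map_last (h1 : S.map (Fin.last n) 1 = 1) (x : ℝ) :
    1 - S.map (Fin.last n) x = S.ρ (Fin.last n) * (1 - x) := by
  have := S.map_sub_map (Fin.last n) 1 x
  rwa [h1] at this

namespace IsRegularSystem

variable (h : S.IsRegularSystem K M α)
include h

/-- Assumption B excludes other pieces of `K` from the first interval, so the scaling at `0` is
exact and not merely an inequality. -/
theorem measure_scale_left (hB : S.AssumptionB K) {x : ℝ} (hx1 : x ≤ 1) :
    normalizedHausdorff α K (Icc 0 (S.ρ 0 * x)) =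
      ENNReal.ofReal (S.ρ 0) ^ α * normalizedHausdorff α K (Icc 0 x) := by
  have hρ := S.ρ_pos 0
  have hw : S.wordMap [0] = S.map 0 := rfl
  apply le_antisymm
  · have := h.measure_wordMap_le (w := [0]) (A := Icc 0 (S.ρ 0 * x)) (u := 0) (v := x) ?_
    · simpa using this
    rintro y ⟨hyK, hy0, hyx⟩
    have hy : y ∈ S.map 0 '' Icc 0 1 ∩ K := by
      refine ⟨⟨y / S.ρ 0, ⟨by positivity, ?_⟩, ?_⟩, hyK⟩
      · rw [div_le_one hρ]; nlinarith
      · rw [map_zero_eq h.map_zero]; field_simp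
    rw [hB.1] at hy
    obtain ⟨z, hz, rfl⟩ := hy
    refine ⟨z, ⟨hz, (h.subset_Icc hz).1, ?_⟩, rfl⟩
    rw [map_zero_eq h.map_zero] at hyx
    exact le_of_mul_le_mul_left hyx hρ
  · have := h.le_measure_wordMap [0] 0 x
    rw [hw, h.map_zero, map_zero_eq h.map_zero] at this
    simpa using this

theorem measure_scale_right (hB : S.AssumptionB K) {x : ℝ} (hx1 : x ≤ 1) :
    normalizedHausdorff α K (Icc (1 - S.ρ (Fin.last n) * x) 1) =
      ENNReal.ofReal (S.ρ (Fin.last n)) ^ α * normalizedHausdorff α K (Icc (1 - x) 1) := by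
  have hρ := S.ρ_pos (Fin.last n)
  have hw : S.wordMap [Fin.last n] = S.map (Fin.last n) := rfl
  apply le_antisymm
  · have := h.measure_wordMap_le (w := [Fin.last n]) (A := Icc (1 - S.ρ (Fin.last n) * x) 1)
      (u := 1 - x) (v := 1) ?_
    · simpa using this
    rintro y ⟨hyK, hy0, hyx⟩
    have hy : y ∈ S.map (Fin.last n) '' Icc 0 1 ∩ K := by
      refine ⟨⟨1 - (1 - y) / S.ρ (Fin.last n), ⟨?_, ?_⟩, ?_⟩, hyK⟩
      · rw [sub_nonneg, div_le_one hρ]; nlinarith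
      · have : 0 ≤ (1 - y) / S.ρ (Fin.last n) := div_nonneg (by linarith) hρ.le
        linarith
      · have := one_sub_map_last h.map_one (1 - (1 - y) / S.ρ (Fin.last n))
        rw [sub_sub_cancel, mul_div_cancel₀ _ hρ.ne'] at this
        linarith
    rw [hB.2] at hy
    obtain ⟨z, hz, rfl⟩ := hy
    refine ⟨z, ⟨hz, ?_, (h.subset_Icc hz).2⟩, rfl⟩
    have e := one_sub_map_last h.map_one z
    have : 1 - z ≤ x := le_of_mul_le_mul_left (by linarith) hρ
    linarith
  · have := h.le_measure_wordMap [Fin.last n] (1 - x) 1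
    have e := one_sub_map_last h.map_one (1 - x)
    rw [sub_sub_cancel] at e
    rw [hw, h.map_one, show S.map (Fin.last n) (1 - x) = 1 - S.ρ (Fin.last n) * x by linarith]
      at this
    simpa using this

/-- A lower bound for the density at the left end of the attractor holds at the left end of each
island. -/
theorem le_measure_island_left {E : ℝ≥0∞}
    (hE : ∀ x, 0 < x → x ≤ 1 →
      E * ENNReal.ofReal x ^ α ≤ normalizedHausdorff α K (Icc 0 x))
    {k : ℕ} {a b : ℝ} (H : S.IsComponent M k a b) {d : ℝ} (had : a < d) (hdb : d ≤ b) :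
    E * ENNReal.ofReal (d - a) ^ α ≤ normalizedHausdorff α K (Icc a d) := by
  classical
  -- Cut at the left end `g` of a word interval reaching `d`. The last piece is an image of an
  -- initial piece `[0, t]`; the rest ends at `g`, so the word itself is no longer counted.
  -- Subadditivity of the power joins the pieces.
  induction hN : {w ∈ M k | a ≤ S.wordMap w 0 ∧ S.wordMap w 0 < d}.card using
    Nat.strong_induction_on generalizing d with
  | _ N ih =>
  obtain ⟨w, hw, hwd, hdw, haw⟩ :
      ∃ w ∈ M k, S.wordMap w 0 < d ∧ d ≤ S.wordMap w 1 ∧ a ≤ S.wordMap w 0 := by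
    rcases hdb.eq_or_lt with rfl | hlt
    · obtain ⟨w, hw, hwb, haw⟩ := H.exists_word_right
      exact ⟨w, hw, hwb ▸ S.wordMap_zero_lt_one w, hwb.ge, haw⟩
    · obtain ⟨w, hw, hwd, haw, -⟩ := H.exists_word_Ioo ⟨had, hlt⟩
      exact ⟨w, hw, hwd.1, hwd.2.le, haw⟩
  have hr := S.ratio_pos w
  set g := S.wordMap w 0 with hg
  have hlast : E * ENNReal.ofReal (d - g) ^ α ≤ normalizedHausdorff α K (Icc g d) := by
    have h1 := hE ((d - g) / S.ratio w) (div_pos (by linarith) hr) (by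
      rw [div_le_one hr]
      have := S.wordMap_one w
      linarith)
    have h2 := h.le_measure_wordMap w 0 ((d - g) / S.ratio w)
    rw [← hg, S.wordMap_apply w ((d - g) / S.ratio w), ← hg, mul_div_cancel₀ _ hr.ne',
      sub_add_cancel] at h2
    calc _ = E * ENNReal.ofReal (S.ratio w * ((d - g) / S.ratio w)) ^ α := by
          rw [mul_div_cancel₀ _ hr.ne']
      _ = _ := ENNReal.mul_ofReal_mul_rpow h.pos.le hr.le E
      _ ≤ _ := (mul_le_mul' le_rfl h1).trans h2
  rcases haw.eq_or_lt with heq | hlt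
  · rwa [← heq] at hlast
  have hfirst := ih _ (by
    rw [← hN]
    refine Finset.card_lt_card (Finset.ssubset_iff_of_subset ?_ |>.2 ⟨w, ?_, ?_⟩)
    · intro v hv
      simp only [Finset.mem_filter] at hv ⊢
      exact ⟨hv.1, hv.2.1, hv.2.2.trans hwd⟩
    · simp only [Finset.mem_filter]; exact ⟨hw, haw, hwd⟩
    · simp only [Finset.mem_filter, not_and, not_lt]; exact fun _ _ => le_rfl) hlt
    (hwd.le.trans hdb) rfl
  calc E * ENNReal.ofReal (d - a) ^ α = E * ENNReal.ofReal ((g - a) + (d - g)) ^ α := by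
        congr 3; ring
    _ ≤ _ := ENNReal.mul_ofReal_add_rpow_le h.pos.le h.lt_one.le (by linarith) (by linarith) E
    _ ≤ _ := add_le_add hfirst hlast
    _ = _ := (h.measure_union_Icc hlt.le hwd.le).symm

theorem le_measure_island_right {E : ℝ≥0∞}
    (hE : ∀ x, 0 < x → x ≤ 1 →
      E * ENNReal.ofReal x ^ α ≤ normalizedHausdorff α K (Icc (1 - x) 1))
    {k : ℕ} {a b : ℝ} (H : S.IsComponent M k a b) {d : ℝ} (had : a ≤ d) (hdb : d < b) :
    E * ENNReal.ofReal (b - d) ^ α ≤ normalizedHausdorff α K (Icc d b) := by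
  classical
  induction hN : {w ∈ M k | S.wordMap w 1 ≤ b ∧ d < S.wordMap w 1}.card using
    Nat.strong_induction_on generalizing d with
  | _ N ih =>
  obtain ⟨w, hw, hwd, hdw, hwb⟩ :
      ∃ w ∈ M k, d < S.wordMap w 1 ∧ S.wordMap w 0 ≤ d ∧ S.wordMap w 1 ≤ b := by
    rcases had.eq_or_lt with rfl | hlt
    · obtain ⟨w, hw, hwa, hwb⟩ := H.exists_word_left
      exact ⟨w, hw, hwa ▸ S.wordMap_zero_lt_one w, hwa.le, hwb⟩
    · obtain ⟨w, hw, hwd, -, hwb⟩ := H.exists_word_Ioo ⟨hlt, hdb⟩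
      exact ⟨w, hw, hwd.2, hwd.1.le, hwb⟩
  have hr := S.ratio_pos w
  set g := S.wordMap w 1 with hg
  have hlast : E * ENNReal.ofReal (g - d) ^ α ≤ normalizedHausdorff α K (Icc d g) := by
    have e := S.wordMap_one w
    have h1 := hE ((g - d) / S.ratio w) (div_pos (by linarith) hr) (by
      rw [div_le_one hr]
      linarith)
    have h2 := h.le_measure_wordMap w (1 - (g - d) / S.ratio w) 1
    rw [← hg, S.wordMap_apply w (1 - (g - d) / S.ratio w), mul_sub, mul_div_cancel₀ _ hr.ne',
      show S.ratio w * 1 - (g - d) + S.wordMap w 0 = d by linarith] at h2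
    calc _ = E * ENNReal.ofReal (S.ratio w * ((g - d) / S.ratio w)) ^ α := by
          rw [mul_div_cancel₀ _ hr.ne']
      _ = _ := ENNReal.mul_ofReal_mul_rpow h.pos.le hr.le E
      _ ≤ _ := (mul_le_mul' le_rfl h1).trans h2
  rcases hwb.eq_or_lt with heq | hlt
  · rwa [heq] at hlast
  have hfirst := ih _ (by
    rw [← hN]
    refine Finset.card_lt_card (Finset.ssubset_iff_of_subset ?_ |>.2 ⟨w, ?_, ?_⟩)
    · intro v hv
      simp only [Finset.mem_filter] at hv ⊢
      exact ⟨hv.1, hv.2.1, hwd.trans hv.2.2⟩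
    · simp only [Finset.mem_filter]; exact ⟨hw, hwb, hwd⟩
    · simp only [Finset.mem_filter, not_and, not_lt]; exact fun _ _ => le_rfl)
    (had.trans hwd.le) hlt rfl
  calc E * ENNReal.ofReal (b - d) ^ α = E * ENNReal.ofReal ((g - d) + (b - g)) ^ α := by
        congr 3; ring
    _ ≤ _ := ENNReal.mul_ofReal_add_rpow_le h.pos.le h.lt_one.le (by linarith) (by linarith) E
    _ ≤ _ := add_le_add hlast hfirst
    _ = _ := (h.measure_union_Icc hwd.le hlt.le).symm

omit h in
-- Powers of `ρ` move `(ρ, 1]` over all of `(0, 1]`.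
theorem scale_induction {ρ : ℝ} (hρ0 : 0 < ρ) (hρ1 : ρ < 1) {P : ℝ → Prop}
    (hP : ∀ x, ρ < x → x ≤ 1 → P x) (hs : ∀ x, 0 < x → x ≤ 1 → P x → P (ρ * x)) {x : ℝ}
    (hx0 : 0 < x) (hx1 : x ≤ 1) : P x := by
  obtain ⟨N, hN⟩ := exists_pow_lt_of_lt_one hx0 hρ1
  induction N generalizing x with
  | zero => rw [pow_zero] at hN; linarith
  | succ N ih =>
    rcases lt_or_ge ρ x with hlt | hge
    · exact hP x hlt hx1
    · have := hs (x / ρ) (div_pos hx0 hρ0) ((div_le_one hρ0).2 hge)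
        (ih (div_pos hx0 hρ0) ((div_le_one hρ0).2 hge) (by
          rw [lt_div_iff₀ hρ0, ← pow_succ]; exact hN))
      rwa [mul_div_cancel₀ _ hρ0.ne'] at this

omit h in
-- Let `G` be the best constant. If `G ≤ E`, the hypothesis raises it by `(E - G) * β ^ α` on the
-- fundamental domain `(ρ, 1]`, hence everywhere by exact scaling. Since `G` is finite and optimal,
-- the gain vanishes, that is, `E ≤ G`.
theorem le_of_bootstrap {f : ℝ → ℝ≥0∞} {E : ℝ≥0∞} {α β ρ : ℝ} (hα : 0 < α) (hβ : 0 < β)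
    (hρ0 : 0 < ρ) (hρ1 : ρ < 1) (hf1 : f 1 ≠ ⊤)
    (hs : ∀ x, 0 < x → x ≤ 1 → f (ρ * x) = ENNReal.ofReal ρ ^ α * f x)
    (hboot : ∀ G ≤ E, (∀ x, 0 < x → x ≤ 1 → G * ENNReal.ofReal x ^ α ≤ f x) →
      ∀ x, ρ < x → x ≤ 1 →
        (G + (E - G) * ENNReal.ofReal β ^ α) * ENNReal.ofReal x ^ α ≤ f x)
    {x : ℝ} (hx0 : 0 < x) (hx1 : x ≤ 1) : E * ENNReal.ofReal x ^ α ≤ f x := by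
  have hne0 : ∀ x : ℝ, 0 < x → ENNReal.ofReal x ^ α ≠ 0 := fun x hx =>
    (ENNReal.rpow_pos (ENNReal.ofReal_pos.2 hx) ENNReal.ofReal_ne_top).ne'
  have hnet : ∀ x : ℝ, ENNReal.ofReal x ^ α ≠ ⊤ := fun x =>
    ENNReal.rpow_ne_top_of_nonneg hα.le ENNReal.ofReal_ne_top
  set G : ℝ≥0∞ := ⨅ x : Ioc (0 : ℝ) 1, f x / ENNReal.ofReal x ^ α with hG
  have hGle : ∀ x, 0 < x → x ≤ 1 → G * ENNReal.ofReal x ^ α ≤ f x := fun x hx0 hx1 => by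
    rw [← ENNReal.le_div_iff_mul_le (Or.inl (hne0 x hx0)) (Or.inl (hnet x))]
    exact iInf_le (fun x : Ioc (0 : ℝ) 1 => f x / ENNReal.ofReal x ^ α) ⟨x, hx0, hx1⟩
  rcases le_total E G with hEG | hGE
  · exact (mul_le_mul' hEG le_rfl).trans (hGle x hx0 hx1)
  have hGt : G ≠ ⊤ := by
    have := hGle 1 one_pos le_rfl
    rw [ENNReal.ofReal_one, ENNReal.one_rpow, mul_one] at this
    exact ne_top_of_le_ne_top hf1 this
  have key : G + (E - G) * ENNReal.ofReal β ^ α ≤ G := by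
    refine le_iInf fun x => ?_
    rw [ENNReal.le_div_iff_mul_le (Or.inl (hne0 x x.2.1)) (Or.inl (hnet x))]
    refine scale_induction hρ0 hρ1 (P := fun x =>
      (G + (E - G) * ENNReal.ofReal β ^ α) * ENNReal.ofReal x ^ α ≤ f x)
      (hboot G hGE hGle) (fun y hy0 hy1 hy => ?_) x.2.1 x.2.2
    rw [ENNReal.mul_ofReal_mul_rpow hα.le hρ0.le, hs y hy0 hy1]
    exact mul_le_mul' le_rfl hy
  have h0 : (E - G) * ENNReal.ofReal β ^ α = 0 := by
    have := (ENNReal.add_le_add_iff_left hGt).1 (key.trans_eq (add_zero G).symm)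
    exact le_antisymm this zero_le
  have hEG : E ≤ G := by
    rcases mul_eq_zero.1 h0 with h1 | h1
    · exact tsub_eq_zero_iff_le.1 h1
    · exact absurd h1 (hne0 β hβ)
  exact (mul_le_mul' hEG le_rfl).trans (hGle x hx0 hx1)

omit h in
theorem bootstrap_le {α β x : ℝ} (hα : 0 < α) (hx1 : x ≤ 1) (E G : ℝ≥0∞) :
    (G + (E - G) * ENNReal.ofReal β ^ α) * ENNReal.ofReal x ^ α ≤
      G * ENNReal.ofReal x ^ α + (E - G) * ENNReal.ofReal β ^ α := by
  rw [add_mul]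
  refine add_le_add le_rfl (mul_le_of_le_one_right' ?_)
  exact ENNReal.rpow_le_one (by simpa using ENNReal.ofReal_le_ofReal hx1) hα.le

/-- The density at the left end is bounded below by its values at the end points of the islands of
a generation whose leftmost island is small. -/
theorem le_measure_left (hB : S.AssumptionB K) {k : ℕ} {b₁ : ℝ} (H : S.IsComponent M k 0 b₁)
    (hb₁ : b₁ ≤ S.ρ 0) {E : ℝ≥0∞}
    (hE : ∀ a b, S.IsComponent M k a b → ∀ x, x = a ∨ x = b → 0 < x →
      E * ENNReal.ofReal x ^ α ≤ normalizedHausdorff α K (Icc 0 x))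
    {x : ℝ} (hx0 : 0 < x) (hx1 : x ≤ 1) :
    E * ENNReal.ofReal x ^ α ≤ normalizedHausdorff α K (Icc 0 x) := by
  have hprob := h.isProbabilityMeasure
  refine le_of_bootstrap (f := fun x => normalizedHausdorff α K (Icc 0 x)) (β := b₁) h.pos H.lt
    (S.ρ_pos 0) (S.ρ_lt_one 0) (measure_lt_top (normalizedHausdorff α K) _).ne (fun x _ hx1 => h.measure_scale_left hB hx1)
    ?_ hx0 hx1
  intro G hGE hG x hρx hx1
  have hxpos : 0 < x := (S.ρ_pos 0).trans hρx
  have hb1 : b₁ ≤ 1 := (h.component_subset H).2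
  have hEx : (G + (E - G) * ENNReal.ofReal b₁ ^ α) * ENNReal.ofReal x ^ α ≤
      E * ENNReal.ofReal x ^ α := by
    gcongr
    calc _ ≤ G + (E - G) := by
          gcongr
          refine mul_le_of_le_one_right' (ENNReal.rpow_le_one ?_ h.pos.le)
          simpa using ENNReal.ofReal_le_ofReal hb1
      _ = E := add_tsub_cancel_of_le hGE
  -- Outside the islands `x` can be pushed right to the next left end: the length grows and the mass
  -- does not.
  by_cases hxI : ∀ I ∈ S.islands M k, x ∉ I
  · obtain ⟨a, b, H', hxa, hnext⟩ := h.exists_next k hx1 hxI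
    calc _ ≤ E * ENNReal.ofReal x ^ α := hEx
      _ ≤ E * ENNReal.ofReal a ^ α := by
          gcongr
          exact h.pos.le
      _ ≤ normalizedHausdorff α K (Icc 0 a) := hE a b H' a (Or.inl rfl) (by linarith)
      _ = normalizedHausdorff α K (Icc 0 x) + normalizedHausdorff α K (Icc x a) :=
          h.measure_union_Icc hxpos.le hxa.le
      _ = _ := by
          have := h.nullSingletonClass
          rw [show normalizedHausdorff α K (Icc x a) = 0 from ?_, add_zero]
          refine le_antisymm ((h.measure_mono_of_inter (B := {a}) ?_).trans
            (measure_singleton a).le) zero_le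
          exact fun y hy => le_antisymm hy.2.2 (hnext y hy.1 hy.2.1)
  · push Not at hxI
    obtain ⟨I, hI, hxI⟩ := hxI
    obtain ⟨a, b, H', rfl⟩ := mem_islands_iff.1 hI
    -- The leftmost island ends at `b₁ ≤ ρ_1 < x`, so `x` lies in another one.
    have hba : b₁ ≤ a := by
      rcases H.eq_or H' with ⟨rfl, rfl⟩ | h1 | h1
      · linarith [hxI.2]
      · exact h1
      · linarith [hxI.2]
    have hapos : 0 < a := H.lt.trans_le hba
    have hEa := hE a b H' a (Or.inl rfl) hapos
    rcases hxI.1.eq_or_lt with rfl | hax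
    · exact hEx.trans hEa
    have hGx := h.le_measure_island_left hG H' hax hxI.2
    -- The constant `E` is available on `[0, a]` and only `G` on `[a, x]`. The gain over `G` is `(E
    -- - G) * a ^ α`, bounded below through `a ≥ b₁`.
    rw [h.measure_union_Icc hapos.le hax.le]
    calc _ ≤ G * ENNReal.ofReal x ^ α + (E - G) * ENNReal.ofReal b₁ ^ α :=
          bootstrap_le h.pos hx1 E G
      _ ≤ (G * ENNReal.ofReal a ^ α + G * ENNReal.ofReal (x - a) ^ α) +
          (E - G) * ENNReal.ofReal a ^ α := by
          gcongr
          · have := ENNReal.mul_ofReal_add_rpow_le h.pos.le h.lt_one.le hapos.le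
              (sub_nonneg.2 hax.le) G
            rwa [add_sub_cancel] at this
          · exact h.pos.le
      _ = (G + (E - G)) * ENNReal.ofReal a ^ α + G * ENNReal.ofReal (x - a) ^ α := by ring
      _ = E * ENNReal.ofReal a ^ α + G * ENNReal.ofReal (x - a) ^ α := by
          rw [add_tsub_cancel_of_le hGE]
      _ ≤ _ := add_le_add hEa hGx

theorem le_measure_right (hB : S.AssumptionB K) {k : ℕ} {a₁ : ℝ} (H : S.IsComponent M k a₁ 1)
    (ha₁ : 1 - a₁ ≤ S.ρ (Fin.last n)) {E : ℝ≥0∞}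
    (hE : ∀ a b, S.IsComponent M k a b → ∀ x, x = a ∨ x = b → x < 1 →
      E * ENNReal.ofReal (1 - x) ^ α ≤ normalizedHausdorff α K (Icc x 1))
    {x : ℝ} (hx0 : 0 < x) (hx1 : x ≤ 1) :
    E * ENNReal.ofReal x ^ α ≤ normalizedHausdorff α K (Icc (1 - x) 1) := by
  have hprob := h.isProbabilityMeasure
  refine le_of_bootstrap (f := fun x => normalizedHausdorff α K (Icc (1 - x) 1)) (β := 1 - a₁)
    h.pos (sub_pos.2 H.lt) (S.ρ_pos _) (S.ρ_lt_one _) (measure_lt_top (normalizedHausdorff α K) _).ne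
    (fun x _ hx1 => h.measure_scale_right hB hx1) ?_ hx0 hx1
  intro G hGE hG x hρx hx1
  have hxpos : 0 < x := (S.ρ_pos _).trans hρx
  have hb1 : 0 ≤ a₁ := (h.component_subset H).1
  have hEx : (G + (E - G) * ENNReal.ofReal (1 - a₁) ^ α) * ENNReal.ofReal x ^ α ≤
      E * ENNReal.ofReal x ^ α := by
    gcongr
    calc _ ≤ G + (E - G) := by
          gcongr
          refine mul_le_of_le_one_right' (ENNReal.rpow_le_one ?_ h.pos.le)
          simpa using ENNReal.ofReal_le_ofReal (show 1 - a₁ ≤ 1 by linarith)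
      _ = E := add_tsub_cancel_of_le hGE
  by_cases hxI : ∀ I ∈ S.islands M k, 1 - x ∉ I
  · obtain ⟨a, b, H', hxb, hprev⟩ := h.exists_prev k (sub_nonneg.2 hx1) hxI
    calc _ ≤ E * ENNReal.ofReal x ^ α := hEx
      _ ≤ E * ENNReal.ofReal (1 - b) ^ α := by
          gcongr
          · exact h.pos.le
          · linarith
      _ ≤ normalizedHausdorff α K (Icc b 1) := hE a b H' b (Or.inr rfl) (by linarith)
      _ = normalizedHausdorff α K (Icc b (1 - x)) + normalizedHausdorff α K (Icc (1 - x) 1) :=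
          h.measure_union_Icc hxb.le (by linarith)
      _ = _ := by
          have := h.nullSingletonClass
          rw [show normalizedHausdorff α K (Icc b (1 - x)) = 0 from ?_, zero_add]
          refine le_antisymm ((h.measure_mono_of_inter (B := {b}) ?_).trans
            (measure_singleton b).le) zero_le
          exact fun y hy => le_antisymm (hprev y hy.1 hy.2.2) hy.2.1
  · push Not at hxI
    obtain ⟨I, hI, hxI⟩ := hxI
    obtain ⟨a, b, H', rfl⟩ := mem_islands_iff.1 hI
    have hba : b ≤ a₁ := by
      rcases H.eq_or H' with ⟨rfl, rfl⟩ | h1 | h1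
      · linarith [hxI.1]
      · linarith [hxI.1]
      · exact h1
    have hb1 : b < 1 := hba.trans_lt H.lt
    have hEb := hE a b H' b (Or.inr rfl) hb1
    rcases hxI.2.eq_or_lt with rfl | hxb
    · rw [sub_sub_cancel] at hEb
      exact hEx.trans hEb
    have hGx := h.le_measure_island_right hG H' hxI.1 hxb
    rw [h.measure_union_Icc hxb.le hb1.le]
    calc _ ≤ G * ENNReal.ofReal x ^ α + (E - G) * ENNReal.ofReal (1 - a₁) ^ α :=
          bootstrap_le h.pos hx1 E G
      _ ≤ (G * ENNReal.ofReal (b - (1 - x)) ^ α + G * ENNReal.ofReal (1 - b) ^ α) +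
          (E - G) * ENNReal.ofReal (1 - b) ^ α := by
          gcongr
          · have := ENNReal.mul_ofReal_add_rpow_le h.pos.le h.lt_one.le
              (sub_nonneg.2 hxb.le) (sub_nonneg.2 hb1.le) G
            rwa [show b - (1 - x) + (1 - b) = x by ring] at this
          · exact h.pos.le
      _ = G * ENNReal.ofReal (b - (1 - x)) ^ α +
          (G + (E - G)) * ENNReal.ofReal (1 - b) ^ α := by ring
      _ = G * ENNReal.ofReal (b - (1 - x)) ^ α + E * ENNReal.ofReal (1 - b) ^ α := by
          rw [add_tsub_cancel_of_le hGE]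
      _ ≤ _ := add_le_add hGx hEb

end IsRegularSystem

end LinearIFS

/-! ### One-sided densities bound the minimal centred density from above -/

namespace LinearIFS

variable {n : ℕ} {S : LinearIFS n} {M : ℕ → Finset (List (Fin (n + 1)))} {K : Set ℝ} {α : ℝ}

theorem scale_up {ρ : ℝ} (hρ0 : 0 < ρ) (hρ1 : ρ < 1) {P : ℝ → Prop} {x₀ : ℝ} (hx₀ : 0 < x₀)
    (hP : ∀ x, 0 < x → x ≤ x₀ → P x) (hs : ∀ x, 0 < x → x ≤ 1 → P (ρ * x) → P x) {x : ℝ}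
    (hx0 : 0 < x) (hx1 : x ≤ 1) : P x := by
  obtain ⟨N, hN⟩ := exists_pow_lt_of_lt_one hx₀ hρ1
  replace hN : ρ ^ N * x ≤ x₀ :=
    (mul_le_of_le_one_right (pow_nonneg hρ0.le N) hx1).trans hN.le
  induction N generalizing x with
  | zero => exact hP x hx0 (by simpa using hN)
  | succ N ih =>
    refine hs x hx0 hx1 (ih (mul_pos hρ0 hx0) ?_ ?_)
    · nlinarith
    · rwa [← mul_assoc, ← pow_succ]

/-- Under Assumption A, at most one constitutive interval of an island starts at a given point. -/
theorem wordMap_eq_of_left_eq (hA : S.AssumptionA M) {k : ℕ} {a b : ℝ}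
    (H : S.IsComponent M k a b) {v w : List (Fin (n + 1))} (hv : v ∈ M k) (hw : w ∈ M k)
    (hva : a ≤ S.wordMap v 0) (hvb : S.wordMap v 1 ≤ b) (hwb : S.wordMap w 1 ≤ b)
    (hvw : S.wordMap v 0 = S.wordMap w 0) : S.wordMap v = S.wordMap w := by
  by_contra hne
  have hv' : S.wordMap v ∈ (⟨k, Icc a b, H.mem_islands⟩ : S.Island M).vertexMaps :=
    ⟨v, hv, rfl, by rw [wordMap_image_Icc]; exact Icc_subset_Icc hva hvb⟩
  have hw' : S.wordMap w ∈ (⟨k, Icc a b, H.mem_islands⟩ : S.Island M).vertexMaps :=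
    ⟨w, hw, rfl, by rw [wordMap_image_Icc]; exact Icc_subset_Icc (hvw ▸ hva) hwb⟩
  rcases le_total (S.wordMap v 1) (S.wordMap w 1) with hle | hle
  · refine hA _ _ hv' _ hw' hne ?_
    rw [wordMap_image_Icc, wordMap_image_Icc]
    exact Icc_subset_Icc hvw.ge hle
  · refine hA _ _ hw' _ hv' (Ne.symm hne) ?_
    rw [wordMap_image_Icc, wordMap_image_Icc]
    exact Icc_subset_Icc hvw.le hle

theorem wordMap_eq_of_right_eq (hA : S.AssumptionA M) {k : ℕ} {a b : ℝ}
    (H : S.IsComponent M k a b) {v w : List (Fin (n + 1))} (hv : v ∈ M k) (hw : w ∈ M k)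
    (hvb : S.wordMap v 1 ≤ b) (hva : a ≤ S.wordMap v 0) (hwa : a ≤ S.wordMap w 0)
    (hvw : S.wordMap v 1 = S.wordMap w 1) : S.wordMap v = S.wordMap w := by
  by_contra hne
  have hv' : S.wordMap v ∈ (⟨k, Icc a b, H.mem_islands⟩ : S.Island M).vertexMaps :=
    ⟨v, hv, rfl, by rw [wordMap_image_Icc]; exact Icc_subset_Icc hva hvb⟩
  have hw' : S.wordMap w ∈ (⟨k, Icc a b, H.mem_islands⟩ : S.Island M).vertexMaps :=
    ⟨w, hw, rfl, by rw [wordMap_image_Icc]; exact Icc_subset_Icc hwa (hvw ▸ hvb)⟩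
  rcases le_total (S.wordMap v 0) (S.wordMap w 0) with hle | hle
  · refine hA _ _ hw' _ hv' (Ne.symm hne) ?_
    rw [wordMap_image_Icc, wordMap_image_Icc]
    exact Icc_subset_Icc hle hvw.ge
  · refine hA _ _ hv' _ hw' hne ?_
    rw [wordMap_image_Icc, wordMap_image_Icc]
    exact Icc_subset_Icc hle hvw.le

theorem exists_pos_forall_lt {ι : Type*} (F : Finset ι) (f : ι → ℝ) (hf : ∀ i ∈ F, 0 < f i) :
    ∃ ε : ℝ, 0 < ε ∧ ∀ i ∈ F, ε < f i := by
  rcases F.eq_empty_or_nonempty with rfl | hne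
  · exact ⟨1, one_pos, by simp⟩
  · obtain ⟨i, hi, hmin⟩ := F.exists_min_image f hne
    exact ⟨f i / 2, half_pos (hf i hi), fun j hj => (half_lt_self (hf i hi)).trans_le (hmin j hj)⟩

namespace IsRegularSystem

variable (h : S.IsRegularSystem K M α)
include h

/-- Some generation has a lake. -/
theorem exists_notMem_islands :
    ∃ k z, 0 < z ∧ z < 1 ∧ ∀ I ∈ S.islands M k, z ∉ I := by
  have := h.finite
  -- Finite measure in dimension `α < 1` makes the one-dimensional measure vanish.
  have hvol : volume K = 0 := by
    rw [← hausdorffMeasure_real]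
    exact (Measure.hausdorffMeasure_zero_or_top h.lt_one K).resolve_right h.measure_ne_top
  obtain ⟨z, hz, hzK⟩ : ∃ z ∈ Ioo (0 : ℝ) 1, z ∉ K := by
    by_contra! hcon
    have := measure_mono_null (show Ioo (0 : ℝ) 1 ⊆ K from hcon) hvol
    simp at this
  obtain ⟨ε, hε, hball⟩ := Metric.isOpen_iff.1 h.compact.isClosed.isOpen_compl z hzK
  obtain ⟨k, hk⟩ := h.diam_tendsto hε
  refine ⟨k, z, hz.1, hz.2, fun I hI hzI => ?_⟩
  have hd := hk k le_rfl I hI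
  obtain ⟨a, b, H, rfl⟩ := mem_islands_iff.1 hI
  refine hball ?_ (h.left_mem H)
  rw [Metric.mem_ball]
  exact (Metric.dist_le_diam_of_mem (Metric.isBounded_Icc a b) (left_mem_Icc.2 H.lt.le)
    hzI).trans_lt hd

/-- Some point of the attractor has a left-isolated neighbourhood which is a copy of the left end
of the attractor. -/
theorem exists_isolated_left (hA : S.AssumptionA M) :
    ∃ w η, 0 < η ∧ η ≤ S.wordMap w 0 ∧ S.wordMap w 0 + η ≤ 1 ∧
      ∀ y ∈ K, S.wordMap w 0 - η ≤ y → y ≤ S.wordMap w 0 + η → y ∈ S.wordMap w '' K := by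
  classical
  obtain ⟨k, z, hz0, hz1, hzI⟩ := h.exists_notMem_islands
  obtain ⟨a, b, H, hza, hnext⟩ := h.exists_next k hz1.le hzI
  obtain ⟨w, hw, hwa, hwb⟩ := H.exists_word_left
  -- The radius stays below `ε` to avoid word intervals starting right of `a`, below `a - z` to
  -- remain in the lake on the left, and below `b - a` to remain in the island. By Assumption A only
  -- one map starts at `a` itself.
  obtain ⟨ε, hε, hlt⟩ := exists_pos_forall_lt {v ∈ M k | a < S.wordMap v 0}
    (fun v => S.wordMap v 0 - a) fun v hv => sub_pos.2 (Finset.mem_filter.1 hv).2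
  have hab := H.lt
  have hb1 := (h.component_subset H).2
  refine ⟨w, min ε (min (a - z) (b - a)), lt_min hε (lt_min (sub_pos.2 hza) (sub_pos.2 hab)),
    ?_, ?_, ?_⟩
  · rw [hwa]; linarith [min_le_right ε (min (a - z) (b - a)), min_le_left (a - z) (b - a)]
  · rw [hwa]; linarith [min_le_right ε (min (a - z) (b - a)), min_le_right (a - z) (b - a)]
  rw [hwa]
  intro y hyK hy1 hy2
  have hay : a ≤ y := hnext y hyK (by
    linarith [min_le_right ε (min (a - z) (b - a)), min_le_left (a - z) (b - a)])
  obtain ⟨v, hv, hyv⟩ := mem_iUnion₂.1 (h.subset_biUnion k hyK)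
  obtain ⟨x, hx, rfl⟩ := hyv
  have hx0 := (S.wordMap_strictMono v).monotone (h.subset_Icc hx).1
  have hx1 := (S.wordMap_strictMono v).monotone (h.subset_Icc hx).2
  obtain ⟨c, d, H', hc, hd⟩ := exists_isComponent_of_word (S := S) hv
  have hac : a ≤ c := by
    by_contra! hlt
    have : c < z := by
      by_contra! hzc
      exact absurd (hnext c (h.left_mem H') hzc) (not_le.2 hlt)
    exact hzI _ H'.mem_islands ⟨this.le, by linarith⟩
  have hva : S.wordMap v 0 = a := by
    refine le_antisymm ?_ (hac.trans hc)
    by_contra! hlt'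
    have := hlt v (Finset.mem_filter.2 ⟨hv, hlt'⟩)
    linarith [min_le_left ε (min (a - z) (b - a))]
  have hdb : d = b := by
    rcases H.eq_or H' with ⟨-, rfl⟩ | h1 | h1
    · rfl
    · linarith
    · linarith [H'.lt]
  rw [wordMap_eq_of_left_eq hA H hv hw hva.ge (hd.trans hdb.le) hwb (hva.trans hwa.symm)]
  exact mem_image_of_mem _ hx

theorem exists_isolated_right (hA : S.AssumptionA M) :
    ∃ w η, 0 < η ∧ η ≤ S.wordMap w 1 ∧ S.wordMap w 1 + η ≤ 1 ∧
      ∀ y ∈ K, S.wordMap w 1 - η ≤ y → y ≤ S.wordMap w 1 + η → y ∈ S.wordMap w '' K := by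
  classical
  obtain ⟨k, z, hz0, hz1, hzI⟩ := h.exists_notMem_islands
  obtain ⟨a, b, H, hzb, hprev⟩ := h.exists_prev k hz0.le hzI
  obtain ⟨w, hw, hwb, hwa⟩ := H.exists_word_right
  obtain ⟨ε, hε, hlt⟩ := exists_pos_forall_lt {v ∈ M k | S.wordMap v 1 < b}
    (fun v => b - S.wordMap v 1) fun v hv => sub_pos.2 (Finset.mem_filter.1 hv).2
  have hab := H.lt
  have ha0 := (h.component_subset H).1
  refine ⟨w, min ε (min (z - b) (b - a)), lt_min hε (lt_min (sub_pos.2 hzb) (sub_pos.2 hab)),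
    ?_, ?_, ?_⟩
  · rw [hwb]; linarith [min_le_right ε (min (z - b) (b - a)), min_le_right (z - b) (b - a)]
  · rw [hwb]; linarith [min_le_right ε (min (z - b) (b - a)), min_le_left (z - b) (b - a)]
  rw [hwb]
  intro y hyK hy1 hy2
  have hyb : y ≤ b := hprev y hyK (by
    linarith [min_le_right ε (min (z - b) (b - a)), min_le_left (z - b) (b - a)])
  obtain ⟨v, hv, hyv⟩ := mem_iUnion₂.1 (h.subset_biUnion k hyK)
  obtain ⟨x, hx, rfl⟩ := hyv
  have hx0 := (S.wordMap_strictMono v).monotone (h.subset_Icc hx).1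
  have hx1 := (S.wordMap_strictMono v).monotone (h.subset_Icc hx).2
  obtain ⟨c, d, H', hc, hd⟩ := exists_isComponent_of_word (S := S) hv
  have hdb : d ≤ b := by
    by_contra! hlt
    have : z < d := by
      by_contra! hzd
      exact absurd (hprev d (h.right_mem H') hzd) (not_le.2 hlt)
    exact hzI _ H'.mem_islands ⟨by linarith, this.le⟩
  have hvb : S.wordMap v 1 = b := by
    refine le_antisymm (hd.trans hdb) ?_
    by_contra! hlt'
    have := hlt v (Finset.mem_filter.2 ⟨hv, hlt'⟩)
    linarith [min_le_left ε (min (z - b) (b - a))]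
  have hca : c = a := by
    rcases H.eq_or H' with ⟨rfl, -⟩ | h1 | h1
    · rfl
    · linarith [H'.lt]
    · linarith
  rw [wordMap_eq_of_right_eq hA H hv hw hvb.le (hca.ge.trans hc) hwa (hvb.trans hwb.symm)]
  exact mem_image_of_mem _ hx

theorem minCentredDensity_mul_le {c r : ℝ} (hc : c ∈ K) (hr : 0 < r)
    (hcr : Icc (c - r) (c + r) ⊆ Icc 0 1) :
    minCentredDensity α K * ENNReal.ofReal (2 * r) ^ α ≤
      normalizedHausdorff α K (Icc (c - r) (c + r)) := by
  have := (h.le_density_iff (by linarith)).1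
    (show minCentredDensity α K ≤ density α K (Icc (c - r) (c + r)) from
      sInf_le ⟨c, hc, r, hr, hcr, rfl⟩)
  rwa [show c + r - (c - r) = 2 * r by ring] at this

omit h in
theorem _root_.ENNReal.le_of_ofReal_rpow_mul_le {α c : ℝ} (hα : 0 ≤ α) (hc : 0 < c)
    {x y : ℝ≥0∞} (hxy : ENNReal.ofReal c ^ α * x ≤ ENNReal.ofReal c ^ α * y) : x ≤ y :=
  (ENNReal.mul_le_mul_iff_right (ENNReal.rpow_pos (ENNReal.ofReal_pos.2 hc)
    ENNReal.ofReal_ne_top).ne' (ENNReal.rpow_ne_top_of_nonneg hα ENNReal.ofReal_ne_top)).1 hxy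

/-- For small `x`, the interval centred at an isolated left end `S_w 0` with radius `ratio w * x`
carries only the image of `[0, x]`. Its length is twice the radius, whence the factor two. Larger
`x` follow from exact scaling at `0`. -/
theorem minCentredDensity_le_left (hA : S.AssumptionA M) (hB : S.AssumptionB K) {x : ℝ}
    (hx0 : 0 < x) (hx1 : x ≤ 1) :
    minCentredDensity α K * ENNReal.ofReal (2 * x) ^ α ≤ normalizedHausdorff α K (Icc 0 x) := by
  obtain ⟨w, η, hη, hη0, hη1, hw⟩ := h.exists_isolated_left hA
  have hr := S.ratio_pos w
  refine scale_up (S.ρ_pos 0) (S.ρ_lt_one 0) (P := fun x =>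
    minCentredDensity α K * ENNReal.ofReal (2 * x) ^ α ≤ normalizedHausdorff α K (Icc 0 x))
    (div_pos hη hr) (fun x hx0 hx => ?_) (fun x hx0 hx1 hx => ?_) hx0 hx1
  · rw [le_div_iff₀ hr] at hx
    have hrx : 0 < S.ratio w * x := mul_pos hr hx0
    have h1 := h.minCentredDensity_mul_le (h.wordMap_zero_mem w) hrx
      (Icc_subset_Icc (by linarith) (by linarith))
    have h2 := h.measure_wordMap_le (w := w)
      (A := Icc (S.wordMap w 0 - S.ratio w * x) (S.wordMap w 0 + S.ratio w * x))
      (u := 0) (v := x) (by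
        rintro y ⟨hyK, hy1, hy2⟩
        obtain ⟨t, ht, rfl⟩ := hw y hyK (by linarith) (by linarith)
        refine ⟨t, ⟨ht, (h.subset_Icc ht).1, ?_⟩, rfl⟩
        rw [S.wordMap_apply w t] at hy2
        exact le_of_mul_le_mul_left (by linarith) hr)
    refine ENNReal.le_of_ofReal_rpow_mul_le h.pos.le hr (le_trans (le_of_eq ?_) (h1.trans h2))
    rw [← ENNReal.mul_ofReal_mul_rpow h.pos.le hr.le]
    congr 3; ring
  · rw [h.measure_scale_left hB hx1, mul_left_comm,
      ENNReal.mul_ofReal_mul_rpow h.pos.le (S.ρ_pos 0).le] at hx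
    exact ENNReal.le_of_ofReal_rpow_mul_le h.pos.le (S.ρ_pos 0) hx

theorem minCentredDensity_le_right (hA : S.AssumptionA M) (hB : S.AssumptionB K) {x : ℝ}
    (hx0 : 0 < x) (hx1 : x ≤ 1) :
    minCentredDensity α K * ENNReal.ofReal (2 * x) ^ α ≤
      normalizedHausdorff α K (Icc (1 - x) 1) := by
  obtain ⟨w, η, hη, hη0, hη1, hw⟩ := h.exists_isolated_right hA
  have hr := S.ratio_pos w
  refine scale_up (S.ρ_pos (Fin.last n)) (S.ρ_lt_one (Fin.last n)) (P := fun x =>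
    minCentredDensity α K * ENNReal.ofReal (2 * x) ^ α ≤
      normalizedHausdorff α K (Icc (1 - x) 1))
    (div_pos hη hr) (fun x hx0 hx => ?_) (fun x hx0 hx1 hx => ?_) hx0 hx1
  · rw [le_div_iff₀ hr] at hx
    have hrx : 0 < S.ratio w * x := mul_pos hr hx0
    have h1 := h.minCentredDensity_mul_le (h.wordMap_one_mem w) hrx
      (Icc_subset_Icc (by linarith) (by linarith))
    have h2 := h.measure_wordMap_le (w := w)
      (A := Icc (S.wordMap w 1 - S.ratio w * x) (S.wordMap w 1 + S.ratio w * x))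
      (u := 1 - x) (v := 1) (by
        rintro y ⟨hyK, hy1, hy2⟩
        obtain ⟨t, ht, rfl⟩ := hw y hyK (by linarith) (by linarith)
        refine ⟨t, ⟨ht, ?_, (h.subset_Icc ht).2⟩, rfl⟩
        rw [S.wordMap_apply w t, S.wordMap_one] at hy1
        exact le_of_mul_le_mul_left (by linarith) hr)
    refine ENNReal.le_of_ofReal_rpow_mul_le h.pos.le hr (le_trans (le_of_eq ?_) (h1.trans h2))
    rw [← ENNReal.mul_ofReal_mul_rpow h.pos.le hr.le]
    congr 3; ring
  · rw [h.measure_scale_right hB hx1, mul_left_comm,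
      ENNReal.mul_ofReal_mul_rpow h.pos.le (S.ρ_pos _).le] at hx
    exact ENNReal.le_of_ofReal_rpow_mul_le h.pos.le (S.ρ_pos _) hx

end IsRegularSystem

end LinearIFS

/-! ### Islands in increasing order, and intervals in the field -/

namespace LinearIFS

variable {n : ℕ} {S : LinearIFS n} {M : ℕ → Finset (List (Fin (n + 1)))} {K : Set ℝ} {α : ℝ}

theorem exists_isIslandList (k : ℕ) : ∃ l a b, S.IsIslandList M k l a b := by
  classical
  set F : Finset ℝ := (finite_islands (S := S) (M := M) k).toFinset.image sInf with hF
  have hFmem : ∀ x, x ∈ F ↔ ∃ b, S.IsComponent M k x b := by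
    intro x
    simp only [hF, Finset.mem_image, Set.Finite.mem_toFinset]
    constructor
    · rintro ⟨I, hI, rfl⟩
      obtain ⟨a, b, H, rfl⟩ := mem_islands_iff.1 hI
      rw [csInf_Icc H.lt.le]
      exact ⟨b, H⟩
    · rintro ⟨b, H⟩
      exact ⟨_, H.mem_islands, csInf_Icc H.lt.le⟩
  choose! B hB using fun x hx => (hFmem x).1 hx
  set e := F.orderEmbOfFin rfl with he
  -- Left ends identify islands. Numbering starts at `1`, hence the shift; the default `0` is never
  -- used for indices between `1` and the number of islands.
  set a : ℕ → ℝ := fun i => if hi : i - 1 < F.card then e ⟨i - 1, hi⟩ else 0 with ha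
  have haF : ∀ i, 1 ≤ i → i ≤ F.card → a i ∈ F := by
    intro i h1 h2
    simp only [ha]
    rw [dif_pos (by omega)]
    exact F.orderEmbOfFin_mem rfl _
  have hcomp : ∀ i, 1 ≤ i → i ≤ F.card → S.IsComponent M k (a i) (B (a i)) :=
    fun i h1 h2 => hB _ (haF i h1 h2)
  refine ⟨F.card, a, fun i => B (a i), ?_, ?_, ?_⟩
  · intro i hi
    rw [Finset.mem_Icc] at hi
    exact (hcomp i hi.1 hi.2).lt
  · intro i h1 h2
    have H1 := hcomp i h1 h2.le
    have H2 := hcomp (i + 1) (by omega) (by omega)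
    have hlt : a i < a (i + 1) := by
      simp only [ha]
      rw [dif_pos (by omega), dif_pos (by omega)]
      exact e.strictMono (Fin.mk_lt_mk.2 (by omega))
    rcases H1.eq_or H2 with ⟨h3, -⟩ | h3 | h3
    · exact absurd h3 hlt.ne
    · exact h3
    · linarith [H2.lt]
  · ext I
    constructor
    · intro hI
      obtain ⟨x, y, H, rfl⟩ := mem_islands_iff.1 hI
      have hx : x ∈ F := (hFmem x).2 ⟨y, H⟩
      have hx' : x ∈ Set.range e := by
        rw [he, Finset.range_orderEmbOfFin]; exact hx
      obtain ⟨i, hi⟩ := hx'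
      refine ⟨i + 1, by simp, ?_⟩
      have : a (i + 1) = x := by
        simp only [ha]
        rw [dif_pos (by simp)]
        simpa using hi
      have hyB : B x = y := by
        rcases (hB x hx).eq_or H with ⟨-, h1⟩ | h1 | h1
        · exact h1
        · linarith [(hB x hx).lt]
        · linarith [H.lt]
      simp only [this, hyB]
    · rintro ⟨i, hi, rfl⟩
      rw [Finset.mem_coe, Finset.mem_Icc] at hi
      exact (hcomp i hi.1 hi.2).mem_islands

namespace IsIslandList

variable {k l : ℕ} {a b : ℕ → ℝ} (L : S.IsIslandList M k l a b)
include L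

theorem isComponent {i : ℕ} (h1 : 1 ≤ i) (h2 : i ≤ l) : S.IsComponent M k (a i) (b i) := by
  apply IsComponent.of_Icc_mem
  rw [L.2.2]
  exact ⟨i, by simp [h1, h2], rfl⟩

theorem exists_index {x y : ℝ} (H : S.IsComponent M k x y) :
    ∃ i, 1 ≤ i ∧ i ≤ l ∧ a i = x ∧ b i = y := by
  have := H.mem_islands
  rw [L.2.2] at this
  obtain ⟨i, hi, e⟩ := this
  rw [Finset.mem_coe, Finset.mem_Icc] at hi
  simp only at e
  obtain ⟨h1, h2⟩ := (Icc_eq_Icc_iff (L.isComponent hi.1 hi.2).lt.le).1 e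
  exact ⟨i, hi.1, hi.2, h1, h2⟩

theorem right_le_left {i j : ℕ} (h1 : 1 ≤ i) (hij : i < j) (hj : j ≤ l) : b i ≤ a j := by
  induction j, hij using Nat.le_induction with
  | base => exact L.2.1 i h1 (by omega)
  | succ j hij ih =>
    exact (ih (by omega)).trans
      ((L.isComponent (by omega) (by omega)).lt.le.trans (L.2.1 j (by omega) (by omega)))

theorem left_mono {i j : ℕ} (h1 : 1 ≤ i) (hij : i ≤ j) (hj : j ≤ l) : a i ≤ a j := by
  rcases hij.eq_or_lt with rfl | hlt
  · exact le_rfl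
  · exact (L.isComponent h1 (by omega)).lt.le.trans (L.right_le_left h1 hlt hj)

theorem right_mono {i j : ℕ} (h1 : 1 ≤ i) (hij : i ≤ j) (hj : j ≤ l) : b i ≤ b j := by
  rcases hij.eq_or_lt with rfl | hlt
  · exact le_rfl
  · exact (L.right_le_left h1 hlt hj).trans (L.isComponent (by omega) hj).lt.le

theorem first (h : S.IsIslandSystem K M) : 1 ≤ l ∧ a 1 = 0 := by
  obtain ⟨x, y, H, hxy⟩ := h.exists_component_of_mem k h.zero_mem
  obtain ⟨i, h1, h2, rfl, rfl⟩ := L.exists_index H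
  have hl : 1 ≤ l := h1.trans h2
  refine ⟨hl, le_antisymm ((L.left_mono le_rfl h1 h2).trans hxy.1)
    (h.component_subset (L.isComponent le_rfl hl)).1⟩

theorem last (h : S.IsIslandSystem K M) : b l = 1 := by
  obtain ⟨x, y, H, hxy⟩ := h.exists_component_of_mem k h.one_mem
  obtain ⟨i, h1, h2, rfl, rfl⟩ := L.exists_index H
  exact le_antisymm (h.component_subset (L.isComponent (h1.trans h2) le_rfl)).2
    (hxy.2.trans (L.right_mono h1 h2 le_rfl))

/-- There is no island between consecutive islands. -/
theorem notMem_of_mem_Ioo {i : ℕ} (h1 : 1 ≤ i) (hi : i < l) {x : ℝ}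
    (hx : x ∈ Ioo (b i) (a (i + 1))) : x ∉ ⋃₀ S.islands M k := by
  rintro ⟨I, hI, hxI⟩
  obtain ⟨c, d, H, rfl⟩ := mem_islands_iff.1 hI
  obtain ⟨j, hj1, hjl, rfl, rfl⟩ := L.exists_index H
  rcases le_or_gt j i with hji | hij
  · have := L.right_mono hj1 hji hi.le
    linarith [hx.1, hxI.2]
  · have := L.left_mono (by omega) (show i + 1 ≤ j from hij) hjl
    linarith [hx.2, hxI.1]

theorem lake_mem (h : S.IsIslandSystem K M) {i : ℕ} (h1 : 1 ≤ i) (hi : i < l)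
    (hlt : b i < a (i + 1)) : Icc (b i) (a (i + 1)) ∈ S.lakes M k := by
  have Hi := L.isComponent h1 hi.le
  have Hi' := L.isComponent (show 1 ≤ i + 1 by omega) (show i + 1 ≤ l by omega)
  have hsub : Ioo (b i) (a (i + 1)) ⊆ Icc (0 : ℝ) 1 \ ⋃₀ S.islands M k := by
    intro x hx
    refine ⟨⟨?_, ?_⟩, L.notMem_of_mem_Ioo h1 hi hx⟩
    · exact (h.component_subset Hi).1.trans (Hi.lt.le.trans hx.1.le)
    · exact hx.2.le.trans (Hi'.lt.le.trans (h.component_subset Hi').2)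
  obtain ⟨x, hx⟩ := nonempty_Ioo.2 hlt
  refine ⟨x, hsub hx, ?_⟩
  rw [connectedComponentIn_eq_Ioo hx hsub, closure_Ioo hlt.ne]
  · exact fun hb => hb.2 ⟨_, Hi.mem_islands, right_mem_Icc.2 Hi.lt.le⟩
  · exact fun ha => ha.2 ⟨_, Hi'.mem_islands, left_mem_Icc.2 Hi'.lt.le⟩

/-- Islands and lakes are adjoined alternately from the left; where two islands touch there is no
lake to adjoin. -/
theorem Icc_zero_mem_field (h : S.IsIslandSystem K M) {i : ℕ} (h1 : 1 ≤ i) (hi : i ≤ l) :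
    Icc 0 (b i) ∈ S.field M k ∧ (i < l → Icc 0 (a (i + 1)) ∈ S.field M k) := by
  have hstep : ∀ i, 1 ≤ i → i ≤ l → Icc 0 (b i) ∈ S.field M k →
      (i < l → Icc 0 (a (i + 1)) ∈ S.field M k) := by
    intro i h1 hi hb hil
    have h0 : 0 ≤ b i := (h.component_subset (L.isComponent h1 hi)).1.trans
      (L.isComponent h1 hi).lt.le
    rcases (L.2.1 i h1 hil).eq_or_lt with heq | hlt
    · rwa [← heq]
    · rw [← Icc_union_Icc_eq_Icc h0 hlt.le]
      exact generateSetAlgebra.union _ _ hb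
        (generateSetAlgebra.base _ (Or.inr (L.lake_mem h h1 hil hlt)))
  induction i, h1 using Nat.le_induction with
  | base =>
    have hb : Icc 0 (b 1) ∈ S.field M k := by
      rw [← (L.first h).2]
      exact generateSetAlgebra.base _ (Or.inl (L.isComponent le_rfl hi).mem_islands)
    exact ⟨hb, hstep 1 le_rfl hi hb⟩
  | succ i h1 ih =>
    have ha := (ih (by omega)).2 (by omega)
    have H := L.isComponent (show 1 ≤ i + 1 by omega) hi
    have hb : Icc 0 (b (i + 1)) ∈ S.field M k := by
      rw [← Icc_union_Icc_eq_Icc (h.component_subset H).1 H.lt.le]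
      exact generateSetAlgebra.union _ _ ha (generateSetAlgebra.base _ (Or.inl H.mem_islands))
    exact ⟨hb, hstep _ (by omega) hi hb⟩

theorem Icc_one_mem_field (h : S.IsIslandSystem K M) {i : ℕ} (h1 : 1 ≤ i) (hi : i ≤ l) :
    Icc (a i) 1 ∈ S.field M k ∧ (1 < i → Icc (b (i - 1)) 1 ∈ S.field M k) := by
  have hstep : ∀ i, 1 ≤ i → i ≤ l → Icc (a i) 1 ∈ S.field M k →
      (1 < i → Icc (b (i - 1)) 1 ∈ S.field M k) := by
    intro i h1 hi ha hil
    have h0 : a i ≤ 1 := (L.isComponent h1 hi).lt.le.trans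
      (h.component_subset (L.isComponent h1 hi)).2
    obtain ⟨j, rfl⟩ : ∃ j, i = j + 1 := ⟨i - 1, by omega⟩
    rw [Nat.add_sub_cancel]
    rcases (L.2.1 j (by omega) (by omega)).eq_or_lt with heq | hlt
    · rwa [heq]
    · rw [← Icc_union_Icc_eq_Icc hlt.le h0]
      exact generateSetAlgebra.union _ _
        (generateSetAlgebra.base _ (Or.inr (L.lake_mem h (by omega) (by omega) hlt))) ha
  induction hi using Nat.decreasingInduction with
  | self =>
    have hb : Icc (a l) 1 ∈ S.field M k := by
      rw [← L.last h]
      exact generateSetAlgebra.base _ (Or.inl (L.isComponent h1 le_rfl).mem_islands)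
    exact ⟨hb, hstep l h1 le_rfl hb⟩
  | of_succ i hi ih =>
    have hb := (ih (by omega)).2 (by omega)
    rw [Nat.add_sub_cancel] at hb
    have H := L.isComponent h1 hi.le
    have ha : Icc (a i) 1 ∈ S.field M k := by
      rw [← Icc_union_Icc_eq_Icc H.lt.le (h.component_subset H).2]
      exact generateSetAlgebra.union _ _ (generateSetAlgebra.base _ (Or.inl H.mem_islands)) hb
    exact ⟨ha, hstep _ h1 hi.le ha⟩

end IsIslandList

namespace IsIslandSystem

variable (h : S.IsIslandSystem K M)
include h

theorem Icc_zero_mem_field {k : ℕ} {a b : ℝ} (H : S.IsComponent M k a b) {x : ℝ}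
    (hx : x = a ∨ x = b) (hx0 : 0 < x) : Icc 0 x ∈ S.field M k := by
  obtain ⟨l, a', b', L⟩ := exists_isIslandList (S := S) (M := M) k
  obtain ⟨i, h1, h2, rfl, rfl⟩ := L.exists_index H
  rcases hx with rfl | rfl
  · have hi : i ≠ 1 := by
      rintro rfl
      exact hx0.ne' (L.first h).2
    have := (L.Icc_zero_mem_field h (show 1 ≤ i - 1 by omega) (by omega)).2 (by omega)
    rwa [Nat.sub_add_cancel h1] at this
  · exact (L.Icc_zero_mem_field h h1 h2).1

theorem Icc_one_mem_field {k : ℕ} {a b : ℝ} (H : S.IsComponent M k a b) {x : ℝ}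
    (hx : x = a ∨ x = b) (hx1 : x < 1) : Icc x 1 ∈ S.field M k := by
  obtain ⟨l, a', b', L⟩ := exists_isIslandList (S := S) (M := M) k
  obtain ⟨i, h1, h2, rfl, rfl⟩ := L.exists_index H
  rcases hx with rfl | rfl
  · exact (L.Icc_one_mem_field h h1 h2).1
  · have hi : i ≠ l := by
      rintro rfl
      exact hx1.ne (L.last h)
    have := (L.Icc_one_mem_field h (show 1 ≤ i + 1 by omega) (by omega)).2 (by omega)
    rwa [Nat.add_sub_cancel] at this

/-- Away from the end points of the islands, the sets of the field are locally constant. -/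
theorem field_locally_constant {k : ℕ} {x : ℝ}
    (hx : ∀ a b, S.IsComponent M k a b → x ≠ a ∧ x ≠ b) {A : Set ℝ} (hA : A ∈ S.field M k) :
    (∀ᶠ y in 𝓝 x, y ∈ A) ∨ ∀ᶠ y in 𝓝 x, y ∉ A := by
  have hisl : ∀ I ∈ S.islands M k, (∀ᶠ y in 𝓝 x, y ∈ I) ∨ ∀ᶠ y in 𝓝 x, y ∉ I := by
    intro I hI
    obtain ⟨a, b, H, rfl⟩ := mem_islands_iff.1 hI
    by_cases hm : x ∈ Icc a b
    · left
      have hxab := hx a b H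
      exact Icc_mem_nhds (lt_of_le_of_ne hm.1 hxab.1.symm) (lt_of_le_of_ne hm.2 hxab.2)
    · right
      exact isClosed_Icc.isOpen_compl.mem_nhds hm
  induction hA with
  | base A hA =>
    rcases hA with hA | hA
    · exact hisl A hA
    obtain ⟨z, hz, rfl⟩ := hA
    set O := Icc (0 : ℝ) 1 \ ⋃₀ S.islands M k with hO
    -- The end points `0` and `1` belong to `K`, hence to islands, so `[0, 1]` may be replaced by
    -- its interior.
    have hOo : IsOpen O := by
      have : O = Ioo (0 : ℝ) 1 \ ⋃₀ S.islands M k := by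
        ext y
        simp only [hO, Set.mem_sdiff]
        refine ⟨fun ⟨h1, h2⟩ => ⟨⟨lt_of_le_of_ne h1.1 ?_, lt_of_le_of_ne h1.2 ?_⟩, h2⟩,
          fun ⟨h1, h2⟩ => ⟨Ioo_subset_Icc_self h1, h2⟩⟩
        · rintro rfl
          obtain ⟨I, hI, h0⟩ := h.exists_island_of_mem k h.zero_mem
          exact h2 ⟨I, hI, h0⟩
        · rintro rfl
          obtain ⟨I, hI, h0⟩ := h.exists_island_of_mem k h.one_mem
          exact h2 ⟨I, hI, h0⟩
      rw [this, sUnion_eq_biUnion]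
      refine isOpen_Ioo.sdiff ((finite_islands k).isClosed_biUnion fun I hI => ?_)
      obtain ⟨a, b, H, rfl⟩ := mem_islands_iff.1 hI
      exact isClosed_Icc
    have hCo : ∀ y, IsOpen (connectedComponentIn O y) := fun y => hOo.connectedComponentIn
    have hdisj : ∀ V : Set ℝ, IsOpen V → Disjoint V (connectedComponentIn O z) → x ∈ V →
        ∀ᶠ y in 𝓝 x, y ∉ closure (connectedComponentIn O z) := by
      intro V hV hVd hxV
      filter_upwards [hV.mem_nhds hxV] with y hy
      exact disjoint_left.1 (hVd.closure_right hV) hy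
    by_cases hxO : x ∈ O
    · by_cases hxC : x ∈ connectedComponentIn O z
      · left
        filter_upwards [(hCo z).mem_nhds hxC] with y hy using subset_closure hy
      · right
        refine hdisj _ (hCo x) (disjoint_left.2 fun y hy1 hy2 => hxC ?_)
          (mem_connectedComponentIn hxO)
        rw [connectedComponentIn_eq hy2, ← connectedComponentIn_eq hy1]
        exact mem_connectedComponentIn hxO
    · right
      rw [hO, Set.mem_sdiff, not_and_or, not_not] at hxO
      rcases hxO with hxO | ⟨I, hI, hxI⟩
      · refine hdisj (Icc 0 1)ᶜ isClosed_Icc.isOpen_compl ?_ hxO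
        exact disjoint_left.2 fun y hy1 hy2 => hy1 (connectedComponentIn_subset _ _ hy2).1
      · have hev := (hisl I hI).resolve_right fun hn => hn.self_of_nhds hxI
        refine hdisj (interior I) isOpen_interior ?_ (mem_interior_iff_mem_nhds.2 hev)
        exact disjoint_left.2 fun y hy1 hy2 =>
          (connectedComponentIn_subset _ _ hy2).2 ⟨I, hI, interior_subset hy1⟩
  | empty => right; simp
  | compl A _ ih =>
    rcases ih with ih | ih
    · right; simpa using ih
    · left; exact ih
  | union A B _ _ ihA ihB =>
    rcases ihA with ihA | ihA
    · left; filter_upwards [ihA] with y hy using Or.inl hy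
    rcases ihB with ihB | ihB
    · left; filter_upwards [ihB] with y hy using Or.inr hy
    · right
      filter_upwards [ihA, ihB] with y hy1 hy2 using fun hy => hy.elim hy1 hy2

/-- Membership in `[0, x]` changes at `x`, while sets of the field are locally constant away from
island ends. -/
theorem endpoint_of_Icc_zero_mem_field {k : ℕ} {x : ℝ} (hx0 : 0 < x)
    (hx : Icc 0 x ∈ S.field M k) : ∃ a b, S.IsComponent M k a b ∧ (x = a ∨ x = b) := by
  by_contra! hcon
  rcases h.field_locally_constant (x := x) hcon hx with hev | hev
  · obtain ⟨y, hy1, hy2⟩ := ((hev.filter_mono nhdsWithin_le_nhds).and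
      (self_mem_nhdsWithin (s := Ioi x))).exists
    exact absurd hy1.2 (not_le.2 hy2)
  · exact hev.self_of_nhds (right_mem_Icc.2 hx0.le)

theorem endpoint_of_Icc_one_mem_field {k : ℕ} {x : ℝ} (hx1 : x < 1)
    (hx : Icc x 1 ∈ S.field M k) : ∃ a b, S.IsComponent M k a b ∧ (x = a ∨ x = b) := by
  by_contra! hcon
  rcases h.field_locally_constant (x := x) hcon hx with hev | hev
  · obtain ⟨y, hy1, hy2⟩ := ((hev.filter_mono nhdsWithin_le_nhds).and
      (self_mem_nhdsWithin (s := Iio x))).exists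
    exact absurd hy1.1 (not_le.2 hy2)
  · exact hev.self_of_nhds (left_mem_Icc.2 hx1.le)

omit h in
theorem finite_endpoints (k : ℕ) :
    {x : ℝ | ∃ a b, S.IsComponent M k a b ∧ (x = a ∨ x = b)}.Finite := by
  refine (((finite_islands (S := S) (M := M) k).image sInf).union
    ((finite_islands (S := S) (M := M) k).image sSup)).subset ?_
  rintro x ⟨a, b, H, rfl | rfl⟩
  · exact Or.inl ⟨_, H.mem_islands, csInf_Icc H.lt.le⟩
  · exact Or.inr ⟨_, H.mem_islands, csSup_Icc H.lt.le⟩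

omit h in
theorem _root_.Set.Finite.exists_isLeast {T : Set ℝ≥0∞} (hT : T.Finite) (hne : T.Nonempty) :
    ∃ y, IsLeast T y := by
  obtain ⟨y, hy, hmin⟩ := T.exists_min_image id hT hne
  exact ⟨y, hy, hmin⟩

theorem exists_isLeast_left (α : ℝ) (k : ℕ) : ∃ D, IsLeast
    {y | ∃ x : ℝ, 0 < x ∧ Icc 0 x ∈ S.field M k ∧ y = density α K (Icc 0 x)} D := by
  refine Set.Finite.exists_isLeast (((finite_endpoints (S := S) (M := M) k).image
    fun x => density α K (Icc 0 x)).subset ?_) ?_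
  · rintro y ⟨x, hx0, hx, rfl⟩
    exact ⟨x, h.endpoint_of_Icc_zero_mem_field hx0 hx, rfl⟩
  · obtain ⟨a, b, H, hab⟩ := h.exists_component_of_mem k h.zero_mem
    have hb : 0 < b := (h.component_subset H).1.trans_lt H.lt
    exact ⟨_, b, hb, h.Icc_zero_mem_field H (Or.inr rfl) hb, rfl⟩

theorem exists_isLeast_right (α : ℝ) (k : ℕ) : ∃ D, IsLeast
    {y | ∃ x : ℝ, x < 1 ∧ Icc x 1 ∈ S.field M k ∧ y = density α K (Icc x 1)} D := by
  refine Set.Finite.exists_isLeast (((finite_endpoints (S := S) (M := M) k).image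
    fun x => density α K (Icc x 1)).subset ?_) ?_
  · rintro y ⟨x, hx0, hx, rfl⟩
    exact ⟨x, h.endpoint_of_Icc_one_mem_field hx0 hx, rfl⟩
  · obtain ⟨a, b, H, hab⟩ := h.exists_component_of_mem k h.one_mem
    have ha : a < 1 := H.lt.trans_le (h.component_subset H).2
    exact ⟨_, a, ha, h.Icc_one_mem_field H (Or.inl rfl) ha, rfl⟩

end IsIslandSystem

end LinearIFS

/-! ### Densities of centred intervals -/

theorem affineFun_image_Icc {p : ℝ} (q : ℝ) (hp : p ≠ 0) (x r : ℝ) :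
    affineFun p q '' Icc (x - r) (x + r) =
      Icc (affineFun p q x - |p| * r) (affineFun p q x + |p| * r) := by
  have hp' := abs_pos.2 hp
  have key : ∀ y, y ∈ Icc (x - r) (x + r) ↔
      affineFun p q y ∈ Icc (affineFun p q x - |p| * r) (affineFun p q x + |p| * r) := by
    intro y
    rw [← Real.closedBall_eq_Icc, ← Real.closedBall_eq_Icc, Metric.mem_closedBall,
      Metric.mem_closedBall, Real.dist_eq, Real.dist_eq]
    simp only [affineFun]
    rw [show p * y + q - (p * x + q) = p * (y - x) by ring, abs_mul,
      mul_le_mul_iff_right₀ hp']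
  ext z
  constructor
  · rintro ⟨y, hy, rfl⟩
    exact (key y).1 hy
  · intro hz
    exact ⟨_, (key _).2 (by rwa [affineFun_comp_inv q hp]), affineFun_comp_inv q hp z⟩

namespace LinearIFS

variable {n : ℕ} {S : LinearIFS n} {M : ℕ → Finset (List (Fin (n + 1)))} {K : Set ℝ} {α : ℝ}

theorem islands_eq_of_Icc_subset {k : ℕ} {I J : Set ℝ} (hI : I ∈ S.islands M k)
    (hJ : J ∈ S.islands M k) {u v : ℝ} (huv : u < v) (h1 : Icc u v ⊆ I) (h2 : Icc u v ⊆ J) :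
    I = J := by
  obtain ⟨a, b, H, rfl⟩ := mem_islands_iff.1 hI
  obtain ⟨a', b', H', rfl⟩ := mem_islands_iff.1 hJ
  rw [Icc_subset_Icc_iff huv.le] at h1 h2
  rcases H.eq_or H' with ⟨rfl, rfl⟩ | h | h
  · rfl
  · linarith
  · linarith

namespace IsIslandSystem

variable (h : S.IsIslandSystem K M)
include h

/-- If no new type appears in generation `k₀ + 1`, then each island is similar to one of generation
at most `k₀`. -/
theorem exists_similar_of_noNewType {k₀ : ℕ} (hk : S.NoNewType M k₀) (g : ℕ) {I : Set ℝ}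
    (hI : I ∈ S.islands M g) :
    ∃ g' ≤ k₀, ∃ I' ∈ S.islands M g', ∃ p q, S.Similar M p q g I g' I' := by
  induction g generalizing I with
  | zero => exact ⟨0, Nat.zero_le _, I, hI, 1, 0, Similar.refl 0 I⟩
  | succ g ih =>
    obtain ⟨P, hP, hIP⟩ := h.exists_parent_island g 1 hI
    obtain ⟨g₁, hg₁, I₁, hI₁, p, q, H⟩ := ih hP
    have hd : I ∈ S.desc M g P 1 := mem_desc.2 ⟨hI, hIP⟩
    have H' := H.child hd
    have hm := (mem_desc.1 ((H.mem_iff _ _).1 hd)).1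
    -- The similarity of the parent carries the child to generation `g₁ + 1`. This is still at most
    -- `k₀`, or it is exactly `k₀ + 1`, where no new type occurs.
    rcases Nat.lt_or_ge g₁ k₀ with hlt | hge
    · exact ⟨g₁ + 1, hlt, _, hm, p, q, H'⟩
    · obtain rfl : g₁ = k₀ := le_antisymm hg₁ hge
      obtain ⟨J, hJ, hEq⟩ := hk ⟨g₁ + 1, _, hm⟩ rfl
      obtain ⟨p', q', H''⟩ := similar_of_equivalent hEq
      exact ⟨J.gen, hJ, J.carrier, J.mem, _, _, H'.trans H''⟩

/-- A nondegenerate interval is contained in an island none of whose children contains it. -/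
theorem exists_last_island [Finite (S.OverlapType M)] {u v : ℝ} (huv : u < v)
    (hsub : Icc u v ⊆ Icc 0 1) :
    ∃ g, ∃ I ∈ S.islands M g, Icc u v ⊆ I ∧ ∀ J ∈ S.islands M (g + 1), ¬ Icc u v ⊆ J := by
  classical
  have hex : ∃ g, ¬ ∃ I ∈ S.islands M g, Icc u v ⊆ I := by
    obtain ⟨N, hN⟩ := h.diam_tendsto (sub_pos.2 huv)
    refine ⟨N, ?_⟩
    rintro ⟨I, hI, hs⟩
    have h1 := hN N le_rfl I hI
    obtain ⟨a, b, H, rfl⟩ := mem_islands_iff.1 hI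
    rw [Icc_subset_Icc_iff huv.le] at hs
    rw [Real.diam_Icc H.lt.le] at h1
    linarith
  have hmin := fun m => Nat.find_min hex (m := m)
  have hspec := Nat.find_spec hex
  rcases hg : Nat.find hex with _ | g
  · rw [hg] at hspec
    exact absurd ⟨_, h.root_mem, hsub⟩ hspec
  · have h1 := not_not.1 (hmin g (by omega))
    obtain ⟨I, hI, hs⟩ := h1
    rw [hg] at hspec
    push Not at hspec
    exact ⟨g, I, hI, hs, hspec⟩

end IsIslandSystem

namespace IsRegularSystem

variable (h : S.IsRegularSystem K M α)
include h

theorem measure_lake {k l : ℕ} {a b : ℕ → ℝ} (L : S.IsIslandList M k l a b) {i : ℕ} (h1 : 1 ≤ i)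
    (hi : i < l) {u v : ℝ} (hu : b i ≤ u) (hv : v ≤ a (i + 1)) :
    normalizedHausdorff α K (Icc u v) = 0 := by
  have := h.nullSingletonClass
  refine le_antisymm ?_ zero_le
  calc _ ≤ normalizedHausdorff α K ({b i, a (i + 1)} : Set ℝ) := by
        refine h.measure_mono_of_inter fun y hy => ?_
        by_contra hne
        simp only [mem_insert_iff, mem_singleton_iff, not_or] at hne
        refine L.notMem_of_mem_Ioo h1 hi (x := y)
          ⟨lt_of_le_of_ne (hu.trans hy.2.1) (Ne.symm hne.1),
            lt_of_le_of_ne (hy.2.2.trans hv) hne.2⟩ ?_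
        obtain ⟨I, hI, hyI⟩ := h.exists_island_of_mem k hy.1
        exact ⟨I, hI, hyI⟩
    _ = 0 := (Set.toFinite _).measure_zero _

/-- Lakes carry no mass, so the numerator of a pair quotient is the mass between the two bordering
islands, surrounding lakes included. -/
theorem sum_measure_islandList {k l : ℕ} {a b : ℕ → ℝ} (L : S.IsIslandList M k l a b)
    {i j : ℕ} (h1 : 1 ≤ i) (hij : i ≤ j) (hj : j < l) :
    ∑ m ∈ Finset.Icc (i + 1) j, normalizedHausdorff α K (Icc (a m) (b m)) =
      normalizedHausdorff α K (Icc (b i) (a (j + 1))) := by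
  induction j, hij using Nat.le_induction with
  | base => simp [h.measure_lake L h1 hj le_rfl le_rfl]
  | succ j hij ih =>
    have H := L.isComponent (show 1 ≤ j + 1 by omega) hj.le
    have h2 := L.right_le_left h1 (show i < j + 1 by omega) hj.le
    have h3 := L.right_le_left (show 1 ≤ j + 1 by omega) (show j + 1 < j + 1 + 1 by omega) hj
    rw [← Finset.insert_Icc_right_eq_Icc_add_one (by omega), Finset.sum_insert (by simp),
      ih (by omega),
      h.measure_union_Icc (h2.trans H.lt.le) h3, h.measure_lake L (by omega) hj le_rfl le_rfl,
      add_zero, h.measure_union_Icc h2 H.lt.le, add_comm]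

/-- Centre at the point `z` of `K` nearest to the midpoint `c` of `[b i, a (j + 1)]`. The largest
interval about `z` inside it has length `a (j + 1) - b i - 2 * dist c z`, the base in the
denominator. -/
theorem minCentredDensity_le_pairMin {k l : ℕ} {a b : ℕ → ℝ} (L : S.IsIslandList M k l a b) :
    minCentredDensity α K ≤ pairMin α K l a b := by
  refine le_sInf ?_
  rintro y ⟨i, j, h1, hij, hj, rfl⟩
  rw [h.sum_measure_islandList L h1 hij.le hj]
  set c := (a (j + 1) + b i) / 2 with hc
  obtain ⟨z, hzK, hz⟩ := h.compact.exists_infDist_eq_dist h.nonempty c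
  rw [hz]
  have H := L.isComponent (show 1 ≤ i + 1 by omega) (show i + 1 ≤ l by omega)
  have H1 := L.isComponent h1 (show i ≤ l by omega)
  have H2 := L.isComponent (show 1 ≤ j + 1 by omega) (show j + 1 ≤ l by omega)
  rcases lt_or_ge 0 (a (j + 1) - b i - 2 * dist c z) with hpos | hneg
  · set r := (a (j + 1) - b i - 2 * dist c z) / 2 with hr
    have hd : |c - z| = dist c z := (Real.dist_eq c z).symm
    have hd1 := abs_le.1 hd.le
    have hsub : Icc (z - r) (z + r) ⊆ Icc (b i) (a (j + 1)) :=
      Icc_subset_Icc (by linarith [hd1.2]) (by linarith [hd1.1])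
    have key := h.minCentredDensity_mul_le hzK (half_pos hpos) (hsub.trans
      (Icc_subset_Icc ((h.component_subset H1).1.trans H1.lt.le)
        (H2.lt.le.trans (h.component_subset H2).2)))
    rw [← hr, show 2 * r = a (j + 1) - b i - 2 * dist c z by rw [hr]; ring] at key
    rw [ENNReal.le_div_iff_mul_le (Or.inl (ENNReal.rpow_pos (ENNReal.ofReal_pos.2 hpos)
      ENNReal.ofReal_ne_top).ne')
      (Or.inl (ENNReal.rpow_ne_top_of_nonneg h.pos.le ENNReal.ofReal_ne_top))]
    exact key.trans (measure_mono hsub)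
  -- Without room for an interval the denominator is zero; the numerator contains an island and is
  -- positive, so the quotient is infinite.
  · rw [ENNReal.ofReal_eq_zero.2 hneg, ENNReal.zero_rpow_of_pos h.pos, ENNReal.div_zero]
    · exact le_top
    · refine ((h.measure_component_pos H).trans_le (measure_mono (Icc_subset_Icc ?_ ?_))).ne'
      · exact L.right_le_left h1 (by omega) (by omega)
      · exact L.right_le_left (by omega) (by omega) (by omega)

/-- The density estimate for centred intervals which are not in the interior of an island. -/
theorem le_measure_centred {k l : ℕ} {a b : ℕ → ℝ} (L : S.IsIslandList M k l a b) {E : ℝ≥0∞}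
    (hleft : ∀ x, 0 < x → x ≤ 1 →
      E * ENNReal.ofReal (2 * x) ^ α ≤ normalizedHausdorff α K (Icc 0 x))
    (hright : ∀ x, 0 < x → x ≤ 1 →
      E * ENNReal.ofReal (2 * x) ^ α ≤ normalizedHausdorff α K (Icc (1 - x) 1))
    (hpair : E ≤ pairMin α K l a b) {x : ℝ} (hxK : x ∈ K) {s : ℕ} (hs1 : 1 ≤ s) (hsl : s ≤ l)
    (hxs : x ∈ Icc (a s) (b s)) {r : ℝ} (hr : 0 < r) (hsub : Icc (x - r) (x + r) ⊆ Icc 0 1)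
    (hout : x - r ≤ a s ∨ b s ≤ x + r) :
    E * ENNReal.ofReal (2 * r) ^ α ≤ normalizedHausdorff α K (Icc (x - r) (x + r)) := by
  classical
  have hmul : ∀ t, E * ENNReal.ofReal (2 * t) ^ α =
      E * ENNReal.ofReal 2 ^ α * ENNReal.ofReal t ^ α := fun t => by
    rw [ENNReal.mul_ofReal_mul_rpow h.pos.le zero_le_two]; ring
  have hL : ∀ i, 1 ≤ i → i ≤ l → ∀ d, a i < d → d ≤ b i →
      E * ENNReal.ofReal (2 * (d - a i)) ^ α ≤ normalizedHausdorff α K (Icc (a i) d) := by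
    intro i h1 h2 d hd1 hd2
    rw [hmul]
    exact h.le_measure_island_left (fun x hx0 hx1 => by
      rw [← hmul]; exact hleft x hx0 hx1) (L.isComponent h1 h2) hd1 hd2
  have hR : ∀ i, 1 ≤ i → i ≤ l → ∀ d, a i ≤ d → d < b i →
      E * ENNReal.ofReal (2 * (b i - d)) ^ α ≤ normalizedHausdorff α K (Icc d (b i)) := by
    intro i h1 h2 d hd1 hd2
    rw [hmul]
    exact h.le_measure_island_right (fun x hx0 hx1 => by
      rw [← hmul]; exact hright x hx0 hx1) (L.isComponent h1 h2) hd1 hd2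
  have hmono : ∀ t t' : ℝ, t ≤ t' →
      E * ENNReal.ofReal (2 * t) ^ α ≤ E * ENNReal.ofReal (2 * t') ^ α := by
    intro t t' htt
    gcongr
    exact h.pos.le
  have hadd : ∀ u : ℝ, 0 ≤ u → u < r → E * ENNReal.ofReal (2 * r) ^ α ≤
      E * ENNReal.ofReal (2 * (r - u)) ^ α + E * ENNReal.ofReal (2 * u) ^ α := by
    intro u hu hur
    have := ENNReal.mul_ofReal_add_rpow_le h.pos.le h.lt_one.le
      (show 0 ≤ 2 * (r - u) by linarith) (show 0 ≤ 2 * u by linarith) E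
    rwa [show 2 * (r - u) + 2 * u = 2 * r by ring] at this
  -- `R` holds the radii at which the left end meets a right island end or the right end meets a
  -- left island end. The induction is on the number of such radii below `r`.
  set R : Finset ℝ := (Finset.Icc 1 l).image (fun i => x - b i) ∪
    (Finset.Icc 1 l).image (fun i => a i - x) with hRdef
  have hRb : ∀ i, 1 ≤ i → i ≤ l → x - b i ∈ R := fun i h1 h2 =>
    Finset.mem_union_left _ (Finset.mem_image_of_mem _ (Finset.mem_Icc.2 ⟨h1, h2⟩))
  have hRa : ∀ i, 1 ≤ i → i ≤ l → a i - x ∈ R := fun i h1 h2 =>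
    Finset.mem_union_right _
      (Finset.mem_image_of_mem (fun i => a i - x) (Finset.mem_Icc.2 ⟨h1, h2⟩))
  induction hN : {u ∈ R | u < r}.card using Nat.strong_induction_on generalizing r with
  | _ N ih =>
  have hsub' := (Icc_subset_Icc_iff (show x - r ≤ x + r by linarith)).1 hsub
  have hstep : ∀ u ∈ R, 0 ≤ u → u < r → (x - u ≤ a s ∨ b s ≤ x + u) →
      E * ENNReal.ofReal (2 * u) ^ α ≤ normalizedHausdorff α K (Icc (x - u) (x + u)) := by
    intro u huR hu0 hur hou
    rcases hu0.eq_or_lt with rfl | hu0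
    · simp [ENNReal.zero_rpow_of_pos h.pos]
    refine ih _ ?_ hu0 (hsub.trans' (Icc_subset_Icc (by linarith) (by linarith))) hou
      (fun v hv0 hvu => ?_) rfl
    · rw [← hN]
      refine Finset.card_lt_card ((Finset.ssubset_iff_of_subset ?_).2 ⟨u, ?_, ?_⟩)
      · intro v hv
        simp only [Finset.mem_filter] at hv ⊢
        exact ⟨hv.1, hv.2.trans hur⟩
      · simp only [Finset.mem_filter]; exact ⟨huR, hur⟩
      · simp only [Finset.mem_filter, lt_self_iff_false, and_false, not_false_eq_true]
    · have := ENNReal.mul_ofReal_add_rpow_le h.pos.le h.lt_one.le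
        (show 0 ≤ 2 * (u - v) by linarith) (show 0 ≤ 2 * v by linarith) E
      rwa [show 2 * (u - v) + 2 * v = 2 * u by ring] at this
  have Hs := L.isComponent hs1 hsl
  -- If only one side leaves the island of `x`, the interval contains an end piece of that island of
  -- length at least `r`, and the one-sided bound suffices.
  by_cases c1 : a s ≤ x - r ∧ b s ≤ x + r
  · rcases hxs.2.eq_or_lt with hxb | hxb
    all_goals
      refine (hmono _ _ ?_).trans ((hR s hs1 hsl (x - r) c1.1 (by linarith)).trans
        (measure_mono (Icc_subset_Icc_right c1.2)))
      linarith
  by_cases c2 : x - r ≤ a s ∧ x + r ≤ b s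
  · refine (hmono _ _ ?_).trans ((hL s hs1 hsl (x + r) (by linarith [hxs.1]) c2.2).trans
      (measure_mono (Icc_subset_Icc_left c2.1)))
    linarith [hxs.1]
  have c3 : x - r < a s ∧ b s < x + r := by
    rcases hout with ho | ho
    · have h2 : b s < x + r := by
        by_contra! hle
        exact c2 ⟨ho, hle⟩
      refine ⟨lt_of_le_of_ne ho fun e => c1 ⟨e.ge, h2.le⟩, h2⟩
    · have h2 : x - r < a s := by
        by_contra! hle
        exact c1 ⟨hle, ho⟩
      exact ⟨h2, lt_of_le_of_ne ho fun e => c2 ⟨h2.le, e.ge⟩⟩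
  -- Cut at `b p` and put `u = x - b p`. The piece left of the cut is an end piece of length `r -
  -- u`. The remainder contains the interval of radius `u`, which still reaches beyond island `s`
  -- and falls under the induction.
  by_cases c4 : ∃ p, 1 ≤ p ∧ p ≤ l ∧ x - r ∈ Ico (a p) (b p)
  · obtain ⟨p, hp1, hpl, hp⟩ := c4
    have hps : p < s := by
      by_contra! hge
      linarith [L.left_mono hs1 hge hpl, hp.1]
    have hba := L.right_le_left hp1 hps hsl
    refine (hadd (x - b p) (by linarith [hxs.1]) (by linarith [hp.2])).trans ?_
    have e1 := hR p hp1 hpl (x - r) hp.1 hp.2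
    have e2 := hstep (x - b p) (hRb p hp1 hpl) (by linarith [hxs.1]) (by linarith [hp.2])
      (Or.inl (by linarith))
    rw [sub_sub_cancel] at e2
    rw [show r - (x - b p) = b p - (x - r) by ring]
    refine (add_le_add e1 e2).trans ?_
    rw [← h.measure_union_Icc hp.2.le (by linarith [hxs.1])]
    exact measure_mono (Icc_subset_Icc_right (by linarith [hp.2]))
  by_cases c5 : ∃ q, 1 ≤ q ∧ q ≤ l ∧ x + r ∈ Ioc (a q) (b q)
  · obtain ⟨q, hq1, hql, hq⟩ := c5
    have hsq : s < q := by
      by_contra! hge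
      linarith [L.right_mono hq1 hge hsl, hq.2]
    have hba := L.right_le_left hs1 hsq hql
    refine (hadd (a q - x) (by linarith [hxs.2]) (by linarith [hq.1])).trans ?_
    have e1 := hL q hq1 hql (x + r) hq.1 hq.2
    have e2 := hstep (a q - x) (hRa q hq1 hql) (by linarith [hxs.2]) (by linarith [hq.1])
      (Or.inr (by linarith))
    rw [add_sub_cancel] at e2
    rw [show r - (a q - x) = x + r - a q by ring, add_comm]
    refine (add_le_add e2 e1).trans ?_
    rw [← h.measure_union_Icc (by linarith [hxs.2]) hq.1.le]
    exact measure_mono (Icc_subset_Icc_left (by linarith [hq.1]))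
  -- In the remaining case both ends lie in closed lakes, possibly degenerate ones. Moving them
  -- outwards to `b p` and `a (q + 1)` leaves the mass unchanged.
  have c4' : ∀ i, 1 ≤ i → i ≤ l → a i ≤ x - r → b i ≤ x - r := fun i h1 h2 h3 => by
    by_contra! hlt
    exact c4 ⟨i, h1, h2, h3, hlt⟩
  have c5' : ∀ i, 1 ≤ i → i ≤ l → x + r ≤ b i → x + r ≤ a i := fun i h1 h2 h3 => by
    by_contra! hlt
    exact c5 ⟨i, h1, h2, hlt, h3⟩
  obtain ⟨hl1, ha1⟩ := L.first h.toIsIslandSystem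
  obtain ⟨p, hp, hpmax⟩ := Finset.exists_max_image {i ∈ Finset.Icc 1 l | a i ≤ x - r} id
    ⟨1, by simp only [Finset.mem_filter, Finset.mem_Icc]; exact ⟨⟨le_rfl, hl1⟩, by linarith⟩⟩
  obtain ⟨q, hq, hqmin⟩ := Finset.exists_min_image {i ∈ Finset.Icc 1 l | x + r ≤ b i} id
    ⟨l, by
      simp only [Finset.mem_filter, Finset.mem_Icc]
      exact ⟨⟨hl1, le_rfl⟩, by linarith [L.last h.toIsIslandSystem]⟩⟩
  simp only [Finset.mem_filter, Finset.mem_Icc, id] at hp hpmax hq hqmin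
  have hps : p < s := by
    by_contra! hge
    linarith [L.left_mono hs1 hge hp.1.2]
  have hsq : s < q := by
    by_contra! hge
    linarith [L.right_mono hq.1.1 hge hsl]
  obtain ⟨q, rfl⟩ : ∃ q', q = q' + 1 := ⟨q - 1, by omega⟩
  have hp' : x - r ≤ a (p + 1) := by
    by_contra! hlt
    have := hpmax (p + 1) ⟨⟨by omega, by omega⟩, hlt.le⟩
    omega
  have hq' : b q ≤ x + r := by
    by_contra! hlt
    have := hqmin q ⟨⟨by omega, by omega⟩, hlt.le⟩
    omega
  have hbp := c4' p hp.1.1 hp.1.2 hp.2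
  have haq := c5' (q + 1) hq.1.1 hq.1.2 hq.2
  have hE := hpair.trans (sInf_le ⟨p, q, hp.1.1, by omega, by omega, rfl⟩)
  rw [h.sum_measure_islandList L hp.1.1 (by omega) (by omega)] at hE
  -- The centre `x` lies in `K`, so the distance from the midpoint to `K` is at most the distance to
  -- `x`.
  have hΔ : 2 * r ≤ a (q + 1) - b p - 2 * Metric.infDist ((a (q + 1) + b p) / 2) K := by
    have h1 := Metric.infDist_le_dist_of_mem (x := (a (q + 1) + b p) / 2) hxK
    rw [Real.dist_eq] at h1
    rcases abs_cases ((a (q + 1) + b p) / 2 - x) with ⟨h2, -⟩ | ⟨h2, -⟩ <;>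
      rw [h2] at h1 <;> linarith
  have hΔ0 : 0 < a (q + 1) - b p - 2 * Metric.infDist ((a (q + 1) + b p) / 2) K := by linarith
  rw [ENNReal.le_div_iff_mul_le (Or.inl (ENNReal.rpow_pos (ENNReal.ofReal_pos.2 hΔ0)
      ENNReal.ofReal_ne_top).ne')
      (Or.inl (ENNReal.rpow_ne_top_of_nonneg h.pos.le ENNReal.ofReal_ne_top))] at hE
  calc E * ENNReal.ofReal (2 * r) ^ α ≤ _ := by
        refine mul_le_mul' le_rfl (ENNReal.rpow_le_rpow (ENNReal.ofReal_le_ofReal hΔ) h.pos.le)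
    _ ≤ normalizedHausdorff α K (Icc (b p) (a (q + 1))) := hE
    _ = _ := by
        rw [h.measure_union_Icc hbp (show x - r ≤ a (q + 1) by linarith),
          h.measure_lake L hp.1.1 (by omega) le_rfl hp', zero_add,
          h.measure_union_Icc (show x - r ≤ x + r by linarith) haq,
          h.measure_lake L (show 1 ≤ q by omega) (by omega) hq' le_rfl, add_zero]

/-- Densities are invariant under similarities of islands. Any interval can therefore be moved from
the last island containing it into one of generation at most `k₀`, where `le_measure_centred`
applies to the islands of generation `k₀ + 1`. -/
theorem le_minCentredDensity {k₀ : ℕ} (hk : S.NoNewType M k₀) {l : ℕ} {a b : ℕ → ℝ}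
    (L : S.IsIslandList M (k₀ + 1) l a b) {E : ℝ≥0∞}
    (hleft : ∀ x, 0 < x → x ≤ 1 →
      E * ENNReal.ofReal (2 * x) ^ α ≤ normalizedHausdorff α K (Icc 0 x))
    (hright : ∀ x, 0 < x → x ≤ 1 →
      E * ENNReal.ofReal (2 * x) ^ α ≤ normalizedHausdorff α K (Icc (1 - x) 1))
    (hpair : E ≤ pairMin α K l a b) : E ≤ minCentredDensity α K := by
  have := h.finite
  refine le_sInf ?_
  rintro y ⟨x, hxK, r, hr, hsub, rfl⟩
  rw [h.le_density_iff (by linarith), show x + r - (x - r) = 2 * r by ring]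
  obtain ⟨g, I, hI, hJI, hlast⟩ := h.exists_last_island (show x - r < x + r by linarith) hsub
  obtain ⟨g', hg', I', hI', p, q, H⟩ := h.exists_similar_of_noNewType hk g hI
  have hp := abs_pos.2 H.ne_zero
  have hr' : 0 < |p| * r := mul_pos hp hr
  have hτ := affineFun_image_Icc q H.ne_zero x r
  have hxI : x ∈ I := hJI ⟨by linarith, by linarith⟩
  have hτK : affineFun p q x ∈ K := by
    have : affineFun p q x ∈ affineFun p q '' (K ∩ I) := mem_image_of_mem _ ⟨hxK, hxI⟩
    rw [h.similar_image hI hI' H] at this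
    exact this.1
  have hτI : affineFun p q '' Icc (x - r) (x + r) ⊆ I' := by
    rw [← H.image_eq]; exact image_mono hJI
  -- As `g' ≤ k₀`, an island `A` containing the image lies in a child of `I'`. Pulled back, this
  -- would be a child of `I` containing the original interval, against the choice of `I`.
  have hnot : ∀ A ∈ S.islands M (k₀ + 1), ¬ affineFun p q '' Icc (x - r) (x + r) ⊆ A := by
    intro A hA hsubA
    obtain ⟨m, hm⟩ := Nat.exists_eq_add_of_le (Nat.succ_le_succ hg')
    obtain ⟨B, hB, hAB⟩ := h.exists_parent_island (g' + 1) m (by rw [← hm]; exact hA)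
    obtain ⟨I'', hI'', hBI⟩ := h.exists_parent_island g' 1 hB
    rw [hτ] at hτI hsubA
    obtain rfl := islands_eq_of_Icc_subset hI' hI'' (by linarith) hτI
      ((hsubA.trans hAB).trans hBI)
    have hBd := (H.symm.mem_iff 1 B).1 (mem_desc.2 ⟨hB, hBI⟩)
    refine hlast _ (mem_desc.1 hBd).1 ?_
    rw [← affineFun_inv_image q H.ne_zero (Icc (x - r) (x + r)), hτ]
    exact image_mono (hsubA.trans hAB)
  obtain ⟨c, d, Hc, hcd⟩ := h.exists_component_of_mem (k₀ + 1) hτK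
  obtain ⟨s, hs1, hsl, rfl, rfl⟩ := L.exists_index Hc
  have key := h.le_measure_centred L hleft hright hpair hτK hs1 hsl hcd hr'
    (by rw [← hτ]; exact hτI.trans (h.island_subset hI')) (by
      by_contra! hcon
      refine hnot _ Hc.mem_islands ?_
      rw [hτ]
      exact Icc_subset_Icc hcon.1.le hcon.2.le)
  rw [← hτ, h.measure_similar_image hI hI' H hJI, mul_left_comm,
    ENNReal.mul_ofReal_mul_rpow h.pos.le (abs_nonneg p)] at key
  exact ENNReal.le_of_ofReal_rpow_mul_le h.pos.le hp key

end IsRegularSystem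

end LinearIFS

/-! ### The packing measure -/

namespace LinearIFS

variable {n : ℕ} {S : LinearIFS n} {M : ℕ → Finset (List (Fin (n + 1)))} {K : Set ℝ} {α : ℝ}

variable (S M) in
/-- The part of an island of generation `g` not covered by the images of `A` in the descendants
similar to the root. -/
def unhit (K A : Set ℝ) (g : ℕ) (I : Set ℝ) : Set ℝ :=
  {x ∈ K ∩ I | ∀ l, ∀ J ∈ S.desc M g I l, ∀ p q, S.Similar M p q 0 (Icc 0 1) (g + l) J →
    x ∉ affineFun p q '' A}

theorem unhit_inter_subset {A : Set ℝ} {g l : ℕ} {I J : Set ℝ} (hJ : J ∈ S.desc M g I l) :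
    S.unhit M K A g I ∩ J ⊆ S.unhit M K A (g + l) J := by
  rintro x ⟨⟨hx, hxI⟩, hxJ⟩
  refine ⟨⟨hx.1, hxJ⟩, fun m B hB p q H => ?_⟩
  rw [mem_desc] at hJ hB
  rw [Nat.add_assoc] at hB H
  exact hxI (l + m) B (mem_desc.2 ⟨hB.1, hB.2.trans hJ.2⟩) p q H

namespace IsRegularSystem

variable (h : S.IsRegularSystem K M α)
include h

theorem measureReal_component_pos {g : ℕ} {I : Set ℝ} (hI : I ∈ S.islands M g) :
    0 < (normalizedHausdorff α K).real I := by
  have := h.isProbabilityMeasure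
  obtain ⟨a, b, H, rfl⟩ := mem_islands_iff.1 hI
  exact ENNReal.toReal_pos (h.measure_component_pos H).ne'
    (measure_lt_top (normalizedHausdorff α K) _).ne

theorem sum_measureReal_desc_le (g l : ℕ) (I : Set ℝ) :
    ∑ J ∈ S.desc M g I l, (normalizedHausdorff α K).real J ≤
      (normalizedHausdorff α K).real I := by
  have := h.isProbabilityMeasure
  have := h.nullSingletonClass
  have key := sum_measure_desc_le (S := S) (M := M) (normalizedHausdorff α K) g l I
    MeasurableSet.univ
  simp only [inter_univ] at key
  simp only [Measure.real]
  rw [← ENNReal.toReal_sum fun J _ => (measure_lt_top (normalizedHausdorff α K) J).ne]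
  exact ENNReal.toReal_mono (measure_lt_top (normalizedHausdorff α K) I).ne key

/-- In each island, a fixed proportion is covered by an image of a given island under a similarity
of the root. -/
theorem exists_hit {N : ℕ} {A : Set ℝ} (hA : A ∈ S.islands M N) :
    ∃ η : ℝ, 0 < η ∧ η ≤ 1 ∧ ∀ g, ∀ I ∈ S.islands M g, ∃ l m, ∃ J ∈ S.desc M g I l,
      ∃ B ∈ S.desc M g I m, ∃ p q, S.Similar M p q 0 (Icc 0 1) (g + l) J ∧
        B = affineFun p q '' A ∧
        η * (normalizedHausdorff α K).real I ≤ (normalizedHausdorff α K).real B := by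
  have := h.isProbabilityMeasure
  have := h.finite
  let T : S.OverlapType M → S.Island M := Quotient.out
  have hT : ∀ t, (⟦T t⟧ : S.OverlapType M) = t := fun t => Quotient.out_eq t
  have hAd : A ∈ S.desc M 0 (Icc 0 1) N := h.mem_desc_root.2 hA
  have h1 : ∀ t, ∃ l, ∃ J ∈ S.desc M (T t).gen (T t).carrier l, ∃ p q,
      S.Similar M p q 0 (Icc 0 1) ((T t).gen + l) J := fun t => by
    obtain ⟨l, J, hJ, p, q, H⟩ := h.transitive _ _ (T t).mem 0 _ h.root_mem
    exact ⟨l, J, hJ, _, _, H.symm⟩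
  choose l J hJ p q H using h1
  have hB : ∀ t, affineFun (p t) (q t) '' A ∈ S.desc M (T t).gen (T t).carrier (l t + N) :=
    fun t => by
      have h2 := (mem_desc.1 (((H t).mem_iff N A).1 hAd))
      rw [Nat.add_assoc] at h2
      exact mem_desc.2 ⟨h2.1, h2.2.trans (mem_desc.1 (hJ t)).2⟩
  have hη : ∀ t, 0 < (normalizedHausdorff α K).real (affineFun (p t) (q t) '' A) /
      (normalizedHausdorff α K).real (T t).carrier := fun t =>
    div_pos (h.measureReal_component_pos (mem_desc.1 (hB t)).1)
      (h.measureReal_component_pos (T t).mem)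
  have := Fintype.ofFinite (S.OverlapType M)
  obtain ⟨η, hη0, hηle⟩ := exists_pos_forall_lt Finset.univ _ fun t _ => hη t
  refine ⟨min η 1, lt_min hη0 one_pos, min_le_right _ _, fun g I hI => ?_⟩
  obtain ⟨t, p', q', H'⟩ := exists_similar_representative T hT hI
  have hJ' := (H'.symm.mem_iff _ _).1 (hJ t)
  have hB' := (H'.symm.mem_iff _ _).1 (hB t)
  refine ⟨l t, l t + N, _, hJ', _, hB', _, _, (H t).trans (H'.symm.child (hJ t)), ?_, ?_⟩
  · rw [image_image]
    congr 1
    ext x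
    simp only [affineFun]; ring
  · have e1 := h.measure_similar_image (T t).mem hI H'.symm (mem_desc.1 (hB t)).2
    have e2 := h.measure_similar_image (T t).mem hI H'.symm subset_rfl
    rw [H'.symm.image_eq] at e2
    have h3 := hηle t (Finset.mem_univ t)
    rw [lt_div_iff₀ (h.measureReal_component_pos (T t).mem)] at h3
    simp only [Measure.real] at h3 ⊢
    rw [e1, e2, ENNReal.toReal_mul, ENNReal.toReal_mul]
    calc min η 1 * _ ≤ η * _ := mul_le_mul_of_nonneg_right (min_le_left _ _) (by positivity)
      _ = (ENNReal.ofReal |p'⁻¹| ^ α).toReal *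
          (η * (normalizedHausdorff α K (T t).carrier).toReal) := by ring
      _ ≤ _ := mul_le_mul_of_nonneg_left h3.le ENNReal.toReal_nonneg

/-- In every island a proportion `η` of the mass is hit, and the unhit part of what remains is unhit
in the smaller islands. Iteration gives the bound `(1 - η) ^ j` for each `j`. -/
theorem measure_unhit {N : ℕ} {A : Set ℝ} (hA : A ∈ S.islands M N) {g : ℕ} {I : Set ℝ}
    (hI : I ∈ S.islands M g) : normalizedHausdorff α K (S.unhit M K A g I) = 0 := by
  classical
  have := h.isProbabilityMeasure
  have := h.finite
  obtain ⟨η, hη0, hη1, hhit⟩ := h.exists_hit hA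
  have key : ∀ j : ℕ, ∀ g, ∀ I ∈ S.islands M g, (normalizedHausdorff α K).real
      (S.unhit M K A g I) ≤ (1 - η) ^ j * (normalizedHausdorff α K).real I := by
    intro j
    induction j with
    | zero =>
      intro g I hI
      rw [pow_zero, one_mul]
      exact measureReal_mono fun x hx => hx.1.2
    | succ j ih =>
      intro g I hI
      obtain ⟨l, m, J, hJ, B, hB, p, q, H, hBA, hle⟩ := hhit g I hI
      have hsub : S.unhit M K A g I ⊆
          ⋃ D ∈ (S.desc M g I m).erase B, S.unhit M K A (g + m) D := by
        intro x hx
        obtain ⟨D, hD, hxD⟩ := (h.mem_inter_island_iff hI).1 hx.1 m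
        refine mem_iUnion₂.2 ⟨D, Finset.mem_erase.2 ⟨?_, hD⟩, unhit_inter_subset hD ⟨hx, hxD⟩⟩
        rintro rfl
        exact hx.2 l J hJ p q H (hBA ▸ hxD)
      have hsum := h.sum_measureReal_desc_le g m I
      rw [← Finset.add_sum_erase _ _ hB] at hsum
      have hpow : 0 ≤ (1 - η) ^ j := pow_nonneg (by linarith) j
      calc _ ≤ (normalizedHausdorff α K).real
            (⋃ D ∈ (S.desc M g I m).erase B, S.unhit M K A (g + m) D) :=
          measureReal_mono hsub (measure_lt_top (normalizedHausdorff α K) _).ne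
        _ ≤ ∑ D ∈ (S.desc M g I m).erase B,
            (normalizedHausdorff α K).real (S.unhit M K A (g + m) D) :=
          measureReal_biUnion_finset_le _ _
        _ ≤ ∑ D ∈ (S.desc M g I m).erase B,
            (1 - η) ^ j * (normalizedHausdorff α K).real D :=
          Finset.sum_le_sum fun D hD =>
            ih _ _ (mem_desc.1 (Finset.mem_of_mem_erase hD)).1
        _ = (1 - η) ^ j * ∑ D ∈ (S.desc M g I m).erase B,
            (normalizedHausdorff α K).real D := by rw [Finset.mul_sum]
        _ ≤ (1 - η) ^ j * ((1 - η) * (normalizedHausdorff α K).real I) :=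
          mul_le_mul_of_nonneg_left (by linarith) hpow
        _ = _ := by ring
  have hlim : Tendsto (fun j : ℕ => (1 - η) ^ j * (normalizedHausdorff α K).real I) atTop
      (𝓝 (0 * (normalizedHausdorff α K).real I)) :=
    (tendsto_pow_atTop_nhds_zero_of_lt_one (by linarith) (by linarith)).mul_const _
  rw [zero_mul] at hlim
  have h0 := ge_of_tendsto' hlim fun j => key j g I hI
  exact (measureReal_eq_zero_iff).1 (le_antisymm h0 measureReal_nonneg)

/-- Almost every point has arbitrarily small intervals with density close to that of a given
centred interval. -/
theorem ae_exists_density_le {y r : ℝ} (hy : y ∈ K) (hr : 0 < r)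
    (hsub : Icc (y - r) (y + r) ⊆ Icc 0 1) {c : ℝ} (hc : 1 < c) :
    normalizedHausdorff α K {x ∈ K | ∀ δ > 0, ∃ t ∈ Ioo 0 δ,
      normalizedHausdorff α K (Icc (x - t) (x + t)) ≤
        density α K (Icc (y - r) (y + r)) * ENNReal.ofReal c ^ α *
          ENNReal.ofReal (2 * t) ^ α}ᶜ = 0 := by
  have := h.finite
  have := h.isProbabilityMeasure
  set d := density α K (Icc (y - r) (y + r)) with hd
  have hc0 : 0 < c := one_pos.trans hc
  have hrc : r / c < r := div_lt_self hr hc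
  have hrc0 : 0 < r / c := div_pos hr hc0
  have hdr : normalizedHausdorff α K (Icc (y - r) (y + r)) = d * ENNReal.ofReal (2 * r) ^ α := by
    rw [hd, density, Real.ediam_Icc, show y + r - (y - r) = 2 * r by ring,
      ENNReal.div_mul_cancel]
    · exact (ENNReal.rpow_pos (ENNReal.ofReal_pos.2 (by linarith)) ENNReal.ofReal_ne_top).ne'
    · exact ENNReal.rpow_ne_top_of_nonneg h.pos.le ENNReal.ofReal_ne_top
  -- An island `A` around `y` shorter than `r - r / c` makes every interval of radius `r / c` about
  -- a point of `A` lie in `[y - r, y + r]`. A point in a copy of `A` thus gets density at most `d *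
  -- c ^ α`, and such copies occur at arbitrarily small scales.
  obtain ⟨N, hN⟩ := h.diam_tendsto (sub_pos.2 hrc)
  obtain ⟨A, hA, hyA⟩ := h.exists_island_of_mem N hy
  have hAd := hN N le_rfl A hA
  have hA1 : A ⊆ Icc 0 1 := h.island_subset hA
  have hAdist : ∀ z ∈ A, |z - y| < r - r / c := by
    intro z hz
    obtain ⟨a, b, H, rfl⟩ := mem_islands_iff.1 hA
    rw [← Real.dist_eq]
    exact (Metric.dist_le_diam_of_mem (Metric.isBounded_Icc a b) hz hyA).trans_lt hAd
  refine measure_mono_null (t := Kᶜ ∪ ⋃ k : ℕ, ⋃ I ∈ S.islands M k, S.unhit M K A k I)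
    ?_ ?_
  · intro x hx
    by_contra hcon
    rw [mem_union, not_or, mem_compl_iff, not_not] at hcon
    obtain ⟨hxK, hcon⟩ := hcon
    refine hx ⟨hxK, fun δ hδ => ?_⟩
    obtain ⟨k, hk⟩ := h.diam_tendsto (div_pos hδ hrc0)
    obtain ⟨I, hI, hxI⟩ := h.exists_island_of_mem k hxK
    have hnot : x ∉ S.unhit M K A k I := fun hu =>
      hcon (mem_iUnion.2 ⟨k, mem_iUnion₂.2 ⟨I, hI, hu⟩⟩)
    have : ∃ l, ∃ J ∈ S.desc M k I l, ∃ p q, S.Similar M p q 0 (Icc 0 1) (k + l) J ∧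
        x ∈ affineFun p q '' A := by
      by_contra! hcon'
      exact hnot ⟨⟨hxK, hxI⟩, hcon'⟩
    obtain ⟨l, J, hJ, p, q, H, z, hzA, rfl⟩ := this
    have hp := abs_pos.2 H.ne_zero
    have hJd := hk (k + l) (Nat.le_add_right _ _) J (mem_desc.1 hJ).1
    rw [H.diam_eq, Real.diam_Icc zero_le_one, sub_zero, mul_one, lt_div_iff₀ hrc0] at hJd
    refine ⟨|p| * (r / c), ⟨mul_pos hp hrc0, hJd⟩, ?_⟩
    have hz := abs_lt.1 (hAdist z hzA)
    have hzs : Icc (z - r / c) (z + r / c) ⊆ Icc (y - r) (y + r) :=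
      Icc_subset_Icc (by linarith) (by linarith)
    rw [← affineFun_image_Icc q H.ne_zero,
      h.measure_similar_image h.root_mem (mem_desc.1 hJ).1 H (hzs.trans hsub)]
    calc _ ≤ ENNReal.ofReal |p| ^ α * normalizedHausdorff α K (Icc (y - r) (y + r)) :=
          mul_le_mul' le_rfl (measure_mono hzs)
      _ = d * ENNReal.ofReal (|p| * (2 * r)) ^ α := by
          rw [hdr, ENNReal.mul_ofReal_mul_rpow h.pos.le hp.le]
      _ = d * ENNReal.ofReal (c * (2 * (|p| * (r / c)))) ^ α := by
          congr 3; field_simp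
      _ = _ := by rw [ENNReal.mul_ofReal_mul_rpow h.pos.le hc0.le]; ring
  · rw [measure_union_null_iff]
    refine ⟨h.measure_compl, measure_iUnion_null fun k => ?_⟩
    exact (measure_biUnion_null_iff (finite_islands k).countable).2 fun I hI =>
      h.measure_unhit hA hI

/-- A bound from below for the packing premeasure of an arbitrary set. -/
theorem measure_div_le_packingPremeasure {E : ℝ≥0∞} (hE : normalizedHausdorff α K
    {x ∈ K | ∀ δ > 0, ∃ t ∈ Ioo 0 δ, normalizedHausdorff α K (Icc (x - t) (x + t)) ≤
      E * ENNReal.ofReal (2 * t) ^ α}ᶜ = 0) (F : Set ℝ) :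
    normalizedHausdorff α K F / E ≤ packingPremeasure α F := by
  have := h.isProbabilityMeasure
  set G := {x ∈ K | ∀ δ > 0, ∃ t ∈ Ioo 0 δ, normalizedHausdorff α K (Icc (x - t) (x + t)) ≤
      E * ENNReal.ofReal (2 * t) ^ α} with hG
  refine le_iInf₂ fun δ hδ => ENNReal.div_le_of_le_mul' ?_
  -- The covering theorem selects disjoint closed balls of radius below `δ`, with centres in `F` and
  -- low density, covering almost all of `F ∩ G`. The corresponding open balls form a packing of
  -- `F`.
  obtain ⟨t, ρ, htc, hts, htr, hcov, hdisj⟩ :=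
    Besicovitch.exists_disjoint_closedBall_covering_ae (normalizedHausdorff α K)
      (fun x => {t | normalizedHausdorff α K (Icc (x - t) (x + t)) ≤
        E * ENNReal.ofReal (2 * t) ^ α}) (F ∩ G)
      (fun x hx δ hδ => by
        obtain ⟨t, ht, htE⟩ := hx.2.2 δ hδ
        exact ⟨t, htE, ht⟩) (fun _ => δ) (fun _ _ => hδ)
  set B : Set (ℝ × ℝ) := (fun x => (x, ρ x)) '' t with hB
  have hpack : IsPacking δ F B := by
    refine ⟨htc.image _, ?_, ?_⟩
    · rintro _ ⟨x, hx, rfl⟩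
      exact ⟨(hts hx).1, (htr x hx).2.1, (htr x hx).2.2.le⟩
    · rintro _ ⟨x, hx, rfl⟩ _ ⟨x', hx', rfl⟩ hne
      have hxx : x ≠ x' := fun e => hne (by rw [e])
      exact (hdisj hx hx' hxx).mono Metric.ball_subset_closedBall Metric.ball_subset_closedBall
  have hsup : ∑' c : B, Metric.ediam (Metric.ball c.1.1 c.1.2) ^ α ≤ packingSup α δ F :=
    le_iSup₂ (f := fun (B : Set (ℝ × ℝ)) (_ : IsPacking δ F B) =>
      ∑' c : B, Metric.ediam (Metric.ball c.1.1 c.1.2) ^ α) B hpack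
  have hinj : InjOn (fun x => (x, ρ x)) t := fun x _ x' _ e => congrArg Prod.fst e
  rw [hB, tsum_image (f := fun c : ℝ × ℝ => Metric.ediam (Metric.ball c.1 c.2) ^ α) hinj] at hsup
  have hFG : normalizedHausdorff α K F ≤ normalizedHausdorff α K (F ∩ G) := by
    calc _ ≤ normalizedHausdorff α K ((F ∩ G) ∪ Gᶜ) := measure_mono fun x hx => by
          by_cases hxG : x ∈ G
          · exact Or.inl ⟨hx, hxG⟩
          · exact Or.inr hxG
      _ ≤ _ := (measure_union_le _ _).trans (by rw [hE, add_zero])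
  have := htc.to_subtype
  calc normalizedHausdorff α K F
      ≤ normalizedHausdorff α K ((⋃ x ∈ t, Metric.closedBall x (ρ x)) ∪
          (F ∩ G) \ ⋃ x ∈ t, Metric.closedBall x (ρ x)) :=
        hFG.trans (measure_mono fun x hx => by
          by_cases hx' : x ∈ ⋃ x ∈ t, Metric.closedBall x (ρ x)
          · exact Or.inl hx'
          · exact Or.inr ⟨hx, hx'⟩)
    _ ≤ normalizedHausdorff α K (⋃ x ∈ t, Metric.closedBall x (ρ x)) :=
        (measure_union_le _ _).trans (by rw [hcov, add_zero])
    _ ≤ ∑' x : t, normalizedHausdorff α K (Metric.closedBall (x : ℝ) (ρ x)) :=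
        measure_biUnion_le _ htc _
    _ ≤ ∑' x : t, E * Metric.ediam (Metric.ball (x : ℝ) (ρ x)) ^ α := by
        refine ENNReal.tsum_le_tsum fun x => ?_
        rw [Real.closedBall_eq_Icc, Real.ball_eq_Ioo, Real.ediam_Ioo,
          show (x : ℝ) + ρ x - (x - ρ x) = 2 * ρ x by ring]
        exact (htr x x.2).1
    _ = E * ∑' x : t, Metric.ediam (Metric.ball (x : ℝ) (ρ x)) ^ α := ENNReal.tsum_mul_left
    _ ≤ E * packingSup α δ F := mul_le_mul' le_rfl hsup

/-- The premeasure bound holds for arbitrary sets, so it can be summed over any countable cover of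
`K`, whose total mass is at least one. Finally `c` tends to `1`. -/
theorem inv_packingMeasure_le : (packingMeasure α K)⁻¹ ≤ minCentredDensity α K := by
  have := h.isProbabilityMeasure
  refine le_sInf ?_
  rintro _ ⟨y, hy, r, hr, hsub, rfl⟩
  set d := density α K (Icc (y - r) (y + r)) with hd
  have key : ∀ c : ℝ, 1 < c → (packingMeasure α K)⁻¹ ≤ d * ENNReal.ofReal c ^ α := by
    intro c hc
    rw [ENNReal.inv_le_iff_inv_le]
    refine le_iInf₂ fun F hF => ?_
    have hae := h.ae_exists_density_le hy hr hsub hc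
    calc (d * ENNReal.ofReal c ^ α)⁻¹
        = normalizedHausdorff α K K / (d * ENNReal.ofReal c ^ α) := by
          rw [h.measure_eq_one subset_rfl, one_div]
      _ ≤ (∑' i, normalizedHausdorff α K (F i)) / (d * ENNReal.ofReal c ^ α) :=
          ENNReal.div_le_div_right ((measure_mono hF).trans (measure_iUnion_le F)) _
      _ = ∑' i, normalizedHausdorff α K (F i) / (d * ENNReal.ofReal c ^ α) := by
          simp only [div_eq_mul_inv]
          exact ENNReal.tsum_mul_right.symm
      _ ≤ _ := ENNReal.tsum_le_tsum fun i => h.measure_div_le_packingPremeasure hae (F i)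
  have hlim : Tendsto (fun c : ℝ => d * ENNReal.ofReal c ^ α) (𝓝[>] 1)
      (𝓝 (d * ENNReal.ofReal 1 ^ α)) := by
    refine ENNReal.Tendsto.const_mul ?_ (Or.inl (by simp))
    exact ((ENNReal.continuous_rpow_const.comp ENNReal.continuous_ofReal).tendsto 1).mono_left
      nhdsWithin_le_nhds
  rw [ENNReal.ofReal_one, ENNReal.one_rpow, mul_one] at hlim
  exact ge_of_tendsto hlim (eventually_nhdsWithin_of_forall fun c hc => key c hc)

/-- Balls of a packing may stick out of `[0, 1]`. Then the part inside is an end piece of length at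
least `r`, and the one-sided bounds take over; `r ≤ 1 / 2` keeps that length at most one. -/
theorem minCentredDensity_mul_le_of_small (hA : S.AssumptionA M) (hB : S.AssumptionB K)
    {x r : ℝ} (hx : x ∈ K) (hr : 0 < r) (hr2 : r ≤ 1 / 2) :
    minCentredDensity α K * ENNReal.ofReal (2 * r) ^ α ≤
      normalizedHausdorff α K (Icc (x - r) (x + r)) := by
  have hx01 := h.subset_Icc hx
  have hmono : ∀ t : ℝ, r ≤ t → minCentredDensity α K * ENNReal.ofReal (2 * r) ^ α ≤
      minCentredDensity α K * ENNReal.ofReal (2 * t) ^ α := by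
    intro t ht
    gcongr
    exact h.pos.le
  rcases lt_or_ge (x - r) 0 with h1 | h1
  · refine (hmono (x + r) (by linarith [hx01.1])).trans
      ((h.minCentredDensity_le_left hA hB (by linarith [hx01.1]) (by linarith)).trans
      (measure_mono (Icc_subset_Icc_left h1.le)))
  rcases lt_or_ge 1 (x + r) with h2 | h2
  · have := h.minCentredDensity_le_right hA hB (x := 1 - (x - r))
      (by linarith [hx01.2]) (by linarith)
    rw [sub_sub_cancel] at this
    exact (hmono _ (by linarith [hx01.2])).trans
      (this.trans (measure_mono (Icc_subset_Icc_right h2.le)))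
  · exact h.minCentredDensity_mul_le hx hr (Icc_subset_Icc h1 h2)

/-- The cover of `K` by itself and balls of radius at most `1 / 2` suffice: disjoint balls have
total mass at most one, and each carries at least the minimal density times its length to the power
`α`. -/
theorem packingMeasure_le (hA : S.AssumptionA M) (hB : S.AssumptionB K) :
    packingMeasure α K ≤ (minCentredDensity α K)⁻¹ := by
  have := h.isProbabilityMeasure
  have := h.nullSingletonClass
  have hempty : packingPremeasure α ∅ = 0 := by
    refine le_antisymm (iInf₂_le_of_le 1 one_pos (iSup₂_le fun B hB => ?_)) zero_le
    have : B = ∅ := eq_empty_of_forall_notMem fun c hc => (hB.2.1 c hc).1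
    subst this
    simp
  have hK : packingPremeasure α K ≤ (minCentredDensity α K)⁻¹ := by
    refine iInf₂_le_of_le (1 / 2) (by norm_num) (iSup₂_le fun B hB' => ?_)
    obtain ⟨hBc, hBr, hBd⟩ := hB'
    rw [ENNReal.le_inv_iff_mul_le, mul_comm, ← ENNReal.tsum_mul_left]
    have := hBc.to_subtype
    calc _ ≤ ∑' c : B, normalizedHausdorff α K (Metric.ball c.1.1 c.1.2) := by
          refine ENNReal.tsum_le_tsum fun c => ?_
          obtain ⟨h1, h2, h3⟩ := hBr c c.2
          rw [Real.ball_eq_Ioo, Real.ediam_Ioo, measure_congr Ioo_ae_eq_Icc,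
            show c.1.1 + c.1.2 - (c.1.1 - c.1.2) = 2 * c.1.2 by ring]
          exact h.minCentredDensity_mul_le_of_small hA hB h1 h2 h3
      _ = normalizedHausdorff α K (⋃ c ∈ B, Metric.ball c.1 c.2) :=
          (measure_biUnion hBc hBd fun c _ => measurableSet_ball).symm
      _ ≤ 1 := prob_le_one
  refine iInf₂_le_of_le (fun i => if i = 0 then K else ∅)
    (subset_iUnion_of_subset 0 (by simp)) ?_
  rw [tsum_eq_single 0 (fun i hi => by simp [hi, hempty])]
  simpa using hK

theorem packingMeasure_eq (hA : S.AssumptionA M) (hB : S.AssumptionB K) :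
    packingMeasure α K = (minCentredDensity α K)⁻¹ :=
  le_antisymm (h.packingMeasure_le hA hB) (ENNReal.inv_le_iff_inv_le.1 h.inv_packingMeasure_le)

end IsRegularSystem

end LinearIFS

/-! ### Existence of the least generations and assembly -/

namespace LinearIFS

variable {n : ℕ} {S : LinearIFS n} {M : ℕ → Finset (List (Fin (n + 1)))} {K : Set ℝ} {α : ℝ}

theorem exists_isLeast_of_nonempty {p : ℕ → Prop} (h : ∃ j, p j) : ∃ k, IsLeast {j | p j} k := by
  classical
  exact ⟨Nat.find h, Nat.find_spec h, fun _ => Nat.find_min' h⟩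

theorem exists_noNewType [Finite (S.OverlapType M)] : ∃ j, S.NoNewType M j := by
  obtain ⟨N, hN⟩ := (Set.finite_range fun t : S.OverlapType M => t.out.gen).bddAbove
  exact ⟨N, fun I _ => ⟨(⟦I⟧ : S.OverlapType M).out, hN (mem_range_self _),
    Quotient.exact (Quotient.out_eq (⟦I⟧ : S.OverlapType M)).symm⟩⟩

namespace IsIslandSystem

theorem exists_diam_le [Finite (S.OverlapType M)] (h : S.IsIslandSystem K M) {ε : ℝ} (hε : 0 < ε) {x : ℝ} (hx : x ∈ K) :
    ∃ j, ∃ I ∈ S.islands M j, x ∈ I ∧ Metric.diam I ≤ ε := by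
  obtain ⟨j, hj⟩ := h.diam_tendsto hε
  obtain ⟨I, hI, hxI⟩ := h.exists_island_of_mem j hx
  exact ⟨j, I, hI, hxI, (hj j le_rfl I hI).le⟩

end IsIslandSystem

namespace IsRegularSystem

variable (h : S.IsRegularSystem K M α)
include h

theorem two_rpow_mul_le_density_iff {E : ℝ≥0∞} {u v : ℝ} (huv : u < v) :
    E ≤ 2 ^ (-α) * density α K (Icc u v) ↔
      E * ENNReal.ofReal (2 * (v - u)) ^ α ≤ normalizedHausdorff α K (Icc u v) := by
  rw [ENNReal.rpow_neg, ← ENNReal.div_eq_inv_mul, ENNReal.le_div_iff_mul_le (by simp)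
    (Or.inl (by simp)), h.le_density_iff huv, mul_assoc,
    ENNReal.ofReal_mul zero_le_two, ENNReal.ofReal_ofNat, ENNReal.mul_rpow_of_nonneg _ _ h.pos.le]

/-- Minimality of `k₀`, `k` and `k'` plays no part in the formula: any generations with the
respective properties give the same value. -/
theorem minCentredDensity_eq (hA : S.AssumptionA M) (hB : S.AssumptionB K) {k₀ k k' l : ℕ}
    {a b : ℕ → ℝ} {D₀ D₁ : ℝ≥0∞} (hk₀ : S.NoNewType M k₀)
    (hk : ∃ I ∈ S.islands M k, (0 : ℝ) ∈ I ∧ Metric.diam I ≤ S.ρ 0)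
    (hk' : ∃ I ∈ S.islands M k', (1 : ℝ) ∈ I ∧ Metric.diam I ≤ S.ρ (Fin.last n))
    (L : S.IsIslandList M (k₀ + 1) l a b)
    (h₀ : IsLeast {y | ∃ x : ℝ, 0 < x ∧ Icc 0 x ∈ S.field M k ∧ y = density α K (Icc 0 x)} D₀)
    (h₁ : IsLeast {y | ∃ x : ℝ, x < 1 ∧ Icc x 1 ∈ S.field M k' ∧ y = density α K (Icc x 1)} D₁) :
    minCentredDensity α K = min (2 ^ (-α) * D₀) (min (2 ^ (-α) * D₁) (pairMin α K l a b)) := by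
  refine le_antisymm (le_min ?_ (le_min ?_ (h.minCentredDensity_le_pairMin L))) ?_
  · obtain ⟨x, hx, hxF, rfl⟩ := h₀.1
    obtain ⟨u, v, H, hxe⟩ := h.endpoint_of_Icc_zero_mem_field hx hxF
    have := h.component_subset H
    rw [h.two_rpow_mul_le_density_iff hx, sub_zero]
    refine h.minCentredDensity_le_left hA hB hx ?_
    rcases hxe with rfl | rfl <;> linarith [H.lt]
  · obtain ⟨x, hx, hxF, rfl⟩ := h₁.1
    obtain ⟨u, v, H, hxe⟩ := h.endpoint_of_Icc_one_mem_field hx hxF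
    have := h.component_subset H
    rw [h.two_rpow_mul_le_density_iff hx]
    have := h.minCentredDensity_le_right hA hB (x := 1 - x) (by linarith)
      (by rcases hxe with rfl | rfl <;> linarith [H.lt])
    rwa [sub_sub_cancel] at this
  · set E := min (2 ^ (-α) * D₀) (min (2 ^ (-α) * D₁) (pairMin α K l a b))
    have hE₀ : E ≤ 2 ^ (-α) * D₀ := min_le_left _ _
    have hE₁ : E ≤ 2 ^ (-α) * D₁ := (min_le_right _ _).trans (min_le_left _ _)
    refine h.le_minCentredDensity hk₀ L ?_ ?_ ((min_le_right _ _).trans (min_le_right _ _))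
    · obtain ⟨I, hI, hxI, hd⟩ := hk
      obtain ⟨u, v, H, rfl⟩ := mem_islands_iff.1 hI
      obtain rfl : u = 0 := le_antisymm hxI.1 (h.component_subset H).1
      rw [Real.diam_Icc H.lt.le, sub_zero] at hd
      intro x hx0 hx1
      rw [ENNReal.ofReal_mul zero_le_two, ENNReal.mul_rpow_of_nonneg _ _ h.pos.le, ← mul_assoc]
      refine h.le_measure_left hB H hd (fun c d Hc y hy hy0 => ?_) hx0 hx1
      have := (h.two_rpow_mul_le_density_iff hy0).1 (hE₀.trans
        (mul_le_mul_right (h₀.2 ⟨y, hy0, h.Icc_zero_mem_field Hc hy hy0, rfl⟩) _))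
      rwa [sub_zero, ENNReal.ofReal_mul zero_le_two, ENNReal.mul_rpow_of_nonneg _ _ h.pos.le,
        ← mul_assoc] at this
    · obtain ⟨I, hI, hxI, hd⟩ := hk'
      obtain ⟨u, v, H, rfl⟩ := mem_islands_iff.1 hI
      obtain rfl : v = 1 := le_antisymm (h.component_subset H).2 hxI.2
      rw [Real.diam_Icc H.lt.le] at hd
      intro x hx0 hx1
      rw [ENNReal.ofReal_mul zero_le_two, ENNReal.mul_rpow_of_nonneg _ _ h.pos.le, ← mul_assoc]
      refine h.le_measure_right hB H hd (fun c d Hc y hy hy1 => ?_) hx0 hx1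
      have := (h.two_rpow_mul_le_density_iff hy1).1 (hE₁.trans
        (mul_le_mul_right (h₁.2 ⟨y, hy1, h.Icc_one_mem_field Hc hy hy1, rfl⟩) _))
      rwa [ENNReal.ofReal_mul zero_le_two, ENNReal.mul_rpow_of_nonneg _ _ h.pos.le,
        ← mul_assoc] at this

end IsRegularSystem

end LinearIFS

theorem theorem4p16 {n : ℕ} (hn : 1 ≤ n) (S : LinearIFS n)
    (horder : Monotone S.b) (hleft : S.map 0 0 = 0) (hright : S.map (Fin.last n) 1 = 1)
    (hinv : ∀ j, S.map j '' Ioo 0 1 ⊆ Ioo 0 1)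
    (K : Set ℝ) (hKne : K.Nonempty) (hKc : IsCompact K) (hK : K = ⋃ j, S.map j '' K)
    (M : ℕ → Finset (List (Fin (n + 1)))) (hM : LinearIFS.IsNestedIndexSeq M)
    (hnested : ∀ k, S.openUnion M (k + 1) ⊆ S.openUnion M k)
    (hfinite : Finite (S.OverlapType M))
    (α : ℝ≥0) (hdim : dimH K = α) (hα : α < 1)
    (T : S.OverlapType M → S.Island M) (hT : ∀ t, (⟦T t⟧ : S.OverlapType M) = t)
    (hirr : (S.incidenceMatrix M T α).IsIrreducible)
    (hA : S.AssumptionA M) (hB : S.AssumptionB K) :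
    ∃ (k₀ k k' l : ℕ) (a b : ℕ → ℝ) (D₀ D₁ : ℝ≥0∞),
      IsLeast {j | S.NoNewType M j} k₀ ∧
      IsLeast {j | ∃ I ∈ S.islands M j, (0 : ℝ) ∈ I ∧ Metric.diam I ≤ S.ρ 0} k ∧
      IsLeast {j | ∃ I ∈ S.islands M j, (1 : ℝ) ∈ I ∧ Metric.diam I ≤ S.ρ (Fin.last n)} k' ∧
      S.IsIslandList M (k₀ + 1) l a b ∧
      IsLeast {y | ∃ x : ℝ, 0 < x ∧ Icc 0 x ∈ S.field M k ∧ y = density α K (Icc 0 x)} D₀ ∧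
      IsLeast {y | ∃ x : ℝ, x < 1 ∧ Icc x 1 ∈ S.field M k' ∧ y = density α K (Icc x 1)} D₁ ∧
      minCentredDensity α K =
        min ((2 : ℝ≥0∞) ^ (-(α : ℝ)) * D₀)
          (min ((2 : ℝ≥0∞) ^ (-(α : ℝ)) * D₁) (pairMin α K l a b)) ∧
      packingMeasure α K = (minCentredDensity α K)⁻¹ := by
  have hsys : S.IsIslandSystem K M := ⟨hleft, hright, hinv, hKne, hKc, hK, hM, hnested⟩
  have htr := LinearIFS.isTransitive_of_isIrreducible T hT hirr
  obtain ⟨hpos, hne0, hneTop⟩ := hsys.hausdorffMeasure_dimH htr hdim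
  have h : S.IsRegularSystem K M (α : ℝ) :=
    ⟨hsys, hpos, hα, hne0, hneTop, hfinite, htr⟩
  obtain ⟨k₀, hk₀⟩ := LinearIFS.exists_isLeast_of_nonempty
    (LinearIFS.exists_noNewType (S := S) (M := M))
  obtain ⟨k, hk⟩ := LinearIFS.exists_isLeast_of_nonempty
    (hsys.exists_diam_le (S.ρ_pos 0) hsys.zero_mem)
  obtain ⟨k', hk'⟩ := LinearIFS.exists_isLeast_of_nonempty
    (hsys.exists_diam_le (S.ρ_pos (Fin.last n)) hsys.one_mem)
  obtain ⟨l, a, b, L⟩ :=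
    LinearIFS.exists_isIslandList (S := S) (M := M) (k₀ + 1)
  obtain ⟨D₀, h₀⟩ := hsys.exists_isLeast_left α k
  obtain ⟨D₁, h₁⟩ := hsys.exists_isLeast_right α k'
  exact ⟨k₀, k, k', l, a, b, D₀, D₁, hk₀, hk, hk', L, h₀, h₁,
    h.minCentredDensity_eq hA hB hk₀.1 hk.1 hk'.1 L h₀ h₁, h.packingMeasure_eq hA hB⟩
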